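/- Let $H\in(\tfrac12,1)$ and let $B^H=(B^H_t)_{t\in[0,1]}$ be a fractional Brownian motion with Hurst parameter $H$, that is, a centred Gaussian process with (almost surely) continuous paths and $\mathbf E[B^H_tB^H_s]=\tfrac12(t^{2H}+s^{2H}-|t-s|^{2H})$. For a centred Gaussian random variable $\Phi$ let $$\Phi^{\diamond k}:=\frac{\mathrm d^k}{\mathrm dw^k}\exp\bigl(w\Phi-\tfrac12\mathbf E[(w\Phi)^2]\bigr)\Big|_{w=0},\qquad k\ge 0,$$ be its Wick powers. For each $n\in\mathbb N$ let $\xi^n_1,\dots,\xi^n_n$ be independent $\{-1,1\}$-valued random variables with $P(\xi^n_i=1)=P(\xi^n_i=-1)$, all defined on a common probability space, and put, for $t\in[0,1]$ and $n\ge 1$, $$B^{H,n}_t:=\sum_{i=1}^{\lfloor nt\rfloor} n\int_{(i-1)/n}^{i/n} z_H\Bigl(\frac{\lfloor nt\rfloor}{n},s\Bigr)\,\mathrm ds\,\frac{1}{\sqrt n}\,\xi^n_i ,$$ where $$z_H(t,s)=\mathbf 1_{\{t\ge s\}}\,c_H\bigl(H-\tfrac12\bigr)s^{1/2-H}\int_s^t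 u^{H-1/2}(u-s)^{H-3/2}\,\mathrm du,\qquad c_H=\sqrt{\frac{2H\,\Gamma(3/2-H)}{\Gamma(H+1/2)\,\Gamma(2-2H)}} .$$ The discrete Wick product $\diamond_n$ is the bilinear product on $L^2(\sigma(\xi^n_1,\dots,\xi^n_n))$ with $\prod_{i\in A}\xi^n_i\diamond_n\prod_{i\in B}\xi^n_i=\prod_{i\in A\cup B}\xi^n_i$ if $A\cap B=\emptyset$, and $=0$ otherwise ($A,B\subseteq\{1,\dots,n\}$). Define $U^{k,n}_l$ by $$U^{k,n}_l=U^{k,n}_{l-1}+k\,U^{k-1,n}_{l-1}\diamond_n\bigl(B^{H,n}_{l/n}-B^{H,n}_{(l-1)/n}\bigr)\quad(k\ge 1,\ l=1,\dots,n),$$ with $U^{0,n}_l=1$ for all $l$ and $U^{k,n}_0=0$ for $k\ge1$, and let $\widetilde U^{k,n}_t:=U^{k,n}_{\lfloor nt\rfloor}$, $t\in[0,1]$. **(i)** Let $(a_{n,k})$ be real numbers such that $a_k:=\lim_{n\to\infty}a_{n,k}$ exists for every $k\ge 0$ and such that, for some constant $C\ge 0$, $|a_{n,k}|\le C^k$ for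 all $n,k\ge 1$. Then, almost surely, $\sum_{k=0}^{\infty}\frac{a_k}{k!}(B^H_t)^{\diamond k}$ converges for all $t\in[0,1]$ and is càdlàg in $t$, and the processes $$\sum_{k=0}^{n}\frac{a_{n,k}}{k!}\,\widetilde U^{k,n}$$ converge weakly to $\sum_{k=0}^{\infty}\frac{a_k}{k!}(B^H)^{\diamond k}$ in the Skorokhod space $D([0,1],\mathbb R)$ as $n\to\infty$. **(ii)** As a special case, let $S^n_l=S^n_{l-1}+S^n_{l-1}\diamond_n\bigl(B^{H,n}_{l/n}-B^{H,n}_{(l-1)/n}\bigr)$ for $l=1,\dots,n$, with $S^n_0=1$ (the Wick–Euler scheme). Then the piecewise constant interpolations $t\mapsto S^n_{\lfloor nt\rfloor}$ converge weakly in $D([0,1],\mathbb R)$ to the geometric fractional Brownian motion $t\mapsto\exp\bigl(B^H_t-\tfrac12t^{2H}\bigr)$. -/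

import Mathlib

open MeasureTheory ProbabilityTheory Filter Set
open scoped Topology ENNReal unitInterval

namespace WickFBM

/-! ### The Skorokhod space `D([0,1], ℝ)` -/

/-- Càdlàg functions on `[0,1]`: right-continuous at every point, with left limits. -/
@[ext]
structure SkorokhodSpace where
  toFun : I → ℝ
  right_continuous : ∀ t, ContinuousWithinAt toFun (Ici t) t
  left_limit : ∀ t, ∃ y, Tendsto toFun (𝓝[<] t) (𝓝 y)

namespace SkorokhodSpace

instance : CoeFun SkorokhodSpace (fun _ => I → ℝ) := ⟨SkorokhodSpace.toFun⟩

/-- Cost of a time change `φ`: the larger of `sup |φ t - t|` and `sup |f t - g (φ t)|`. -/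
noncomputable def cost (φ : I ≃o I) (f g : I → ℝ) : ℝ≥0∞ :=
  max (⨆ t, edist (φ t) t) (⨆ t, edist (f t) (g (φ t)))

/-- Skorokhod's metric: the infimum of the cost over all time changes, that is, over all
increasing bijections of `[0,1]` (which are automatically homeomorphisms). -/
noncomputable instance : EDist SkorokhodSpace := ⟨fun f g => ⨅ φ : I ≃o I, cost φ f g⟩

theorem edist_eq (f g : SkorokhodSpace) : edist f g = ⨅ φ : I ≃o I, cost φ f g := rfl

theorem edist_le_symm (f g : SkorokhodSpace) : edist g f ≤ edist f g := by
  rw [edist_eq f g]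
  refine le_iInf fun φ => (iInf_le _ φ.symm).trans (max_le_max ?_ ?_)
  · refine iSup_le fun t => ?_
    have := le_iSup (fun t : I => edist (φ t) t) (φ.symm t)
    simpa [edist_comm] using this
  · refine iSup_le fun t => ?_
    have := le_iSup (fun t : I => edist (f t) (g (φ t))) (φ.symm t)
    simpa [edist_comm] using this

theorem cost_trans (φ ψ : I ≃o I) (f g h : I → ℝ) :
    cost (φ.trans ψ) f h ≤ cost φ f g + cost ψ g h := by
  refine max_le (iSup_le fun t => ?_) (iSup_le fun t => ?_)
  · calc edist (ψ (φ t)) t ≤ edist (ψ (φ t)) (φ t) + edist (φ t) t := edist_triangle _ _ _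
      _ = edist (φ t) t + edist (ψ (φ t)) (φ t) := add_comm _ _
      _ ≤ _ := add_le_add
        (le_max_of_le_left (le_iSup (fun t : I => edist (φ t) t) t))
        (le_max_of_le_left (le_iSup (fun t : I => edist (ψ t) t) (φ t)))
  · calc edist (f t) (h (ψ (φ t))) ≤ edist (f t) (g (φ t)) + edist (g (φ t)) (h (ψ (φ t))) :=
        edist_triangle _ _ _
      _ ≤ _ := add_le_add
        (le_max_of_le_right (le_iSup (fun t : I => edist (f t) (g (φ t))) t))
        (le_max_of_le_right (le_iSup (fun t : I => edist (g t) (h (ψ t))) (φ t)))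

/-- The topology of this (extended pseudo-)metric is Skorokhod's `J₁` topology. -/
noncomputable instance : PseudoEMetricSpace SkorokhodSpace where
  edist_self f := by
    refine le_antisymm ((iInf_le _ (OrderIso.refl I)).trans ?_) bot_le
    simp [cost]
  edist_comm f g := le_antisymm (edist_le_symm g f) (edist_le_symm f g)
  edist_triangle f g h := by
    exact ENNReal.le_iInf_add_iInf fun φ ψ =>
      (iInf_le _ (φ.trans ψ)).trans (cost_trans φ ψ f g h)

/-- `D([0,1], ℝ)` carries its Borel `σ`-algebra. -/
noncomputable instance : MeasurableSpace SkorokhodSpace := borel SkorokhodSpace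

instance : BorelSpace SkorokhodSpace := ⟨rfl⟩

end SkorokhodSpace

theorem stepPath_right (n : ℕ) (u : ℕ → ℝ) (t : I) :
    ContinuousWithinAt (fun s : I => u ⌊(n : ℝ) * (s : ℝ)⌋₊) (Ici t) t := by
  have hc : Continuous fun s : I => (n : ℝ) * (s : ℝ) := by fun_prop
  have h1 : ∀ᶠ s : I in 𝓝[≥] t, (n : ℝ) * (s : ℝ) < (⌊(n : ℝ) * (t : ℝ)⌋₊ : ℝ) + 1 :=
    nhdsWithin_le_nhds (hc.continuousAt.eventually_lt continuousAt_const (Nat.lt_floor_add_one _))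
  refine (tendsto_const_nhds (x := u ⌊(n : ℝ) * (t : ℝ)⌋₊)).congr' ?_
  filter_upwards [h1, self_mem_nhdsWithin] with s hs hts
  have hts' : (t : ℝ) ≤ s := hts
  have h0 : (0 : ℝ) ≤ n * (s : ℝ) := mul_nonneg n.cast_nonneg s.2.1
  congr 1
  refine ((Nat.floor_eq_iff h0).2 ⟨?_, hs⟩).symm
  exact (Nat.floor_le (mul_nonneg n.cast_nonneg t.2.1)).trans
    (mul_le_mul_of_nonneg_left hts' n.cast_nonneg)

theorem stepPath_left (n : ℕ) (u : ℕ → ℝ) (t : I) :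
    ∃ y, Tendsto (fun s : I => u ⌊(n : ℝ) * (s : ℝ)⌋₊) (𝓝[<] t) (𝓝 y) := by
  have hc : Continuous fun s : I => (n : ℝ) * (s : ℝ) := by fun_prop
  refine ⟨u (⌈(n : ℝ) * (t : ℝ)⌉₊ - 1), ?_⟩
  rcases Nat.eq_zero_or_pos ⌈(n : ℝ) * (t : ℝ)⌉₊ with h | h
  · refine tendsto_const_nhds.congr' ?_
    filter_upwards [self_mem_nhdsWithin] with s hs
    have hts' : (s : ℝ) ≤ t := le_of_lt hs
    have h2 : (n : ℝ) * (s : ℝ) ≤ 0 :=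
      (mul_le_mul_of_nonneg_left hts' n.cast_nonneg).trans (Nat.ceil_eq_zero.1 h)
    rw [h, Nat.floor_of_nonpos h2]
  · have h1 : ∀ᶠ s : I in 𝓝[<] t, ((⌈(n : ℝ) * (t : ℝ)⌉₊ - 1 : ℕ) : ℝ) < (n : ℝ) * (s : ℝ) :=
      nhdsWithin_le_nhds (continuousAt_const.eventually_lt hc.continuousAt
        (Nat.lt_ceil.1 (by omega)))
    refine tendsto_const_nhds.congr' ?_
    filter_upwards [h1, self_mem_nhdsWithin] with s hs hst
    have hst' : (s : ℝ) < t := hst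
    have h0 : (0 : ℝ) ≤ n * (s : ℝ) := mul_nonneg n.cast_nonneg s.2.1
    have hn : (0 : ℝ) < n := by
      rcases Nat.eq_zero_or_pos n with hn | hn
      · subst hn
        simp at h
      · exact_mod_cast hn
    congr 1
    refine ((Nat.floor_eq_iff h0).2 ⟨hs.le, ?_⟩).symm
    have h3 : (n : ℝ) * (s : ℝ) < ⌈(n : ℝ) * (t : ℝ)⌉₊ :=
      (mul_lt_mul_of_pos_left hst' hn).trans_le (Nat.le_ceil _)
    have h4 : (((⌈(n : ℝ) * (t : ℝ)⌉₊ - 1 : ℕ) : ℝ) + 1) = ⌈(n : ℝ) * (t : ℝ)⌉₊ := by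
      exact_mod_cast Nat.sub_add_cancel h
    rwa [h4]

/-- The piecewise constant interpolation `t ↦ u ⌊n t⌋` as an element of `D([0,1], ℝ)`. -/
noncomputable def stepPath (n : ℕ) (u : ℕ → ℝ) : SkorokhodSpace where
  toFun t := u ⌊(n : ℝ) * (t : ℝ)⌋₊
  right_continuous := stepPath_right n u
  left_limit := stepPath_left n u

/-! ### Fractional Brownian motion and Wick powers of Gaussian variables -/

section Gaussian

variable {Ω : Type*} [MeasurableSpace Ω]

/-- `B` is a fractional Brownian motion on `[0,1]` with Hurst parameter `H`: a centred Gaussian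
process with almost surely continuous paths and the covariance of fractional Brownian motion. -/
structure IsFractionalBrownianMotion (H : ℝ) (B : I → Ω → ℝ) (P : Measure Ω) : Prop where
  gaussian : IsGaussianProcess B P
  mean_zero : ∀ t, ∫ ω, B t ω ∂P = 0
  covariance : ∀ s t, ∫ ω, B t ω * B s ω ∂P =
    ((t : ℝ) ^ (2 * H) + (s : ℝ) ^ (2 * H) - |(t : ℝ) - (s : ℝ)| ^ (2 * H)) / 2
  continuous : ∀ᵐ ω ∂P, Continuous fun t => B t ω

/-- The Wick exponential `exp(Φ - E[Φ²] / 2)` of a centred Gaussian random variable `Φ`. -/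
noncomputable def wickExp (P : Measure Ω) (Φ : Ω → ℝ) (ω : Ω) : ℝ :=
  Real.exp (Φ ω - (∫ ω', Φ ω' ^ 2 ∂P) / 2)

/-- The `k`-th Wick power of a centred Gaussian random variable `Φ`: the `k`-th derivative at
`w = 0` of the Wick exponential of `w Φ`. -/
noncomputable def wickPow (P : Measure Ω) (Φ : Ω → ℝ) (k : ℕ) (ω : Ω) : ℝ :=
  iteratedDeriv k (fun w : ℝ => wickExp P (fun ω' => w * Φ ω') ω) 0

end Gaussian

/-! ### The disturbed binary random walk -/

/-- The normalising constant `c_H` of the kernel. -/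
noncomputable def kernelConst (H : ℝ) : ℝ :=
  √(2 * H * Real.Gamma (3 / 2 - H) / (Real.Gamma (H + 1 / 2) * Real.Gamma (2 - 2 * H)))

/-- The Molchan–Golosov kernel `z_H(t, s)` for `1/2 < H < 1`. -/
noncomputable def kernel (H t s : ℝ) : ℝ :=
  if s ≤ t then
    kernelConst H * (H - 1 / 2) * s ^ (1 / 2 - H) *
      ∫ u in s..t, u ^ (H - 1 / 2) * (u - s) ^ (H - 3 / 2)
  else 0

section Discrete

variable {Ω : Type*} [MeasurableSpace Ω] {n : ℕ}

/-- `ξ` is an `n`-tuple of independent symmetric Bernoulli variables with values `±1`. -/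
structure IsSymmetricBernoulli (ξ : Fin n → Ω → ℝ) (P : Measure Ω) : Prop where
  measurable : ∀ i, Measurable (ξ i)
  values : ∀ i ω, ξ i ω = 1 ∨ ξ i ω = -1
  symmetric : ∀ i, P {ω | ξ i ω = 1} = P {ω | ξ i ω = -1}
  indep : iIndepFun ξ P

/-- The random walk `B^{H,n}_t = ∑_{i ≤ ⌊nt⌋} n (∫_{(i-1)/n}^{i/n} z_H(⌊nt⌋/n, s) ds) n^{-1/2} ξ_i`.
The variable written `ξ_i` with `1 ≤ i ≤ n` is `ξ ⟨i - 1, _⟩` here. -/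
noncomputable def walk (H : ℝ) (ξ : Fin n → Ω → ℝ) (t : ℝ) (ω : Ω) : ℝ :=
  ∑ i : Fin n with i.val + 1 ≤ ⌊(n : ℝ) * t⌋₊,
    (n : ℝ) * (∫ s in ((i.val : ℝ) / n)..(((i.val : ℝ) + 1) / n),
      kernel H ((⌊(n : ℝ) * t⌋₊ : ℝ) / n) s) * (1 / √(n : ℝ)) * ξ i ω

/-- The `l`-th increment `B^{H,n}_{l/n} - B^{H,n}_{(l-1)/n}`. -/
noncomputable def walkIncrement (H : ℝ) (ξ : Fin n → Ω → ℝ) (l : ℕ) (ω : Ω) : ℝ :=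
  walk H ξ ((l : ℝ) / n) ω - walk H ξ (((l : ℝ) - 1) / n) ω

/-! ### The discrete Wick product -/

/-- The Walsh function `Ξ_A = ∏_{i ∈ A} ξ_i`. -/
noncomputable def walsh (ξ : Fin n → Ω → ℝ) (A : Finset (Fin n)) (ω : Ω) : ℝ :=
  ∏ i ∈ A, ξ i ω

/-- The coefficient of `X` at `Ξ_A` in its Walsh decomposition; as the Walsh functions are an
orthonormal basis of `L²(σ(ξ))`, this is the inner product of `X` with `Ξ_A`. -/
noncomputable def walshCoeff (P : Measure Ω) (ξ : Fin n → Ω → ℝ) (X : Ω → ℝ)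
    (A : Finset (Fin n)) : ℝ :=
  ∫ ω, X ω * walsh ξ A ω ∂P

/-- The discrete Wick product of `X, Y ∈ L²(σ(ξ))`: the bilinear product for which
`Ξ_A ⋄ Ξ_B` is `Ξ_{A ∪ B}` if `A` and `B` are disjoint, and `0` otherwise. -/
noncomputable def discreteWick (P : Measure Ω) (ξ : Fin n → Ω → ℝ) (X Y : Ω → ℝ) (ω : Ω) : ℝ :=
  ∑ C : Finset (Fin n),
    (∑ p : Finset (Fin n) × Finset (Fin n) with p.1 ∪ p.2 = C ∧ p.1 ∩ p.2 = ∅,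
      walshCoeff P ξ X p.1 * walshCoeff P ξ Y p.2) * walsh ξ C ω

/-- `wickU P H ξ k l` is `U^{k,n}_l`, the solution of the system of Wick difference equations
`U^{k,n}_l = U^{k,n}_{l-1} + k U^{k-1,n}_{l-1} ⋄ₙ (B^{H,n}_{l/n} - B^{H,n}_{(l-1)/n})` for `k ≥ 1`,
with `U^{0,n}_l = 1` and, for `k ≥ 1`, `U^{k,n}_0 = 0`. -/
noncomputable def wickU (P : Measure Ω) (H : ℝ) (ξ : Fin n → Ω → ℝ) : ℕ → ℕ → Ω → ℝ
  | 0, _ => fun _ => 1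
  | _ + 1, 0 => fun _ => 0
  | k + 1, l + 1 => fun ω => wickU P H ξ (k + 1) l ω +
      ((k + 1 : ℕ) : ℝ) * discreteWick P ξ (wickU P H ξ k l) (walkIncrement H ξ (l + 1)) ω

/-- The Wick–Euler scheme
`S^n_l = S^n_{l-1} + S^n_{l-1} ⋄ₙ (B^{H,n}_{l/n} - B^{H,n}_{(l-1)/n})`, `S^n_0 = 1`. -/
noncomputable def wickEuler (P : Measure Ω) (H : ℝ) (ξ : Fin n → Ω → ℝ) : ℕ → Ω → ℝ
  | 0 => fun _ => 1
  | l + 1 => fun ω => wickEuler P H ξ l ω +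
      discreteWick P ξ (wickEuler P H ξ l) (walkIncrement H ξ (l + 1)) ω

end Discrete

end WickFBM

namespace WickFBM

/-! ### Walsh functions -/

section Walsh

variable {Ω : Type*} [MeasurableSpace Ω] {n : ℕ} {P : Measure Ω} {ξ : Fin n → Ω → ℝ}

/-! Everything is computed in the Walsh basis. Wick multiplication by a linear form in the `ξ i`
adds one new index to a Walsh set, so the schemes have explicit coefficients: `U^{k,n}_l` is the sum
over `|A| = k` of `k! w(l, A) Ξ_A`, where `w = wickCoeff` sums products of increments of the walk
coefficients `b` over injective assignments of time steps to the elements of `A`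
(`wickU_eq_walshSum`). Dropping injectivity would give `∏ i ∈ A, b l i`, the coefficients of the
discrete Wick power of the walk itself. The kernel is nonnegative and increasing in `t`, so all
increments of `b` are nonnegative; hence `0 ≤ w ≤ ∏ b`, and the increments of `w` in `l` are
dominated by those of `∏ b`. Parseval turns the `L²` estimates on the series into estimates on the
vectors `b l`.

These vectors are normalised cell averages of the kernel. Averaging contracts `L²`, and the kernel
reproduces the covariance of fractional Brownian motion (`lintegral_kernel_mul_kernel_of_le`:
Tonelli and a Beta integral). This gives `∑ (b l - b m)² ≤ ((l - m)/n)^{2H}`, and no energy is lost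
in the limit (`tendsto_integral_sq_sub_sum_cellCoeff_sq`).

At finitely many fixed times, the walk converges by a Lindeberg argument on characteristic functions
(`tendstoInDistribution_walk`). In `L²`, `w` may be replaced by `∏ b`, because coincidences of time
steps become negligible (`sum_pow_card_mul_prod_sub_wickCoeff_sq_le`). Discrete Wick powers satisfy
the Hermite recursion up to a vanishing error (`chaosSum_add_two`). So a truncated Wick series of
the walk is close in probability to a continuous function of the walk's value.

Passing to paths uses `2H > 1`: dyadic chaining (`exists_maximal_bound`) bounds the oscillation of
the series over a block. With mesh `1/m` and truncation at degree `m`, the series is uniformly close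
to a step function of `m + 1` values of the walk, outside an event whose probability is, up to a
term vanishing as `n → ∞`, a constant times `(m + 1)(Q m^{-2H} + R 2^{-m})`, which tends to `0`.
Uniform closeness bounds the Skorokhod distance, so `tendstoInDistribution_of_approximation`
concludes by letting `n → ∞` and then `m → ∞`; no separate tightness criterion is needed. The
Wick–Euler scheme is the case of all coefficients equal to `1`, where the limit series is the
Hermite generating function. -/

theorem IsSymmetricBernoulli.sq_eq_one (hξ : IsSymmetricBernoulli ξ P) (i : Fin n) (ω : Ω) :
    ξ i ω * ξ i ω = 1 := by
  rcases hξ.values i ω with h | h <;> rw [h] <;> norm_num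

theorem IsSymmetricBernoulli.abs_eq_one (hξ : IsSymmetricBernoulli ξ P) (i : Fin n) (ω : Ω) :
    |ξ i ω| = 1 := by
  rcases hξ.values i ω with h | h <;> rw [h] <;> norm_num

/-- The integral of a function of a symmetric Bernoulli variable. -/
theorem IsSymmetricBernoulli.integral_comp [IsProbabilityMeasure P]
    (hξ : IsSymmetricBernoulli ξ P) {E : Type*} [NormedAddCommGroup E] [NormedSpace ℝ E]
    [CompleteSpace E] (i : Fin n) (g : ℝ → E) :
    ∫ ω, g (ξ i ω) ∂P = (1 / 2 : ℝ) • (g 1 + g (-1)) := by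
  have hm1 : MeasurableSet {ω | ξ i ω = 1} := hξ.measurable i (measurableSet_singleton 1)
  have hcompl : {ω | ξ i ω = 1}ᶜ = {ω | ξ i ω = -1} := by
    ext ω
    rcases hξ.values i ω with h | h <;> simp [h] <;> norm_num
  have hhalf : P.real {ω | ξ i ω = 1} = 1 / 2 := by
    have h1 := probReal_compl_eq_one_sub (μ := P) hm1
    rw [hcompl] at h1
    have h2 : P.real {ω | ξ i ω = 1} = P.real {ω | ξ i ω = -1} := by
      rw [measureReal_def, measureReal_def, hξ.symmetric i]
    linarith
  have hhalf' : P.real {ω | ξ i ω = -1} = 1 / 2 := by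
    rw [← hhalf, measureReal_def, measureReal_def, hξ.symmetric i]
  have hfun : (fun ω => g (ξ i ω)) = fun ω =>
      {ω | ξ i ω = 1}.indicator (fun _ => g 1) ω +
        {ω | ξ i ω = -1}.indicator (fun _ => g (-1)) ω := by
    funext ω
    rcases hξ.values i ω with h | h
    · simp [h, Set.indicator]; intro h'; norm_num at h'
    · simp [h, Set.indicator]; intro h'; norm_num at h'
  have hm2 : MeasurableSet {ω | ξ i ω = -1} := hξ.measurable i (measurableSet_singleton (-1))
  rw [hfun, integral_add ((integrable_const _).indicator hm1)
    ((integrable_const _).indicator hm2), integral_indicator_const _ hm1,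
    integral_indicator_const _ hm2, hhalf, hhalf', smul_add]

theorem measurable_walsh (hξ : IsSymmetricBernoulli ξ P) (A : Finset (Fin n)) :
    Measurable (walsh ξ A) := by
  unfold walsh
  exact Finset.measurable_fun_prod _ fun i _ => hξ.measurable i

theorem abs_walsh (hξ : IsSymmetricBernoulli ξ P) (A : Finset (Fin n)) (ω : Ω) :
    |walsh ξ A ω| = 1 := by
  rw [walsh, Finset.abs_prod]
  exact Finset.prod_eq_one fun i _ => hξ.abs_eq_one i ω

theorem integrable_walsh_mul [IsProbabilityMeasure P] (hξ : IsSymmetricBernoulli ξ P)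
    (A B : Finset (Fin n)) : Integrable (fun ω => walsh ξ A ω * walsh ξ B ω) P := by
  refine Integrable.of_bound
    ((measurable_walsh hξ A).mul (measurable_walsh hξ B)).aestronglyMeasurable 1
    (ae_of_all _ fun ω => ?_)
  rw [Real.norm_eq_abs, abs_mul, abs_walsh hξ, abs_walsh hξ, one_mul]

/-- If `A ≠ B`, some index lies in exactly one of the sets; independence splits off that single
centred factor, which kills the integral. -/
theorem integral_walsh_mul [IsProbabilityMeasure P] (hξ : IsSymmetricBernoulli ξ P)
    (A B : Finset (Fin n)) :
    ∫ ω, walsh ξ A ω * walsh ξ B ω ∂P = if A = B then 1 else 0 := by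
  split_ifs with h
  · subst h
    have : ∀ ω, walsh ξ A ω * walsh ξ A ω = 1 := fun ω => by
      rw [walsh, ← Finset.prod_mul_distrib]
      exact Finset.prod_eq_one fun i _ => hξ.sq_eq_one i ω
    simp [this]
  · let f : Fin n → ℝ → ℝ := fun i x => (if i ∈ A then x else 1) * (if i ∈ B then x else 1)
    have hf : ∀ ω, walsh ξ A ω * walsh ξ B ω = ∏ i, f i (ξ i ω) := fun ω => by
      simp only [f, Finset.prod_mul_distrib, Finset.prod_ite_mem, Finset.univ_inter, walsh]
    have hfm : ∀ i, Measurable (f i) := fun i => by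
      simp only [f]
      by_cases hA : i ∈ A <;> by_cases hB : i ∈ B <;> simp only [hA, hB, if_true, if_false] <;>
        fun_prop
    simp_rw [hf]
    rw [hξ.indep.integral_fun_prod_comp (fun i => (hξ.measurable i).aemeasurable)
      (fun i => (hfm i).aestronglyMeasurable)]
    have hex : ∃ i, ¬ (i ∈ A ↔ i ∈ B) := by
      by_contra hcon
      push Not at hcon
      exact h (Finset.ext hcon)
    obtain ⟨i, hi⟩ := hex
    refine Finset.prod_eq_zero (Finset.mem_univ i) ?_
    rw [hξ.integral_comp i (f i)]
    by_cases hA : i ∈ A <;> by_cases hB : i ∈ B <;> simp [f, hA, hB] at hi ⊢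

/-- The random variable with Walsh coefficients `c`. -/
noncomputable def walshSum (ξ : Fin n → Ω → ℝ) (c : Finset (Fin n) → ℝ) (ω : Ω) : ℝ :=
  ∑ A, c A * walsh ξ A ω

theorem measurable_walshSum (hξ : IsSymmetricBernoulli ξ P) (c : Finset (Fin n) → ℝ) :
    Measurable (walshSum ξ c) := by
  unfold walshSum
  exact Finset.measurable_fun_sum _ fun A _ => (measurable_walsh hξ A).const_mul _

theorem walshSum_sub (c c' : Finset (Fin n) → ℝ) (ω : Ω) :
    walshSum ξ c ω - walshSum ξ c' ω = walshSum ξ (fun A => c A - c' A) ω := by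
  simp only [walshSum, ← Finset.sum_sub_distrib, sub_mul]

theorem integrable_walshSum_mul_walsh [IsProbabilityMeasure P] (hξ : IsSymmetricBernoulli ξ P)
    (c : Finset (Fin n) → ℝ) (A : Finset (Fin n)) :
    Integrable (fun ω => walshSum ξ c ω * walsh ξ A ω) P := by
  simp only [walshSum, Finset.sum_mul, mul_assoc]
  exact integrable_finsetSum _ fun B _ => (integrable_walsh_mul hξ B A).const_mul _

theorem walshCoeff_walshSum [IsProbabilityMeasure P] (hξ : IsSymmetricBernoulli ξ P)
    (c : Finset (Fin n) → ℝ) (A : Finset (Fin n)) :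
    walshCoeff P ξ (walshSum ξ c) A = c A := by
  simp only [walshCoeff, walshSum, Finset.sum_mul, mul_assoc]
  rw [integral_finsetSum _ fun B _ => (integrable_walsh_mul hξ B A).const_mul _]
  simp [integral_const_mul, integral_walsh_mul hξ]

/-- Parseval's identity for Walsh functions. -/
theorem integral_walshSum_sq [IsProbabilityMeasure P] (hξ : IsSymmetricBernoulli ξ P)
    (c : Finset (Fin n) → ℝ) :
    ∫ ω, walshSum ξ c ω ^ 2 ∂P = ∑ A, c A ^ 2 := by
  have h : ∀ ω, walshSum ξ c ω ^ 2 = ∑ A, c A * (walshSum ξ c ω * walsh ξ A ω) := fun ω => by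
    rw [sq]
    nth_rewrite 2 [walshSum]
    rw [Finset.mul_sum]
    exact Finset.sum_congr rfl fun A _ => by ring
  simp_rw [h]
  rw [integral_finsetSum _ fun A _ => (integrable_walshSum_mul_walsh hξ c A).const_mul _]
  refine Finset.sum_congr rfl fun A _ => ?_
  rw [integral_const_mul, sq]
  congr 1
  exact walshCoeff_walshSum hξ c A

theorem integrable_walshSum_sq [IsProbabilityMeasure P] (hξ : IsSymmetricBernoulli ξ P)
    (c : Finset (Fin n) → ℝ) : Integrable (fun ω => walshSum ξ c ω ^ 2) P := by
  refine Integrable.of_bound ((measurable_walshSum hξ c).pow_const 2).aestronglyMeasurable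
    ((∑ A, |c A|) ^ 2) (ae_of_all _ fun ω => ?_)
  rw [Real.norm_eq_abs, abs_pow]
  refine pow_le_pow_left₀ (abs_nonneg _) ?_ 2
  refine (Finset.abs_sum_le_sum_abs _ _).trans (le_of_eq ?_)
  exact Finset.sum_congr rfl fun A _ => by rw [abs_mul, abs_walsh hξ, mul_one]

/-! ### The discrete Wick product in terms of Walsh coefficients -/

/-- The linear form `∑ i, y i * ξ i` as a Walsh sum. -/
theorem sum_mul_eq_walshSum (y : Fin n → ℝ) (ω : Ω) :
    ∑ i, y i * ξ i ω = walshSum ξ (fun A => ∑ i, if A = {i} then y i else 0) ω := by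
  simp only [walshSum, Finset.sum_mul]
  rw [Finset.sum_comm]
  refine Finset.sum_congr rfl fun i _ => ?_
  simp [ite_mul, walsh]

/-- A linear form has Walsh coefficients only at singletons, and the only disjoint decomposition of
`C` with second part `{i}` is `C.erase i ∪ {i}`. -/
theorem discreteWick_walshSum_linear [IsProbabilityMeasure P] (hξ : IsSymmetricBernoulli ξ P)
    (c : Finset (Fin n) → ℝ) (y : Fin n → ℝ) (ω : Ω) :
    discreteWick P ξ (walshSum ξ c) (fun ω => ∑ i, y i * ξ i ω) ω =
      walshSum ξ (fun A => ∑ i ∈ A, c (A.erase i) * y i) ω := by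
  have hY : (fun ω => ∑ i, y i * ξ i ω) =
      walshSum ξ (fun A => ∑ i, if A = {i} then y i else 0) :=
    funext fun ω => sum_mul_eq_walshSum y ω
  rw [hY, discreteWick]
  change _ = ∑ C, _ * walsh ξ C ω
  refine Finset.sum_congr rfl fun C _ => ?_
  congr 1
  simp only [walshCoeff_walshSum hξ, Finset.mul_sum]
  rw [Finset.sum_comm, ← Finset.sum_subset (Finset.subset_univ C)]
  · refine Finset.sum_congr rfl fun i hi => ?_
    rw [Finset.sum_eq_single (C.erase i, {i})]
    · simp
    · rintro ⟨p, q⟩ hp hne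
      simp only [Finset.mem_filter, Finset.mem_univ, true_and] at hp
      rw [if_neg, mul_zero]
      rintro rfl
      apply hne
      rw [← hp.1, Prod.mk.injEq]
      refine ⟨?_, rfl⟩
      have hip : i ∉ p := fun h => by
        have : i ∈ p ∩ {i} := by simp [h]
        simp [hp.2] at this
      ext j
      simp only [Finset.mem_erase, Finset.mem_union, Finset.mem_singleton]
      grind
    · intro h
      exfalso
      apply h
      simp only [Finset.mem_filter, Finset.mem_univ, true_and]
      constructor
      · ext j; simp only [Finset.mem_erase, Finset.mem_union, Finset.mem_singleton]; grind
      · ext j; simp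
  · intro i _ hi
    refine Finset.sum_eq_zero ?_
    rintro ⟨p, q⟩ hp
    simp only [Finset.mem_filter, Finset.mem_univ, true_and] at hp
    rw [if_neg, mul_zero]
    rintro rfl
    apply hi
    rw [← hp.1]
    simp

end Walsh

/-! ### Walsh coefficients of the Wick difference equations -/

/-- The coefficients `w(l, A) = ∑ ∏_{i ∈ A} (b (j i) i - b (j i - 1) i)`, summed over the injective
maps `j : A → {1, …, l}`, of the solution of a linear Wick difference equation. -/
noncomputable def wickCoeff {ι : Type*} [DecidableEq ι] (b : ℕ → ι → ℝ) : ℕ → Finset ι → ℝ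
  | 0, A => if A = ∅ then 1 else 0
  | l + 1, A => wickCoeff b l A + ∑ i ∈ A, wickCoeff b l (A.erase i) * (b (l + 1) i - b l i)

theorem wickCoeff_empty {ι : Type*} [DecidableEq ι] (b : ℕ → ι → ℝ) (l : ℕ) :
    wickCoeff b l ∅ = 1 := by
  induction l with
  | zero => simp [wickCoeff]
  | succ l ih => simp [wickCoeff, ih]

/-- The coefficients `b l i` of the disturbed random walk. -/
noncomputable def walkCoeff (H : ℝ) (n : ℕ) (l : ℕ) (i : Fin n) : ℝ :=
  √(n : ℝ) * ∫ s in ((i.val : ℝ) / n)..(((i.val : ℝ) + 1) / n), kernel H ((l : ℝ) / n) s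

/-- The kernel vanishes for `s > t`. This lets the truncated sum defining the walk be extended to
all of `Fin n`, so that increments can be taken coefficientwise. -/
theorem walkCoeff_eq_zero {H : ℝ} {n l : ℕ} {i : Fin n} (h : l ≤ i.val) :
    walkCoeff H n l i = 0 := by
  have hn : (0 : ℝ) < n := by exact_mod_cast i.pos
  rw [walkCoeff, intervalIntegral.integral_of_le (by gcongr; linarith),
    setIntegral_eq_zero_of_forall_eq_zero, mul_zero]
  intro s hs
  rw [kernel, if_neg]
  have : (l : ℝ) / n ≤ (i.val : ℝ) / n := by gcongr
  linarith [hs.1]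

section Expansion

variable {Ω : Type*} [MeasurableSpace Ω] {n : ℕ} {P : Measure Ω} {ξ : Fin n → Ω → ℝ} {H : ℝ}

theorem walk_div (hn : n ≠ 0) (l : ℕ) (ω : Ω) :
    walk H ξ ((l : ℝ) / n) ω = ∑ i, walkCoeff H n l i * ξ i ω := by
  have hn' : (n : ℝ) ≠ 0 := by exact_mod_cast hn
  have hfl : ⌊(n : ℝ) * ((l : ℝ) / n)⌋₊ = l := by
    rw [mul_div_cancel₀ _ hn', Nat.floor_natCast]
  rw [walk, hfl, Finset.sum_filter]
  refine Finset.sum_congr rfl fun i _ => ?_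
  split_ifs with h
  · rw [walkCoeff]
    congr 1
    have : (n : ℝ) * (1 / √(n : ℝ)) = √(n : ℝ) := by
      rw [mul_one_div, Real.div_sqrt]
    rw [mul_right_comm, this]
  · rw [walkCoeff_eq_zero (by omega), zero_mul]

theorem walkIncrement_succ (hn : n ≠ 0) (l : ℕ) (ω : Ω) :
    walkIncrement H ξ (l + 1) ω =
      ∑ i, (walkCoeff H n (l + 1) i - walkCoeff H n l i) * ξ i ω := by
  have : (((l + 1 : ℕ) : ℝ) - 1) / n = (l : ℝ) / n := by push_cast; ring
  rw [walkIncrement, this, walk_div hn, walk_div hn, ← Finset.sum_sub_distrib]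
  exact Finset.sum_congr rfl fun i _ => by ring

/-- Each step of the recursion raises the degree by one and contributes a factor `k`, which
accumulates to `k!`; what remains is exactly the recursion for `wickCoeff`. -/
theorem wickU_eq_walshSum [IsProbabilityMeasure P] (hξ : IsSymmetricBernoulli ξ P) (hn : n ≠ 0)
    (k l : ℕ) :
    wickU P H ξ k l = walshSum ξ (fun A =>
      if A.card = k then (k.factorial : ℝ) * wickCoeff (walkCoeff H n) l A else 0) := by
  induction k, l using wickU.induct with
  | case1 l =>
    funext ω
    simp only [wickU, walshSum, Finset.card_eq_zero, ite_mul, zero_mul]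
    simp [wickCoeff_empty, walsh]
  | case2 k =>
    funext ω
    rw [wickU, walshSum, Finset.sum_eq_zero]
    intro A _
    split_ifs with h
    · rw [wickCoeff, if_neg, mul_zero, zero_mul]
      rintro rfl
      simp at h
    · rw [zero_mul]
  | case3 k l ih1 ih2 =>
    funext ω
    have hinc : walkIncrement H ξ (l + 1) = fun ω =>
        ∑ i, (walkCoeff H n (l + 1) i - walkCoeff H n l i) * ξ i ω :=
      funext fun ω => walkIncrement_succ hn l ω
    rw [wickU, ih1, ih2, hinc]
    beta_reduce
    rw [discreteWick_walshSum_linear hξ]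
    simp only [walshSum]
    rw [Finset.mul_sum, ← Finset.sum_add_distrib]
    refine Finset.sum_congr rfl fun A _ => ?_
    rw [← mul_assoc, ← add_mul]
    congr 1
    split_ifs with h
    · rw [wickCoeff, mul_add]
      congr 1
      rw [Finset.mul_sum, Finset.mul_sum, Nat.factorial_succ]
      refine Finset.sum_congr rfl fun i hi => ?_
      rw [if_pos (by rw [Finset.card_erase_of_mem hi, h]; rfl)]
      push_cast
      ring
    · rw [Finset.sum_eq_zero, mul_zero, add_zero]
      intro i hi
      rw [if_neg, zero_mul]
      have := Finset.card_erase_add_one hi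
      omega

/-- Subsets of `Fin n` have at most `n` elements, so summing up to `k = n` meets every Walsh set
exactly once, and the factorials cancel. -/
theorem sum_wickU_eq_walshSum [IsProbabilityMeasure P] (hξ : IsSymmetricBernoulli ξ P) (hn : n ≠ 0)
    (a : ℕ → ℝ) (l : ℕ) (ω : Ω) :
    ∑ k ∈ Finset.range (n + 1), a k / (k.factorial : ℝ) * wickU P H ξ k l ω =
      walshSum ξ (fun A => a A.card * wickCoeff (walkCoeff H n) l A) ω := by
  simp only [wickU_eq_walshSum hξ hn, walshSum, Finset.mul_sum]
  rw [Finset.sum_comm]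
  refine Finset.sum_congr rfl fun A _ => ?_
  rw [Finset.sum_eq_single A.card]
  · rw [if_pos rfl, ← mul_assoc, ← mul_assoc,
      div_mul_cancel₀ _ (by exact_mod_cast A.card.factorial_ne_zero)]
  · intro k _ hk
    rw [if_neg (Ne.symm hk), zero_mul, mul_zero]
  · intro h
    exfalso
    apply h
    rw [Finset.mem_range]
    have := Finset.card_le_univ A
    simp at this
    omega

theorem wickEuler_eq_walshSum [IsProbabilityMeasure P] (hξ : IsSymmetricBernoulli ξ P) (hn : n ≠ 0)
    (l : ℕ) : wickEuler P H ξ l = walshSum ξ (wickCoeff (walkCoeff H n) l) := by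
  induction l with
  | zero =>
    funext ω
    simp [wickEuler, walshSum, wickCoeff, walsh]
  | succ l ih =>
    funext ω
    have hinc : walkIncrement H ξ (l + 1) = fun ω =>
        ∑ i, (walkCoeff H n (l + 1) i - walkCoeff H n l i) * ξ i ω :=
      funext fun ω => walkIncrement_succ hn l ω
    rw [wickEuler, ih, hinc]
    beta_reduce
    rw [discreteWick_walshSum_linear hξ]
    simp only [walshSum]
    rw [← Finset.sum_add_distrib]
    exact Finset.sum_congr rfl fun A _ => by rw [wickCoeff, add_mul]

end Expansion

/-! ### Sums over subsets -/

section Subsets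

variable {ι : Type*} [DecidableEq ι]

/-- The left side consists of the terms of order zero and one in `d`; the others are nonnegative. -/
theorem prod_add_sum_le_prod_add (A : Finset ι) {x d : ι → ℝ} (hx : ∀ i, 0 ≤ x i)
    (hd : ∀ i, 0 ≤ d i) :
    ∏ i ∈ A, x i + ∑ i ∈ A, (∏ j ∈ A.erase i, x j) * d i ≤ ∏ i ∈ A, (x i + d i) := by
  induction A using Finset.induction_on with
  | empty => simp
  | insert a A ha ih =>
    rw [Finset.prod_insert ha, Finset.prod_insert ha, Finset.sum_insert ha,
      Finset.erase_insert ha]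
    have h : ∑ i ∈ A, (∏ j ∈ (insert a A).erase i, x j) * d i =
        x a * ∑ i ∈ A, (∏ j ∈ A.erase i, x j) * d i := by
      rw [Finset.mul_sum]
      refine Finset.sum_congr rfl fun i hi => ?_
      have hia : a ≠ i := by rintro rfl; exact ha hi
      rw [Finset.erase_insert_of_ne hia, Finset.prod_insert (by simp [ha])]
      ring
    have h1 : ∏ i ∈ A, x i ≤ ∏ i ∈ A, (x i + d i) :=
      Finset.prod_le_prod (fun i _ => hx i) fun i _ => by linarith [hd i]
    rw [h, add_mul]
    nlinarith [mul_le_mul_of_nonneg_left ih (hx a), mul_le_mul_of_nonneg_left h1 (hd a)]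

/-- Change the factors one at a time and bound the untouched ones by the larger `x`. -/
theorem prod_sub_prod_le (A : Finset ι) {x y : ι → ℝ} (hy : ∀ i, 0 ≤ y i)
    (hyx : ∀ i, y i ≤ x i) :
    ∏ i ∈ A, x i - ∏ i ∈ A, y i ≤ ∑ i ∈ A, (∏ j ∈ A.erase i, x j) * (x i - y i) := by
  induction A using Finset.induction_on with
  | empty => simp
  | insert a A ha ih =>
    rw [Finset.prod_insert ha, Finset.prod_insert ha, Finset.sum_insert ha,
      Finset.erase_insert ha]
    have h : ∑ i ∈ A, (∏ j ∈ (insert a A).erase i, x j) * (x i - y i) =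
        x a * ∑ i ∈ A, (∏ j ∈ A.erase i, x j) * (x i - y i) := by
      rw [Finset.mul_sum]
      refine Finset.sum_congr rfl fun i hi => ?_
      have hia : a ≠ i := by rintro rfl; exact ha hi
      rw [Finset.erase_insert_of_ne hia, Finset.prod_insert (by simp [ha])]
      ring
    have h1 : ∏ i ∈ A, y i ≤ ∏ i ∈ A, x i :=
      Finset.prod_le_prod (fun i _ => hy i) fun i _ => hyx i
    rw [h]
    nlinarith [mul_le_mul_of_nonneg_left ih ((hy a).trans (hyx a)),
      mul_le_mul_of_nonneg_left h1 (sub_nonneg.2 (hyx a))]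

variable [Fintype ι]

/-- Double counting: a set with a marked element corresponds to an element and a set avoiding it. -/
theorem sum_sum_erase {M : Type*} [AddCommMonoid M] (f : ι → Finset ι → M) :
    ∑ A : Finset ι, ∑ i ∈ A, f i (A.erase i) = ∑ i, ∑ A : Finset ι with i ∉ A, f i A := by
  have h : ∀ A : Finset ι, ∑ i ∈ A, f i (A.erase i) =
      ∑ i, if i ∈ A then f i (A.erase i) else 0 := fun A => by simp
  simp_rw [h]
  rw [Finset.sum_comm]
  refine Finset.sum_congr rfl fun i _ => ?_
  rw [← Finset.sum_filter]
  refine Finset.sum_nbij' (fun A => A.erase i) (fun A => insert i A) ?_ ?_ ?_ ?_ ?_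
  · intro A _; simp
  · intro A _; simp
  · intro A hA
    exact Finset.insert_erase (by simpa using hA)
  · intro A hA
    exact Finset.erase_insert (by simpa using hA)
  · intro A _; rfl

theorem sum_pow_card_mul_prod (c : ℝ) (x : ι → ℝ) :
    ∑ A : Finset ι, c ^ A.card * ∏ i ∈ A, x i = ∏ i, (1 + c * x i) := by
  rw [Finset.prod_one_add, Finset.powerset_univ]
  exact Finset.sum_congr rfl fun A _ => by rw [Finset.prod_mul_distrib, Finset.prod_const]

theorem sum_pow_card_mul_prod_le {c : ℝ} (hc : 0 ≤ c) {x : ι → ℝ} (hx : ∀ i, 0 ≤ x i) :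
    ∑ A : Finset ι, c ^ A.card * ∏ i ∈ A, x i ≤ Real.exp (c * ∑ i, x i) := by
  rw [sum_pow_card_mul_prod, Finset.mul_sum, Real.exp_sum]
  refine Finset.prod_le_prod (fun i _ => ?_) fun i _ => ?_
  · have := mul_nonneg hc (hx i); linarith
  · rw [add_comm]; exact Real.add_one_le_exp _

theorem sum_pow_card_mul_prod_not_mem_le {c : ℝ} (hc : 0 ≤ c) {x : ι → ℝ} (hx : ∀ i, 0 ≤ x i)
    (i : ι) :
    ∑ A : Finset ι with i ∉ A, c ^ A.card * ∏ j ∈ A, x j ≤ Real.exp (c * ∑ i, x i) :=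
  (Finset.sum_le_sum_of_subset_of_nonneg (Finset.filter_subset _ _) fun A _ _ =>
    mul_nonneg (pow_nonneg hc _) (Finset.prod_nonneg fun j _ => hx j)).trans
    (sum_pow_card_mul_prod_le hc hx)

/-- Lipschitz estimate in `ℓ²` for the Wick exponential. -/
theorem sum_pow_card_mul_prod_sub_sq_le {c : ℝ} (hc : 0 ≤ c) {x y : ι → ℝ} (hy : ∀ i, 0 ≤ y i)
    (hyx : ∀ i, y i ≤ x i) :
    ∑ A : Finset ι, c ^ A.card * (∏ i ∈ A, x i - ∏ i ∈ A, y i) ^ 2 ≤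
      2 * c * Real.exp (2 * c * ∑ i, x i ^ 2) * ∑ i, (x i - y i) ^ 2 := by
  have hx : ∀ i, 0 ≤ x i := fun i => (hy i).trans (hyx i)
  have hpt : ∀ A : Finset ι, c ^ A.card * (∏ i ∈ A, x i - ∏ i ∈ A, y i) ^ 2 ≤
      ∑ i ∈ A, (2 * c) ^ ((A.erase i).card + 1) *
        ((∏ j ∈ A.erase i, x j ^ 2) * (x i - y i) ^ 2) := by
    intro A
    have h0 : 0 ≤ ∏ i ∈ A, x i - ∏ i ∈ A, y i :=
      sub_nonneg.2 (Finset.prod_le_prod (fun i _ => hy i) fun i _ => hyx i)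
    -- Cauchy–Schwarz over `i ∈ A` costs a factor `|A| ≤ 2 ^ |A|`, absorbed by passing from `c` to
    -- `2 * c`.
    have h2 : ((A.card : ℕ) : ℝ) ≤ 2 ^ A.card := by exact_mod_cast A.card.lt_two_pow_self.le
    calc c ^ A.card * (∏ i ∈ A, x i - ∏ i ∈ A, y i) ^ 2
        ≤ c ^ A.card * (∑ i ∈ A, (∏ j ∈ A.erase i, x j) * (x i - y i)) ^ 2 :=
          mul_le_mul_of_nonneg_left (pow_le_pow_left₀ h0 (prod_sub_prod_le A hy hyx) 2)
            (pow_nonneg hc _)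
      _ ≤ c ^ A.card * (2 ^ A.card * ∑ i ∈ A, ((∏ j ∈ A.erase i, x j) * (x i - y i)) ^ 2) := by
          refine mul_le_mul_of_nonneg_left (sq_sum_le_card_mul_sum_sq.trans ?_) (pow_nonneg hc _)
          exact mul_le_mul_of_nonneg_right h2 (Finset.sum_nonneg fun i _ => sq_nonneg _)
      _ = _ := by
          rw [← mul_assoc, ← mul_pow, mul_comm c 2, Finset.mul_sum]
          refine Finset.sum_congr rfl fun i hi => ?_
          rw [Finset.card_erase_add_one hi, mul_pow _ (x i - y i), Finset.prod_pow]
  refine (Finset.sum_le_sum fun A _ => hpt A).trans ?_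
  rw [sum_sum_erase (fun i A => (2 * c) ^ (A.card + 1) *
        ((∏ j ∈ A, x j ^ 2) * (x i - y i) ^ 2)), Finset.mul_sum]
  refine Finset.sum_le_sum fun i _ => ?_
  have := sum_pow_card_mul_prod_not_mem_le (c := 2 * c) (by positivity)
    (x := fun i => x i ^ 2) (fun i => sq_nonneg _) i
  calc ∑ A : Finset ι with i ∉ A, (2 * c) ^ (A.card + 1) *
        ((∏ j ∈ A, x j ^ 2) * (x i - y i) ^ 2)
      = 2 * c * (∑ A : Finset ι with i ∉ A, (2 * c) ^ A.card * ∏ j ∈ A, x j ^ 2) *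
          (x i - y i) ^ 2 := by
        rw [Finset.mul_sum, Finset.sum_mul]
        exact Finset.sum_congr rfl fun A _ => by ring
    _ ≤ _ := by gcongr

end Subsets

/-! ### Estimates for the coefficients of the Wick difference equations -/

section WickCoeff

variable {ι : Type*} [DecidableEq ι] {b : ℕ → ι → ℝ}

theorem wickCoeff_nonneg (hb : ∀ i, Monotone fun l => b l i) (l : ℕ) (A : Finset ι) :
    0 ≤ wickCoeff b l A := by
  induction l generalizing A with
  | zero => rw [wickCoeff]; split_ifs <;> norm_num
  | succ l ih =>
    rw [wickCoeff]
    exact add_nonneg (ih A) (Finset.sum_nonneg fun i _ =>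
      mul_nonneg (ih _) (sub_nonneg.2 (hb i l.le_succ)))

theorem wickCoeff_le_succ (hb : ∀ i, Monotone fun l => b l i) (l : ℕ) (A : Finset ι) :
    wickCoeff b l A ≤ wickCoeff b (l + 1) A := by
  rw [wickCoeff]
  exact le_add_of_nonneg_right (Finset.sum_nonneg fun i _ =>
    mul_nonneg (wickCoeff_nonneg hb _ _) (sub_nonneg.2 (hb i l.le_succ)))

theorem wickCoeff_mono (hb : ∀ i, Monotone fun l => b l i) (A : Finset ι) :
    Monotone fun l => wickCoeff b l A :=
  monotone_nat_of_le_succ fun l => wickCoeff_le_succ hb l A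

theorem coeff_nonneg (hb : ∀ i, Monotone fun l => b l i) (h0 : ∀ i, b 0 i = 0) (l : ℕ) (i : ι) :
    0 ≤ b l i := (h0 i).ge.trans (hb i l.zero_le)

theorem prod_coeff_add_sum_le (hb : ∀ i, Monotone fun l => b l i) (h0 : ∀ i, b 0 i = 0) (l : ℕ)
    (A : Finset ι) : ∏ i ∈ A, b l i + ∑ i ∈ A, (∏ j ∈ A.erase i, b l j) * (b (l + 1) i - b l i) ≤
      ∏ i ∈ A, b (l + 1) i := by
  have := prod_add_sum_le_prod_add A (x := b l) (d := fun i => b (l + 1) i - b l i)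
    (coeff_nonneg hb h0 l) fun i => sub_nonneg.2 (hb i l.le_succ)
  simpa using this

/-- The product is the same sum taken over all maps `A → {1, …, l}`, not only the injective ones,
and every term is nonnegative. -/
theorem wickCoeff_le_prod (hb : ∀ i, Monotone fun l => b l i) (h0 : ∀ i, b 0 i = 0) (l : ℕ)
    (A : Finset ι) : wickCoeff b l A ≤ ∏ i ∈ A, b l i := by
  induction l generalizing A with
  | zero =>
    rw [wickCoeff]
    split_ifs with h
    · simp [h]
    · exact Finset.prod_nonneg fun i _ => (h0 i).ge
  | succ l ih =>
    rw [wickCoeff]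
    refine (add_le_add (ih A) (Finset.sum_le_sum fun i _ => ?_)).trans
      (prod_coeff_add_sum_le hb h0 l A)
    exact mul_le_mul_of_nonneg_right (ih _) (sub_nonneg.2 (hb i l.le_succ))

/-- One step adds to `wickCoeff` only first-order terms with smaller cofactors than the
corresponding terms in the expansion of the product; summing over the steps gives the claim. -/
theorem wickCoeff_sub_le (hb : ∀ i, Monotone fun l => b l i) (h0 : ∀ i, b 0 i = 0) {m l : ℕ}
    (hml : m ≤ l) (A : Finset ι) :
    wickCoeff b l A - wickCoeff b m A ≤ ∏ i ∈ A, b l i - ∏ i ∈ A, b m i := by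
  induction l, hml using Nat.le_induction with
  | base => simp
  | succ l hml ih =>
    have h1 : wickCoeff b (l + 1) A - wickCoeff b l A ≤
        ∑ i ∈ A, (∏ j ∈ A.erase i, b l j) * (b (l + 1) i - b l i) := by
      rw [wickCoeff, add_sub_cancel_left]
      exact Finset.sum_le_sum fun i _ => mul_le_mul_of_nonneg_right
        (wickCoeff_le_prod hb h0 _ _) (sub_nonneg.2 (hb i l.le_succ))
    have h2 := prod_coeff_add_sum_le hb h0 l A
    linarith

variable [Fintype ι]

theorem sum_pow_card_mul_wickCoeff_sub_sq_le (hb : ∀ i, Monotone fun l => b l i)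
    (h0 : ∀ i, b 0 i = 0) {c : ℝ} (hc : 0 ≤ c) {m l : ℕ} (hml : m ≤ l) :
    ∑ A : Finset ι, c ^ A.card * (wickCoeff b l A - wickCoeff b m A) ^ 2 ≤
      2 * c * Real.exp (2 * c * ∑ i, b l i ^ 2) * ∑ i, (b l i - b m i) ^ 2 := by
  refine le_trans (Finset.sum_le_sum fun A _ => ?_)
    (sum_pow_card_mul_prod_sub_sq_le hc (coeff_nonneg hb h0 m) fun i => hb i hml)
  exact mul_le_mul_of_nonneg_left (pow_le_pow_left₀
    (sub_nonneg.2 (wickCoeff_mono hb A hml)) (wickCoeff_sub_le hb h0 hml A) 2) (pow_nonneg hc _)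

theorem sum_pow_card_mul_wickCoeff_sq_le (hb : ∀ i, Monotone fun l => b l i)
    (h0 : ∀ i, b 0 i = 0) {c : ℝ} (hc : 0 ≤ c) (l : ℕ) :
    ∑ A : Finset ι, c ^ A.card * wickCoeff b l A ^ 2 ≤ Real.exp (c * ∑ i, b l i ^ 2) := by
  refine le_trans (Finset.sum_le_sum fun A _ => ?_)
    (sum_pow_card_mul_prod_le hc fun i => sq_nonneg (b l i))
  rw [Finset.prod_pow]
  exact mul_le_mul_of_nonneg_left (pow_le_pow_left₀
    (wickCoeff_nonneg hb _ _) (wickCoeff_le_prod hb h0 l A) 2) (pow_nonneg hc _)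

theorem exp_le_one_add_add_sq_mul_exp {x : ℝ} (hx : 0 ≤ x) :
    Real.exp x ≤ 1 + x + x ^ 2 * Real.exp x := by
  have h1 : Real.exp x - 1 ≤ x * Real.exp x := by
    have h := mul_le_mul_of_nonneg_left (Real.add_one_le_exp (-x)) (Real.exp_pos x).le
    rw [← Real.exp_add, add_neg_cancel, Real.exp_zero] at h
    linarith
  nlinarith [mul_le_mul_of_nonneg_left h1 hx]

/-- The pairing of the solution of the Wick difference equation with the Wick exponential of the
final value of the walk satisfies an approximate linear recursion. -/
theorem sum_pow_card_mul_prod_mul_wickCoeff_succ_ge (hb : ∀ i, Monotone fun l => b l i)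
    (h0 : ∀ i, b 0 i = 0) {c β : ℝ} (hc : 0 ≤ c) {j L : ℕ} (hj : j ≤ L)
    (hβ : ∀ i, b L i ^ 2 ≤ β) :
    (1 + c * ∑ i, b L i * (b (j + 1) i - b j i)) *
        ∑ A : Finset ι, c ^ A.card * ((∏ i ∈ A, b L i) * wickCoeff b j A) -
      c ^ 2 * β * (∑ i, b L i * (b (j + 1) i - b j i)) * Real.exp (c * ∑ i, b L i ^ 2) ≤
    ∑ A : Finset ι, c ^ A.card * ((∏ i ∈ A, b L i) * wickCoeff b (j + 1) A) := by
  set x := b L with hx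
  set d : ι → ℝ := fun i => b (j + 1) i - b j i with hd
  have hx0 : ∀ i, 0 ≤ x i := coeff_nonneg hb h0 L
  have hd0 : ∀ i, 0 ≤ d i := fun i => sub_nonneg.2 (hb i j.le_succ)
  set F : Finset ι → ℝ := fun A => c ^ A.card * ((∏ i ∈ A, x i) * wickCoeff b j A) with hF
  -- The recursion is exactly linear except that the new index `i` must avoid `A`.
  have h1 : ∑ A : Finset ι, c ^ A.card * ((∏ i ∈ A, x i) * wickCoeff b (j + 1) A) =
      ∑ A, F A + ∑ i, c * (x i * d i) * ∑ A : Finset ι with i ∉ A, F A := by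
    have h2 : ∀ A : Finset ι, c ^ A.card * ((∏ i ∈ A, x i) * wickCoeff b (j + 1) A) =
        F A + ∑ i ∈ A, c * (x i * d i) * F (A.erase i) := by
      intro A
      rw [wickCoeff, mul_add, mul_add, Finset.mul_sum, Finset.mul_sum]
      congr 1
      refine Finset.sum_congr rfl fun i hi => ?_
      simp only [hF]
      rw [← Finset.mul_prod_erase A x hi, ← Finset.card_erase_add_one hi, pow_succ]
      ring
    simp_rw [h2]
    rw [Finset.sum_add_distrib, sum_sum_erase (fun i A => c * (x i * d i) * F A)]
    simp_rw [Finset.mul_sum]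
  -- Dropping the restriction `i ∉ A` costs the sets containing `i`; each carries a factor `c * x i
  -- ^ 2 ≤ c * β`.
  have h3 : ∀ i, ∑ A, F A - c * β * Real.exp (c * ∑ i, x i ^ 2) ≤
      ∑ A : Finset ι with i ∉ A, F A := by
    intro i
    rw [← Finset.sum_filter_add_sum_filter_not Finset.univ (fun A : Finset ι => i ∉ A) F]
    have h4 : ∑ A : Finset ι with ¬ i ∉ A, F A ≤ c * β * Real.exp (c * ∑ i, x i ^ 2) := by
      have h5 : ∑ A : Finset ι with ¬ i ∉ A, F A ≤
          ∑ A : Finset ι with i ∈ A, c * x i ^ 2 *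
            (c ^ (A.erase i).card * ∏ j ∈ A.erase i, x j ^ 2) := by
        simp only [not_not]
        refine Finset.sum_le_sum fun A hA => ?_
        have hi : i ∈ A := by simpa using hA
        calc F A ≤ c ^ A.card * ((∏ i ∈ A, x i) * ∏ i ∈ A, x i) := by
              refine mul_le_mul_of_nonneg_left (mul_le_mul_of_nonneg_left
                ((wickCoeff_mono hb A hj).trans (wickCoeff_le_prod hb h0 L A))
                (Finset.prod_nonneg fun i _ => hx0 i)) (pow_nonneg hc _)
          _ = _ := by
              rw [← Finset.mul_prod_erase A x hi, ← Finset.card_erase_add_one hi, pow_succ,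
                Finset.prod_pow]
              ring
      refine h5.trans ?_
      have h6 : ∑ A : Finset ι with i ∈ A, c * x i ^ 2 *
            (c ^ (A.erase i).card * ∏ j ∈ A.erase i, x j ^ 2) =
          c * x i ^ 2 * ∑ A : Finset ι with i ∉ A, c ^ A.card * ∏ j ∈ A, x j ^ 2 := by
        rw [Finset.mul_sum]
        refine Finset.sum_nbij' (fun A => A.erase i) (fun A => insert i A) ?_ ?_ ?_ ?_ ?_
        · intro A _; simp
        · intro A _; simp
        · intro A hA
          exact Finset.insert_erase (by simpa using hA)
        · intro A hA
          exact Finset.erase_insert (by simpa using hA)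
        · intro A _; rfl
      rw [h6]
      have h7 := sum_pow_card_mul_prod_not_mem_le hc (x := fun i => x i ^ 2)
        (fun i => sq_nonneg _) i
      have h8 := hβ i
      have h9 : 0 ≤ β := (sq_nonneg _).trans h8
      gcongr
    linarith
  rw [h1]
  have h4 : ∑ i, c * (x i * d i) * (∑ A, F A - c * β * Real.exp (c * ∑ i, x i ^ 2)) ≤
      ∑ i, c * (x i * d i) * ∑ A : Finset ι with i ∉ A, F A :=
    Finset.sum_le_sum fun i _ => mul_le_mul_of_nonneg_left (h3 i)
      (mul_nonneg hc (mul_nonneg (hx0 i) (hd0 i)))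
  rw [← Finset.sum_mul, ← Finset.mul_sum] at h4
  linarith

/-- The solution of the linear Wick difference equation is close to the Wick exponential. -/
theorem sum_pow_card_mul_prod_sub_wickCoeff_sq_le (hb : ∀ i, Monotone fun l => b l i)
    (h0 : ∀ i, b 0 i = 0) {c β η : ℝ} (hc : 0 ≤ c) (L : ℕ)
    (hβ0 : 0 ≤ β) (hβ : ∀ i, b L i ^ 2 ≤ β)
    (hη : ∀ j < L, ∑ i, b L i * (b (j + 1) i - b j i) ≤ η) :
    ∑ A : Finset ι, c ^ A.card * (∏ i ∈ A, b L i - wickCoeff b L A) ^ 2 ≤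
      c ^ 2 * (η + β) * (∑ i, b L i ^ 2) * Real.exp (2 * c * ∑ i, b L i ^ 2) := by
  set V := ∑ i, b L i ^ 2 with hV
  set δ : ℕ → ℝ := fun j => ∑ i, b L i * (b (j + 1) i - b j i) with hδ
  set Ψ : ℕ → ℝ := fun j => ∑ A : Finset ι, c ^ A.card * ((∏ i ∈ A, b L i) * wickCoeff b j A)
    with hΨ
  have hx0 : ∀ i, 0 ≤ b L i := coeff_nonneg hb h0 L
  have hδ0 : ∀ j, 0 ≤ δ j := fun j => Finset.sum_nonneg fun i _ =>
    mul_nonneg (hx0 i) (sub_nonneg.2 (hb i j.le_succ))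
  set S : ℕ → ℝ := fun j => ∑ i, b L i * b j i with hS
  have hSsucc : ∀ j, S (j + 1) = S j + δ j := fun j => by
    simp only [hS, hδ, ← Finset.sum_add_distrib]
    exact Finset.sum_congr rfl fun i _ => by ring
  have hS0 : ∀ j, 0 ≤ S j := fun j => Finset.sum_nonneg fun i _ =>
    mul_nonneg (hx0 i) (coeff_nonneg hb h0 j i)
  have hSL : S L = V := Finset.sum_congr rfl fun i _ => by ring
  have hSV : ∀ j ≤ L, S j ≤ V := fun j hj => by
    rw [← hSL]
    exact Finset.sum_le_sum fun i _ => mul_le_mul_of_nonneg_left (hb i hj) (hx0 i)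
  -- The exact comparison grows by `exp (c δ)`, while `Ψ` grows by at least `1 + c δ` up to the
  -- excluded sets. The discrepancies `c² δ η` and `c² β δ`, times `exp (c V)`, accumulate because
  -- `∑ δ` telescopes to `S`.
  have key : ∀ j ≤ L, Real.exp (c * S j) - Ψ j ≤
      c ^ 2 * (η + β) * Real.exp (c * V) * S j * Real.exp (c * S j) := by
    intro j
    induction j with
    | zero =>
      intro _
      have h1 : S 0 = 0 := Finset.sum_eq_zero fun i _ => by rw [h0, mul_zero]
      have h2 : Ψ 0 = 1 := by simp [hΨ, wickCoeff]
      rw [h1, h2]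
      simp
    | succ j ih =>
      intro hj
      have ih := ih (by omega)
      have hrec : (1 + c * δ j) * Ψ j - c ^ 2 * β * δ j * Real.exp (c * V) ≤ Ψ (j + 1) :=
        sum_pow_card_mul_prod_mul_wickCoeff_succ_ge hb h0 hc (by omega : j ≤ L) hβ
      have hδη : δ j ≤ η := hη j (by omega)
      have hη0 : 0 ≤ η := (hδ0 j).trans hδη
      have hcδ : 0 ≤ c * δ j := mul_nonneg hc (hδ0 j)
      have he := exp_le_one_add_add_sq_mul_exp hcδ
      have hadd : Real.exp (c * S (j + 1)) = Real.exp (c * δ j) * Real.exp (c * S j) := by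
        rw [← Real.exp_add, hSsucc]; congr 1; ring
      have h1 : Real.exp (c * S (j + 1)) ≤ Real.exp (c * V) :=
        Real.exp_le_exp.2 (mul_le_mul_of_nonneg_left (hSV _ hj) hc)
      have h2 : Real.exp (c * S (j + 1)) ≤
          (1 + c * δ j) * Real.exp (c * S j) + c ^ 2 * (δ j * η) * Real.exp (c * V) := by
        calc Real.exp (c * S (j + 1))
            ≤ (1 + c * δ j + (c * δ j) ^ 2 * Real.exp (c * δ j)) * Real.exp (c * S j) := by
              rw [hadd]; gcongr
          _ = (1 + c * δ j) * Real.exp (c * S j) +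
              c ^ 2 * (δ j * δ j) * Real.exp (c * S (j + 1)) := by rw [hadd]; ring
          _ ≤ _ := by
              have := hδ0 j
              gcongr
      set M := c ^ 2 * (η + β) * Real.exp (c * V) with hM
      have hM0 : 0 ≤ M := by positivity
      have h3 : (1 + c * δ j) * (Real.exp (c * S j) - Ψ j) ≤
          M * S j * Real.exp (c * S (j + 1)) := by
        calc (1 + c * δ j) * (Real.exp (c * S j) - Ψ j)
            ≤ (1 + c * δ j) * (M * S j * Real.exp (c * S j)) := by gcongr
          _ ≤ Real.exp (c * δ j) * (M * S j * Real.exp (c * S j)) := by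
              have := hS0 j
              have h4 : 1 + c * δ j ≤ Real.exp (c * δ j) := by
                rw [add_comm]; exact Real.add_one_le_exp _
              gcongr
          _ = _ := by rw [hadd]; ring
      have h5 : M * δ j ≤ M * δ j * Real.exp (c * S (j + 1)) := by
        refine le_mul_of_one_le_right (mul_nonneg hM0 (hδ0 j)) (Real.one_le_exp ?_)
        exact mul_nonneg hc (hS0 _)
      have h6 : M * S (j + 1) * Real.exp (c * S (j + 1)) =
          M * S j * Real.exp (c * S (j + 1)) + M * δ j * Real.exp (c * S (j + 1)) := by
        rw [hSsucc j]; ring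
      have h7 : M * δ j = c ^ 2 * (δ j * η) * Real.exp (c * V) +
          c ^ 2 * β * δ j * Real.exp (c * V) := by rw [hM]; ring
      linarith
  have hfin := key L le_rfl
  rw [hSL] at hfin
  -- Since `0 ≤ w ≤ p`, one has `(p - w)² ≤ p² - p w`, so a lower bound on the pairing `∑ c^|A| p w`
  -- suffices.
  have hpt : ∀ A : Finset ι, c ^ A.card * (∏ i ∈ A, b L i - wickCoeff b L A) ^ 2 ≤
      c ^ A.card * ∏ i ∈ A, b L i ^ 2 - c ^ A.card * ((∏ i ∈ A, b L i) * wickCoeff b L A) := by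
    intro A
    rw [← mul_sub, Finset.prod_pow]
    refine mul_le_mul_of_nonneg_left ?_ (pow_nonneg hc _)
    nlinarith [wickCoeff_nonneg hb L A, wickCoeff_le_prod hb h0 L A]
  have h1 := sum_pow_card_mul_prod_le hc (x := fun i => b L i ^ 2) fun i => sq_nonneg _
  have h2 : Real.exp (2 * c * V) = Real.exp (c * V) * Real.exp (c * V) := by
    rw [← Real.exp_add]; congr 1; ring
  calc ∑ A : Finset ι, c ^ A.card * (∏ i ∈ A, b L i - wickCoeff b L A) ^ 2
      ≤ ∑ A : Finset ι, (c ^ A.card * ∏ i ∈ A, b L i ^ 2 -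
          c ^ A.card * ((∏ i ∈ A, b L i) * wickCoeff b L A)) := Finset.sum_le_sum fun A _ => hpt A
    _ ≤ Real.exp (c * V) - Ψ L := by
        rw [Finset.sum_sub_distrib]
        exact sub_le_sub_right h1 _
    _ ≤ _ := by
        rw [h2]
        linarith

end WickCoeff

/-! ### Elementary symmetric polynomials and the Hermite recursion -/

section Esymm

variable {ι : Type*} [Fintype ι] [DecidableEq ι]

/-- The recursion `(k + 1) e_{k+1} = e_1 e_k - p_2 e_{k-1} + …` for elementary symmetric
polynomials, with the correction in terms of squares. -/
theorem sum_mul_sum_card_eq (y : ι → ℝ) (k : ℕ) :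
    (∑ i, y i) * ∑ A : Finset ι with A.card = k + 1, ∏ i ∈ A, y i =
      ((k : ℝ) + 2) * ∑ A : Finset ι with A.card = k + 2, ∏ i ∈ A, y i +
      ((∑ i, y i ^ 2) * ∑ A : Finset ι with A.card = k, ∏ i ∈ A, y i -
        ∑ A : Finset ι with A.card = k, (∑ i ∈ A, y i ^ 2) * ∏ i ∈ A, y i) := by
  -- Pairs `(i, A)` with `|A| = k + 1` are split by whether `i ∈ A`. If not, `insert i A` arises `k
  -- + 2` times; if so, removing `i` leaves `y i ^ 2` times a product over a `k`-set avoiding `i`.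
  have h1 : ((k : ℝ) + 2) * ∑ A : Finset ι with A.card = k + 2, ∏ i ∈ A, y i =
      ∑ i, ∑ A : Finset ι with i ∉ A, if A.card = k + 1 then y i * ∏ j ∈ A, y j else 0 := by
    rw [← sum_sum_erase (fun i A => if A.card = k + 1 then y i * ∏ j ∈ A, y j else 0),
      Finset.sum_filter, Finset.mul_sum]
    refine Finset.sum_congr rfl fun A _ => ?_
    split_ifs with hA
    · rw [Finset.sum_congr rfl (g := fun _ => ∏ i ∈ A, y i), Finset.sum_const, hA, nsmul_eq_mul]
      · push_cast; ring
      · intro i hi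
        rw [if_pos (by rw [Finset.card_erase_of_mem hi, hA]; rfl), Finset.mul_prod_erase A y hi]
    · rw [mul_zero, Finset.sum_eq_zero]
      intro i hi
      have := Finset.card_erase_add_one hi
      rw [if_neg (by omega)]
  have h2 : (∑ i, y i ^ 2) * ∑ A : Finset ι with A.card = k, ∏ i ∈ A, y i -
        ∑ A : Finset ι with A.card = k, (∑ i ∈ A, y i ^ 2) * ∏ i ∈ A, y i =
      ∑ i, ∑ A : Finset ι with i ∉ A, if A.card = k then y i ^ 2 * ∏ j ∈ A, y j else 0 := by
    have h3 : ∀ i, ∑ A : Finset ι with i ∉ A, (if A.card = k then y i ^ 2 * ∏ j ∈ A, y j else 0) =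
        ∑ A : Finset ι with A.card = k, if i ∉ A then y i ^ 2 * ∏ j ∈ A, y j else 0 := fun i => by
      rw [Finset.sum_filter, Finset.sum_filter]
      refine Finset.sum_congr rfl fun A _ => ?_
      split_ifs <;> rfl
    simp_rw [h3]
    rw [Finset.sum_comm, Finset.mul_sum, ← Finset.sum_sub_distrib]
    refine Finset.sum_congr rfl fun A _ => ?_
    rw [← sub_mul, ← Finset.sum_filter, ← Finset.sum_mul]
    congr 1
    rw [sub_eq_iff_eq_add, ← Finset.sum_filter_add_sum_filter_not Finset.univ (fun i => i ∉ A)]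
    congr 1
    exact Finset.sum_congr (by ext; simp) fun _ _ => rfl
  have h4 : ∑ i, ∑ A : Finset ι with i ∉ A, (if A.card = k then y i ^ 2 * ∏ j ∈ A, y j else 0) =
      ∑ i, ∑ A : Finset ι with ¬ i ∉ A, if A.card = k + 1 then y i * ∏ j ∈ A, y j else 0 := by
    rw [← sum_sum_erase (fun i A => if A.card = k then y i ^ 2 * ∏ j ∈ A, y j else 0)]
    simp_rw [Finset.sum_filter]
    rw [Finset.sum_comm]
    refine Finset.sum_congr rfl fun A _ => ?_
    simp only [not_not]
    rw [Finset.sum_ite_mem, Finset.univ_inter]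
    refine Finset.sum_congr rfl fun i hi => ?_
    have := Finset.card_erase_add_one hi
    by_cases hA : A.card = k + 1
    · rw [if_pos hA, if_pos (by omega), ← Finset.mul_prod_erase A y hi]
      ring
    · rw [if_neg hA, if_neg (by omega)]
  rw [h1, h2, h4, ← Finset.sum_add_distrib, Finset.sum_mul]
  refine Finset.sum_congr rfl fun i _ => ?_
  rw [Finset.sum_filter_add_sum_filter_not, ← Finset.sum_filter, Finset.mul_sum]

end Esymm

/-! ### The covariance of the Molchan–Golosov kernel -/

section Kernel

theorem setLIntegral_Ioo_ofReal_eq {f : ℝ → ℝ} {a b : ℝ} (hab : a ≤ b)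
    (hf : IntervalIntegrable f volume a b) (hf0 : ∀ x ∈ Ioo a b, 0 ≤ f x) :
    ∫⁻ x in Ioo a b, ENNReal.ofReal (f x) = ENNReal.ofReal (∫ x in a..b, f x) := by
  rw [intervalIntegral.integral_of_le hab, integral_Ioc_eq_integral_Ioo,
    ofReal_integral_eq_lintegral_ofReal]
  · exact ((intervalIntegrable_iff_integrableOn_Ioo_of_le hab).1 hf)
  · exact (ae_restrict_mem measurableSet_Ioo).mono hf0

theorem setLIntegral_Ioo_ofReal_sub_left_rpow {r a b : ℝ} (hr : -1 < r) (hab : a ≤ b) :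
    ∫⁻ x in Ioo a b, ENNReal.ofReal ((x - a) ^ r) =
      ENNReal.ofReal ((b - a) ^ (r + 1) / (r + 1)) := by
  rw [setLIntegral_Ioo_ofReal_eq hab]
  · rw [intervalIntegral.integral_comp_sub_right (fun x => x ^ r), sub_self,
      integral_rpow (Or.inl hr), Real.zero_rpow (by linarith), sub_zero]
  · have := (intervalIntegral.intervalIntegrable_rpow' (a := 0) (b := b - a) hr).comp_sub_right a
    simpa using this
  · exact fun x hx => Real.rpow_nonneg (by linarith [hx.1]) _

theorem setLIntegral_Ioo_ofReal_sub_right_rpow {r a b : ℝ} (hr : -1 < r) (hab : a ≤ b) :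
    ∫⁻ x in Ioo a b, ENNReal.ofReal ((b - x) ^ r) =
      ENNReal.ofReal ((b - a) ^ (r + 1) / (r + 1)) := by
  rw [setLIntegral_Ioo_ofReal_eq hab]
  · rw [intervalIntegral.integral_comp_sub_left (fun x => x ^ r), sub_self,
      integral_rpow (Or.inl hr), Real.zero_rpow (by linarith), sub_zero]
  · have := (intervalIntegral.intervalIntegrable_rpow' (a := b - a) (b := 0) hr).comp_sub_left b
    simpa using this
  · exact fun x hx => Real.rpow_nonneg (by linarith [hx.2]) _

/-- Read off from the fact that the Beta density has total mass one. -/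
theorem setLIntegral_beta {a b : ℝ} (ha : 0 < a) (hb : 0 < b) :
    ∫⁻ y in Ioo (0 : ℝ) 1, ENNReal.ofReal (y ^ (a - 1) * (1 - y) ^ (b - 1)) =
      ENNReal.ofReal (beta a b) := by
  have h := lintegral_betaPDF_eq_one ha hb
  have hB := beta_pos ha hb
  rw [lintegral_betaPDF] at h
  have h1 : ∀ x : ℝ, ENNReal.ofReal (1 / beta a b * x ^ (a - 1) * (1 - x) ^ (b - 1)) =
      ENNReal.ofReal (1 / beta a b) * ENNReal.ofReal (x ^ (a - 1) * (1 - x) ^ (b - 1)) :=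
    fun x => by rw [← ENNReal.ofReal_mul (by positivity), mul_assoc]
  simp_rw [h1] at h
  rw [lintegral_const_mul _ (by fun_prop)] at h
  calc _ = ENNReal.ofReal (beta a b) * (ENNReal.ofReal (1 / beta a b) *
        ∫⁻ y in Ioo (0 : ℝ) 1, ENNReal.ofReal (y ^ (a - 1) * (1 - y) ^ (b - 1))) := by
        rw [← mul_assoc, ← ENNReal.ofReal_mul hB.le, mul_one_div_cancel hB.ne']
        simp
    _ = _ := by rw [h, mul_one]

/-- The Jacobian times the Beta integrand for the substitution below, with `S = s`, `D = v - u`, `U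
= u`, `V = v`, `E = u - s`, `F = v - s`. In logarithmic variables it is a linear identity of
exponents. -/
theorem beta_substitution_identity {S D U V E F : ℝ} (hS : 0 < S) (hD : 0 < D) (hU : 0 < U)
    (hV : 0 < V) (hE : 0 < E) (hF : 0 < F) (α : ℝ) :
    D * V / (U * F ^ 2) * ((S * D / (U * F)) ^ (-(2 * α)) * (V * E / (U * F)) ^ (α - 1)) =
      D ^ (1 - 2 * α) * (S ^ (-(2 * α)) * E ^ (α - 1) * F ^ (α - 1) * (U ^ α * V ^ α)) := by
  obtain ⟨s, rfl⟩ : ∃ s, S = Real.exp s := ⟨_, (Real.exp_log hS).symm⟩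
  obtain ⟨d, rfl⟩ : ∃ s, D = Real.exp s := ⟨_, (Real.exp_log hD).symm⟩
  obtain ⟨u, rfl⟩ : ∃ s, U = Real.exp s := ⟨_, (Real.exp_log hU).symm⟩
  obtain ⟨v, rfl⟩ : ∃ s, V = Real.exp s := ⟨_, (Real.exp_log hV).symm⟩
  obtain ⟨e, rfl⟩ : ∃ s, E = Real.exp s := ⟨_, (Real.exp_log hE).symm⟩
  obtain ⟨f, rfl⟩ : ∃ s, F = Real.exp s := ⟨_, (Real.exp_log hF).symm⟩
  rw [sq]
  simp only [← Real.exp_add, ← Real.exp_sub, ← Real.exp_mul]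
  congr 1
  ring

/-- The Möbius map `y = s (v - u) / (u (v - s))` carries `(0, u)` onto `(0, 1)` with `1 - y = v (u -
s) / (u (v - s))`, and turns the integral into a Beta integral times a power of `v - u`. -/
theorem setLIntegral_rpow_mul_sub_rpow {α u v : ℝ} (hα : 0 < α) (hα' : α < 1 / 2) (hu : 0 < u)
    (huv : u < v) :
    ∫⁻ s in Ioo 0 u, ENNReal.ofReal
        (s ^ (-(2 * α)) * (u - s) ^ (α - 1) * (v - s) ^ (α - 1) * (u ^ α * v ^ α)) =
      ENNReal.ofReal (beta (1 - 2 * α) α * (v - u) ^ (2 * α - 1)) := by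
  have hv : 0 < v := hu.trans huv
  have hD : 0 < v - u := sub_pos.2 huv
  set f : ℝ → ℝ := fun s => s * (v - u) / (u * (v - s)) with hf
  have hderiv : ∀ s ∈ Ioo 0 u, HasDerivWithinAt f ((v - u) * v / (u * (v - s) ^ 2)) (Ioo 0 u) s := by
    intro s hs
    have hF : 0 < v - s := by linarith [hs.2]
    have h1 : HasDerivAt (fun s => s * (v - u)) (1 * (v - u)) s := (hasDerivAt_id s).mul_const _
    have h2 : HasDerivAt (fun s => u * (v - s)) (u * (-1)) s :=
      ((hasDerivAt_id s).const_sub v).const_mul u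
    have h3 := (h1.div h2 (by positivity)).hasDerivWithinAt (s := Ioo 0 u)
    have h4 : (v - u) * v / (u * (v - s) ^ 2) =
        (1 * (v - u) * (u * (v - s)) - s * (v - u) * (u * -1)) / (u * (v - s)) ^ 2 := by
      field_simp
      ring
    rw [h4]
    exact h3
  have hinj : InjOn f (Ioo 0 u) := by
    intro s hs t ht hst
    have hF : 0 < v - s := by linarith [hs.2]
    have hG : 0 < v - t := by linarith [ht.2]
    simp only [hf] at hst
    rw [div_eq_div_iff (by positivity) (by positivity)] at hst
    have h1 : (v - u) * u * v * (s - t) = 0 := by linear_combination hst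
    have h2 : (v - u) * u * v ≠ 0 := by positivity
    have := (mul_eq_zero.1 h1).resolve_left h2
    linarith
  have himg : f '' Ioo 0 u = Ioo 0 1 := by
    ext y
    constructor
    · rintro ⟨s, hs, rfl⟩
      have hF : 0 < v - s := by linarith [hs.2]
      have hs0 := hs.1
      refine ⟨by simp only [hf]; positivity, ?_⟩
      simp only [hf]
      rw [div_lt_one (by positivity)]
      nlinarith [hs.2]
    · rintro ⟨hy0, hy1⟩
      have hden : 0 < v - u + u * y := by positivity
      refine ⟨y * u * v / (v - u + u * y), ⟨by positivity, ?_⟩, ?_⟩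
      · rw [div_lt_iff₀ hden]
        nlinarith [mul_pos hu hD]
      · have h1 : v - y * u * v / (v - u + u * y) = v * (v - u) / (v - u + u * y) := by
          field_simp; ring
        simp only [hf]
        rw [h1]
        field_simp
  have hcv := lintegral_image_eq_lintegral_abs_deriv_mul measurableSet_Ioo hderiv hinj
    (fun y => ENNReal.ofReal (y ^ ((1 - 2 * α) - 1) * (1 - y) ^ (α - 1)))
  rw [himg, setLIntegral_beta (by linarith) hα] at hcv
  have hpt : ∀ s ∈ Ioo 0 u, ENNReal.ofReal |(v - u) * v / (u * (v - s) ^ 2)| *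
      ENNReal.ofReal (f s ^ ((1 - 2 * α) - 1) * (1 - f s) ^ (α - 1)) =
      ENNReal.ofReal ((v - u) ^ (1 - 2 * α)) * ENNReal.ofReal
        (s ^ (-(2 * α)) * (u - s) ^ (α - 1) * (v - s) ^ (α - 1) * (u ^ α * v ^ α)) := by
    intro s hs
    have hF : 0 < v - s := by linarith [hs.2]
    have hE : 0 < u - s := by linarith [hs.2]
    have h1 : 1 - f s = v * (u - s) / (u * (v - s)) := by
      simp only [hf]
      field_simp
      ring
    have h2 : (1 - 2 * α) - 1 = -(2 * α) := by ring
    rw [h1, h2, abs_of_nonneg (by positivity), ← ENNReal.ofReal_mul (by positivity),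
      ← ENNReal.ofReal_mul (by positivity),
      ← beta_substitution_identity hs.1 hD hu hv hE hF α]
  rw [setLIntegral_congr_fun measurableSet_Ioo hpt, lintegral_const_mul _ (by fun_prop)] at hcv
  have hpos : 0 < (v - u) ^ (2 * α - 1) := Real.rpow_pos_of_pos hD _
  have hmul : (v - u) ^ (2 * α - 1) * (v - u) ^ (1 - 2 * α) = 1 := by
    rw [← Real.rpow_add hD]; simp
  rw [mul_comm (beta _ _), ENNReal.ofReal_mul hpos.le, hcv, ← mul_assoc, ← ENNReal.ofReal_mul hpos.le, hmul]
  simp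

/-- The density `s^{-α} u^α (u - s)^{α - 1}` on `0 < s < u` of the kernel. -/
noncomputable def kernelDensity (α s u : ℝ) : ℝ≥0∞ :=
  if 0 < s ∧ s < u then ENNReal.ofReal (s ^ (-α) * u ^ α * (u - s) ^ (α - 1)) else 0

theorem measurable_kernelDensity (α : ℝ) :
    Measurable fun p : ℝ × ℝ => kernelDensity α p.1 p.2 := by
  unfold kernelDensity
  refine Measurable.ite ?_ (by fun_prop) measurable_const
  exact (measurableSet_lt measurable_const measurable_fst).inter
    (measurableSet_lt measurable_fst measurable_snd)

theorem lintegral_kernelDensity_mul {α u v : ℝ} (hα : 0 < α) (hα' : α < 1 / 2) (hu : 0 < u)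
    (hu1 : u ≤ 1) (huv : u < v) :
    ∫⁻ s in Ioc 0 1, kernelDensity α s u * kernelDensity α s v =
      ENNReal.ofReal (beta (1 - 2 * α) α * (v - u) ^ (2 * α - 1)) := by
  rw [← setLIntegral_rpow_mul_sub_rpow hα hα' hu huv,
    ← lintegral_indicator measurableSet_Ioc, ← lintegral_indicator measurableSet_Ioo]
  congr 1
  funext s
  by_cases hs : s ∈ Ioo 0 u
  · have hF : 0 < v - s := by linarith [hs.2]
    have hE : 0 < u - s := by linarith [hs.2]
    have hs0 := hs.1
    have hv : 0 < v := hu.trans huv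
    rw [indicator_of_mem hs, indicator_of_mem (show s ∈ Ioc 0 1 from ⟨hs.1, hs.2.le.trans hu1⟩), kernelDensity,
      kernelDensity, if_pos (show 0 < s ∧ s < u from hs),
      if_pos ⟨hs.1, hs.2.trans huv⟩, ← ENNReal.ofReal_mul (by positivity)]
    congr 1
    have : s ^ (-(2 * α)) = s ^ (-α) * s ^ (-α) := by
      rw [← Real.rpow_add hs.1]; congr 1; ring
    rw [this]
    ring
  · rw [indicator_of_notMem hs]
    have : kernelDensity α s u = 0 := if_neg hs
    simp [Set.indicator, this]

theorem lintegral_kernelDensity_mul_of_ne {α u v : ℝ} (hα : 0 < α) (hα' : α < 1 / 2)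
    (hu : u ∈ Ioo (0 : ℝ) 1) (hv : v ∈ Ioo (0 : ℝ) 1) (huv : u ≠ v) :
    ∫⁻ s in Ioc 0 1, kernelDensity α s u * kernelDensity α s v =
      ENNReal.ofReal (beta (1 - 2 * α) α) * ENNReal.ofReal (|v - u| ^ (2 * α - 1)) := by
  have hB := beta_pos (α := 1 - 2 * α) (by linarith) hα
  rw [← ENNReal.ofReal_mul hB.le]
  rcases lt_or_gt_of_ne huv with h | h
  · rw [lintegral_kernelDensity_mul hα hα' hu.1 hu.2.le h, abs_of_pos (sub_pos.2 h)]
  · simp_rw [mul_comm (kernelDensity α _ u)]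
    rw [lintegral_kernelDensity_mul hα hα' hv.1 hv.2.le h, abs_sub_comm,
      abs_of_pos (sub_pos.2 h)]

theorem kernel_nonneg {H : ℝ} (hH : 1 / 2 < H) (t : ℝ) {s : ℝ} (hs : 0 ≤ s) :
    0 ≤ kernel H t s := by
  rw [kernel]
  split_ifs with h
  · refine mul_nonneg (mul_nonneg (mul_nonneg (Real.sqrt_nonneg _) (by linarith))
      (Real.rpow_nonneg hs _)) (intervalIntegral.integral_nonneg h fun u hu => ?_)
    exact mul_nonneg (Real.rpow_nonneg (hs.trans hu.1) _)
      (Real.rpow_nonneg (sub_nonneg.2 hu.1) _)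
  · exact le_rfl

/-- The kernel becomes an integral of a nonnegative density over a range `(0, t)` not depending on
`s`. Tonelli then needs no integrability, and monotonicity in `t` is immediate. -/
theorem ofReal_kernel {H : ℝ} (hH : 1 / 2 < H) {t s : ℝ} (hs : 0 < s) :
    ENNReal.ofReal (kernel H t s) = ENNReal.ofReal (kernelConst H * (H - 1 / 2)) *
      ∫⁻ u in Ioo 0 t, kernelDensity (H - 1 / 2) s u := by
  have hα : 0 < H - 1 / 2 := by linarith
  have hc : 0 ≤ kernelConst H * (H - 1 / 2) := mul_nonneg (Real.sqrt_nonneg _) hα.le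
  rw [kernel]
  split_ifs with hst
  · rw [mul_assoc, ENNReal.ofReal_mul hc]
    congr 1
    rw [← intervalIntegral.integral_const_mul, ← setLIntegral_Ioo_ofReal_eq hst]
    · rw [← lintegral_indicator measurableSet_Ioo, ← lintegral_indicator measurableSet_Ioo]
      congr 1
      funext u
      by_cases hu : u ∈ Ioo s t
      · rw [indicator_of_mem hu, indicator_of_mem (show u ∈ Ioo 0 t from ⟨hs.trans hu.1, hu.2⟩), kernelDensity,
          if_pos ⟨hs, hu.1⟩]
        congr 1
        rw [← mul_assoc]
        congr 2 <;> ring_nf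
      · rw [indicator_of_notMem hu]
        by_cases hu' : u ∈ Ioo 0 t
        · rw [indicator_of_mem hu', kernelDensity, if_neg]
          exact fun h => hu ⟨h.2, hu'.2⟩
        · rw [indicator_of_notMem hu']
    · refine IntervalIntegrable.const_mul ?_ _
      refine IntervalIntegrable.continuousOn_mul ?_
        (Real.continuous_rpow_const hα.le).continuousOn
      have := (intervalIntegral.intervalIntegrable_rpow' (a := 0) (b := t - s)
        (r := H - 3 / 2) (by linarith)).comp_sub_right s
      simpa using this
    · intro u hu
      have h1 : 0 < u := hs.trans hu.1
      have h2 : 0 < u - s := sub_pos.2 hu.1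
      positivity
  · rw [ENNReal.ofReal_zero]
    have : ∫⁻ u in Ioo 0 t, kernelDensity (H - 1 / 2) s u = 0 := by
      rw [setLIntegral_congr_fun measurableSet_Ioo (g := fun _ => 0), lintegral_zero]
      intro u hu
      rw [kernelDensity, if_neg]
      exact fun h => hst (h.2.trans hu.2).le
    rw [this, mul_zero]

/-- This is what `c_H` is normalised for: with `Γ(H + 1/2) = (H - 1/2) Γ(H - 1/2)` all Gamma factors
cancel, leaving the constant of the covariance density `H (2H - 1) |v - u|^{2H - 2}`. -/
theorem kernelConst_sq_mul_beta {H : ℝ} (hH : 1 / 2 < H) (hH' : H < 1) :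
    (kernelConst H * (H - 1 / 2)) ^ 2 * beta (1 - 2 * (H - 1 / 2)) (H - 1 / 2) =
      (H - 1 / 2) * (2 * H) := by
  have h1 : 0 < Real.Gamma (3 / 2 - H) := Real.Gamma_pos_of_pos (by linarith)
  have h2 : 0 < Real.Gamma (H - 1 / 2) := Real.Gamma_pos_of_pos (by linarith)
  have h3 : 0 < Real.Gamma (2 - 2 * H) := Real.Gamma_pos_of_pos (by linarith)
  have h4 : Real.Gamma (H + 1 / 2) = (H - 1 / 2) * Real.Gamma (H - 1 / 2) := by
    rw [← Real.Gamma_add_one (by linarith)]; congr 1; ring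
  have hα : 0 < H - 1 / 2 := by linarith
  have hne : H - 1 / 2 ≠ 0 := hα.ne'
  rw [beta, mul_pow, kernelConst, Real.sq_sqrt (by rw [h4]; positivity), h4]
  have e1 : 1 - 2 * (H - 1 / 2) = 2 - 2 * H := by ring
  have e2 : 2 - 2 * H + (H - 1 / 2) = 3 / 2 - H := by ring
  rw [e1, e2]
  generalize H - 1 / 2 = α at *
  generalize Real.Gamma (3 / 2 - H) = x at *
  generalize Real.Gamma (2 - 2 * H) = y at *
  field_simp

theorem lintegral_abs_sub_rpow {β T u : ℝ} (hβ : 0 < β) (hu : 0 < u) (huT : u ≤ T) :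
    ∫⁻ v in Ioo 0 T, ENNReal.ofReal (|v - u| ^ (β - 1)) =
      ENNReal.ofReal ((u ^ β + (T - u) ^ β) / β) := by
  have h1 : ∫⁻ v in Ioo 0 T, ENNReal.ofReal (|v - u| ^ (β - 1)) =
      ∫⁻ v in Ioc 0 T, ENNReal.ofReal (|v - u| ^ (β - 1)) :=
    (setLIntegral_congr Ioo_ae_eq_Ioc)
  have hA : ∫⁻ v in Ioc 0 u, ENNReal.ofReal (|v - u| ^ (β - 1)) =
      ENNReal.ofReal (u ^ β / β) := by
    rw [← setLIntegral_congr Ioo_ae_eq_Ioc,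
      setLIntegral_congr_fun measurableSet_Ioo (g := fun v => ENNReal.ofReal ((u - v) ^ (β - 1))),
      setLIntegral_Ioo_ofReal_sub_right_rpow (by linarith) hu.le, sub_zero, sub_add_cancel]
    intro v hv
    simp only
    rw [abs_sub_comm, abs_of_pos (sub_pos.2 hv.2)]
  have hB : ∫⁻ v in Ioc u T, ENNReal.ofReal (|v - u| ^ (β - 1)) =
      ENNReal.ofReal ((T - u) ^ β / β) := by
    rw [← setLIntegral_congr Ioo_ae_eq_Ioc,
      setLIntegral_congr_fun measurableSet_Ioo (g := fun v => ENNReal.ofReal ((v - u) ^ (β - 1))),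
      setLIntegral_Ioo_ofReal_sub_left_rpow (by linarith) huT, sub_add_cancel]
    intro v hv
    simp only
    rw [abs_of_pos (sub_pos.2 hv.1)]
  have hT : 0 ≤ T - u := sub_nonneg.2 huT
  rw [h1, ← Ioc_union_Ioc_eq_Ioc hu.le huT, lintegral_union measurableSet_Ioc
    (Ioc_disjoint_Ioc_of_le le_rfl), hA, hB, ← ENNReal.ofReal_add (by positivity) (by positivity),
    add_div]

/-- With `β = 2H - 1` this is the covariance up to a constant. The order `t ≤ T` ensures that every
`u` in `(0, t)` splits `(0, T)` into two power integrals. -/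
theorem lintegral_lintegral_abs_sub_rpow {β t T : ℝ} (hβ : 0 < β) (ht : 0 ≤ t) (htT : t ≤ T) :
    ∫⁻ u in Ioo 0 t, ∫⁻ v in Ioo 0 T, ENNReal.ofReal (|v - u| ^ (β - 1)) =
      ENNReal.ofReal ((t ^ (β + 1) + T ^ (β + 1) - (T - t) ^ (β + 1)) / (β * (β + 1))) := by
  rw [setLIntegral_congr_fun measurableSet_Ioo
    (g := fun u => ENNReal.ofReal ((u ^ β + (T - u) ^ β) / β))
    (fun u hu => lintegral_abs_sub_rpow hβ hu.1 (hu.2.le.trans htT)),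
    setLIntegral_Ioo_ofReal_eq ht]
  · congr 1
    have hc1 : Continuous fun u : ℝ => u ^ β := Real.continuous_rpow_const hβ.le
    have hc2 : Continuous fun u : ℝ => (T - u) ^ β := hc1.comp (by fun_prop)
    rw [intervalIntegral.integral_div, intervalIntegral.integral_add
      (hc1.intervalIntegrable _ _) (hc2.intervalIntegrable _ _),
      intervalIntegral.integral_comp_sub_left (fun x => x ^ β),
      integral_rpow (Or.inl (by linarith)), integral_rpow (Or.inl (by linarith)),
      Real.zero_rpow (by linarith), sub_zero, sub_zero]
    field_simp
    ring
  · have hc1 : Continuous fun u : ℝ => u ^ β := Real.continuous_rpow_const hβ.le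
    have hc2 : Continuous fun u : ℝ => (T - u) ^ β := hc1.comp (by fun_prop)
    exact ((hc1.add hc2).div_const β).intervalIntegrable _ _
  · intro u hu
    have := hu.1
    have h2 : 0 ≤ T - u := by linarith [hu.2]
    positivity

theorem measurable_setLIntegral_kernelDensity (α t : ℝ) :
    Measurable fun s => ∫⁻ u in Ioo 0 t, kernelDensity α s u :=
  (measurable_kernelDensity α).lintegral_prod_right'

/-- The kernel reproduces the covariance of fractional Brownian motion. -/
theorem lintegral_kernel_mul_kernel_of_le {H : ℝ} (hH : 1 / 2 < H) (hH' : H < 1) {t T : ℝ}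
    (ht : 0 ≤ t) (htT : t ≤ T) (hT : T ≤ 1) :
    ∫⁻ s in Ioc 0 1, ENNReal.ofReal (kernel H t s) * ENNReal.ofReal (kernel H T s) =
      ENNReal.ofReal ((t ^ (2 * H) + T ^ (2 * H) - (T - t) ^ (2 * H)) / 2) := by
  set α := H - 1 / 2 with hαdef
  have hα : 0 < α := by linarith
  have hα' : α < 1 / 2 := by linarith
  set c := kernelConst H * α with hc
  have hc0 : 0 ≤ c := mul_nonneg (Real.sqrt_nonneg _) hα.le
  have hB := beta_pos (α := 1 - 2 * α) (by linarith) hα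
  have hm := measurable_kernelDensity α
  have hms : ∀ s, Measurable fun u => kernelDensity α s u := fun s =>
    hm.comp (measurable_const.prodMk measurable_id)
  have hmu : ∀ u, Measurable fun s => kernelDensity α s u := fun u =>
    hm.comp (measurable_id.prodMk measurable_const)
  have e1 : ∫⁻ s in Ioc 0 1, ENNReal.ofReal (kernel H t s) * ENNReal.ofReal (kernel H T s) =
      ∫⁻ s in Ioc 0 1, ENNReal.ofReal (c ^ 2) * ∫⁻ u in Ioo 0 t, ∫⁻ v in Ioo 0 T,
        kernelDensity α s u * kernelDensity α s v := by
    refine setLIntegral_congr_fun measurableSet_Ioc fun s hs => ?_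
    rw [ofReal_kernel hH hs.1, ofReal_kernel hH hs.1]
    have : ∀ u, ∫⁻ v in Ioo 0 T, kernelDensity α s u * kernelDensity α s v =
        kernelDensity α s u * ∫⁻ v in Ioo 0 T, kernelDensity α s v := fun u =>
      lintegral_const_mul _ (hms s)
    simp_rw [this]
    rw [lintegral_mul_const _ (hms s), pow_two, ENNReal.ofReal_mul hc0]
    ring
  have hm3 : Measurable fun p : ℝ × ℝ × ℝ => kernelDensity α p.1 p.2.1 * kernelDensity α p.1 p.2.2 :=
    (hm.comp (measurable_fst.prodMk measurable_snd.fst)).mul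
      (hm.comp (measurable_fst.prodMk measurable_snd.snd))
  have e2 : ∫⁻ s in Ioc 0 1, ∫⁻ u in Ioo 0 t, ∫⁻ v in Ioo 0 T,
        kernelDensity α s u * kernelDensity α s v =
      ∫⁻ u in Ioo 0 t, ∫⁻ v in Ioo 0 T, ∫⁻ s in Ioc 0 1,
        kernelDensity α s u * kernelDensity α s v := by
    rw [lintegral_lintegral_swap]
    · refine lintegral_congr fun u => ?_
      rw [lintegral_lintegral_swap]
      exact (((hmu u).comp measurable_fst).mul hm).aemeasurable
    · refine Measurable.aemeasurable ?_
      have : Measurable fun q : (ℝ × ℝ) × ℝ =>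
          kernelDensity α q.1.1 q.1.2 * kernelDensity α q.1.1 q.2 :=
        hm3.comp (measurable_fst.fst.prodMk (measurable_fst.snd.prodMk measurable_snd))
      exact this.lintegral_prod_right'
  have e3 : ∫⁻ u in Ioo 0 t, ∫⁻ v in Ioo 0 T, ∫⁻ s in Ioc 0 1,
        kernelDensity α s u * kernelDensity α s v =
      ∫⁻ u in Ioo 0 t, ENNReal.ofReal (beta (1 - 2 * α) α) *
        ∫⁻ v in Ioo 0 T, ENNReal.ofReal (|v - u| ^ (2 * α - 1)) := by
    refine setLIntegral_congr_fun measurableSet_Ioo fun u hu => ?_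
    rw [← lintegral_const_mul _ (by fun_prop)]
    refine lintegral_congr_ae ?_
    -- The Beta formula is available only off the diagonal, a null set.
    have hne : ∀ᵐ v ∂(volume.restrict (Ioo 0 T)), v ≠ u :=
      ae_restrict_of_ae (by simp [ae_iff])
    filter_upwards [hne, ae_restrict_mem measurableSet_Ioo] with v hv hvT
    exact lintegral_kernelDensity_mul_of_ne hα hα' ⟨hu.1, hu.2.trans_le (htT.trans hT)⟩
      ⟨hvT.1, hvT.2.trans_le hT⟩ hv.symm
  have hmo : Measurable fun u : ℝ => ∫⁻ v in Ioo 0 T, ENNReal.ofReal (|v - u| ^ (2 * α - 1)) := by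
    have : Measurable fun p : ℝ × ℝ => ENNReal.ofReal (|p.2 - p.1| ^ (2 * α - 1)) := by fun_prop
    exact this.lintegral_prod_right'
  have hmi : Measurable fun s => ∫⁻ u in Ioo 0 t, ∫⁻ v in Ioo 0 T,
        kernelDensity α s u * kernelDensity α s v := by
    have h1 : Measurable fun q : (ℝ × ℝ) × ℝ =>
          kernelDensity α q.1.1 q.1.2 * kernelDensity α q.1.1 q.2 :=
        hm3.comp (measurable_fst.fst.prodMk (measurable_fst.snd.prodMk measurable_snd))
    exact (h1.lintegral_prod_right' (ν := volume.restrict (Ioo 0 T))).lintegral_prod_right'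
  rw [e1, lintegral_const_mul _ hmi, e2, e3, lintegral_const_mul _ hmo,
    lintegral_lintegral_abs_sub_rpow (by positivity) ht htT, ← mul_assoc,
    ← ENNReal.ofReal_mul (sq_nonneg _), kernelConst_sq_mul_beta hH hH', ← hαdef,
    ← ENNReal.ofReal_mul (by positivity)]
  have e4 : 2 * α + 1 = 2 * H := by rw [hαdef]; ring
  rw [e4]
  congr 1
  have : H ≠ 0 := by linarith
  field_simp

end Kernel

/-! ### Cell averages of square integrable functions -/

section Cells

variable {n : ℕ} {f : ℝ → ℝ}

theorem cell_le (i : Fin n) : (i.val : ℝ) / n ≤ ((i.val : ℝ) + 1) / n := by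
  gcongr; linarith

theorem Ioc_cell_subset (i : Fin n) :
    Ioc ((i.val : ℝ) / n) (((i.val : ℝ) + 1) / n) ⊆ Ioc 0 1 := by
  have hn : (0 : ℝ) < n := by exact_mod_cast i.pos
  refine Ioc_subset_Ioc (by positivity) ?_
  rw [div_le_one hn]
  exact_mod_cast i.isLt

theorem intervalIntegrable_cell (hf : IntegrableOn f (Ioc 0 1)) (i : Fin n) :
    IntervalIntegrable f volume ((i.val : ℝ) / n) (((i.val : ℝ) + 1) / n) :=
  (intervalIntegrable_iff_integrableOn_Ioc_of_le (cell_le i)).2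
    (hf.mono_set (Ioc_cell_subset i))

theorem sum_integral_cell (hn : n ≠ 0) (hf : IntegrableOn f (Ioc 0 1)) :
    ∑ i : Fin n, ∫ s in ((i.val : ℝ) / n)..(((i.val : ℝ) + 1) / n), f s =
      ∫ s in Ioc 0 1, f s := by
  have hn' : (n : ℝ) ≠ 0 := by exact_mod_cast hn
  rw [← intervalIntegral.integral_of_le zero_le_one,
    Fin.sum_univ_eq_sum_range
      (fun k : ℕ => ∫ s in ((k : ℝ) / n)..(((k : ℝ) + 1) / n), f s) n]
  have h := intervalIntegral.sum_integral_adjacent_intervals (f := f) (μ := volume)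
    (a := fun k : ℕ => (k : ℝ) / n) (n := n) fun k hk => by
      have := intervalIntegrable_cell hf ⟨k, hk⟩
      simpa using this
  simp only [Nat.cast_add, Nat.cast_one, Nat.cast_zero, zero_div, div_self hn'] at h
  exact h

/-- The normalised integral of `f` over the `i`-th cell of the grid with mesh `1 / n`. -/
noncomputable def cellCoeff (n : ℕ) (i : Fin n) (f : ℝ → ℝ) : ℝ :=
  √(n : ℝ) * ∫ s in ((i.val : ℝ) / n)..(((i.val : ℝ) + 1) / n), f s

/-- The cell has length `1 / n`, so the mean of `f` on it is `√n * cellCoeff n i f`. Completing the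
square isolates the distance of `c` from that mean; the choice of `c` then gives both the Bessel
bound and the bound on the lost energy. -/
theorem integral_cell_sub_sq (hf : MemLp f 2 (volume.restrict (Ioc 0 1))) (i : Fin n) (c : ℝ) :
    ∫ s in ((i.val : ℝ) / n)..(((i.val : ℝ) + 1) / n), (f s - c) ^ 2 =
      (∫ s in ((i.val : ℝ) / n)..(((i.val : ℝ) + 1) / n), f s ^ 2) - cellCoeff n i f ^ 2 +
        (cellCoeff n i f - c / √(n : ℝ)) ^ 2 := by
  have hn : (0 : ℝ) < n := by exact_mod_cast i.pos
  have h1 := intervalIntegrable_cell (hf.integrable (by norm_num)) i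
  have h2 := intervalIntegrable_cell hf.integrable_sq i
  have h3 : ∀ s, (f s - c) ^ 2 = f s ^ 2 - 2 * c * f s + c ^ 2 := fun s => by ring
  simp_rw [h3]
  rw [intervalIntegral.integral_add (h2.sub (h1.const_mul _)) intervalIntegrable_const,
    intervalIntegral.integral_sub h2 (h1.const_mul _), intervalIntegral.integral_const_mul,
    intervalIntegral.integral_const, cellCoeff]
  have h4 : ((i.val : ℝ) + 1) / n - (i.val : ℝ) / n = 1 / √(n : ℝ) ^ 2 := by
    rw [Real.sq_sqrt hn.le]; ring
  have h6 : √(n : ℝ) ≠ 0 := (Real.sqrt_pos.2 hn).ne'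
  rw [h4, smul_eq_mul]
  generalize (∫ s in ((i.val : ℝ) / n)..(((i.val : ℝ) + 1) / n), f s) = p
  generalize (∫ s in ((i.val : ℝ) / n)..(((i.val : ℝ) + 1) / n), f s ^ 2) = q
  generalize √(n : ℝ) = r at h6
  field_simp
  ring

theorem integral_cell_sq_sub_le (hf : MemLp f 2 (volume.restrict (Ioc 0 1))) (i : Fin n) (c : ℝ) :
    (∫ s in ((i.val : ℝ) / n)..(((i.val : ℝ) + 1) / n), f s ^ 2) - cellCoeff n i f ^ 2 ≤
      ∫ s in ((i.val : ℝ) / n)..(((i.val : ℝ) + 1) / n), (f s - c) ^ 2 := by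
  rw [integral_cell_sub_sq hf]
  exact le_add_of_nonneg_right (sq_nonneg _)

theorem cellCoeff_sq_le (hf : MemLp f 2 (volume.restrict (Ioc 0 1))) (i : Fin n) :
    cellCoeff n i f ^ 2 ≤ ∫ s in ((i.val : ℝ) / n)..(((i.val : ℝ) + 1) / n), f s ^ 2 := by
  have hn : (0 : ℝ) < n := by exact_mod_cast i.pos
  have h := integral_cell_sub_sq hf i (√(n : ℝ) * cellCoeff n i f)
  have h0 : 0 ≤ ∫ s in ((i.val : ℝ) / n)..(((i.val : ℝ) + 1) / n),
      (f s - √(n : ℝ) * cellCoeff n i f) ^ 2 :=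
    intervalIntegral.integral_nonneg (cell_le i) fun s _ => sq_nonneg _
  rw [mul_div_cancel_left₀ _ (Real.sqrt_pos.2 hn).ne', sub_self] at h
  linarith

theorem sum_cellCoeff_sq_le (hn : n ≠ 0) (hf : MemLp f 2 (volume.restrict (Ioc 0 1))) :
    ∑ i : Fin n, cellCoeff n i f ^ 2 ≤ ∫ s in Ioc 0 1, f s ^ 2 := by
  rw [← sum_integral_cell hn hf.integrable_sq]
  exact Finset.sum_le_sum fun i _ => cellCoeff_sq_le hf i

theorem exists_continuous_integral_sub_sq_le (hf : MemLp f 2 (volume.restrict (Ioc 0 1)))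
    {ε : ℝ} (hε : 0 < ε) : ∃ g : ℝ → ℝ, UniformContinuous g ∧ (∃ M, ∀ s, |g s| ≤ M) ∧
      MemLp g 2 (volume.restrict (Ioc 0 1)) ∧ ∫ s in Ioc 0 1, (f s - g s) ^ 2 ≤ ε := by
  have h2 : ENNReal.ofReal 2 = 2 := by simp
  obtain ⟨g, hg, hfg, hgc, hgm⟩ := MemLp.exists_hasCompactSupport_integral_rpow_sub_le
    (p := 2) two_pos (by rwa [h2]) hε
  refine ⟨g, hg.uniformContinuous_of_continuous hgc, ?_, by rwa [h2] at hgm, ?_⟩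
  · obtain ⟨M, hM⟩ := hg.exists_bound_of_continuous hgc
    exact ⟨M, hM⟩
  · simpa using hfg

/-- Uniformly in the cell, the integral of an integrable square over a cell is small. -/
theorem exists_forall_integral_cell_sq_le (hf : MemLp f 2 (volume.restrict (Ioc 0 1)))
    {ε : ℝ} (hε : 0 < ε) : ∃ N : ℕ, ∀ n ≥ N, ∀ i : Fin n,
      ∫ s in ((i.val : ℝ) / n)..(((i.val : ℝ) + 1) / n), f s ^ 2 ≤ ε := by
  -- From `f² ≤ 2 (f - g)² + 2 M²`: the first part gives `ε / 2`, the second `2 M² / n ≤ ε / 2`.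
  obtain ⟨g, -, ⟨M, hM⟩, hgm, hfg⟩ := exists_continuous_integral_sub_sq_le hf
    (ε := ε / 4) (by positivity)
  obtain ⟨N, hN⟩ := exists_nat_gt (4 * M ^ 2 / ε)
  refine ⟨N, fun n hn i => ?_⟩
  have hn0 : (0 : ℝ) < n := by exact_mod_cast i.pos
  have h1 : Integrable (fun s => (f s - g s) ^ 2) (volume.restrict (Ioc 0 1)) :=
    (hf.sub hgm).integrable_sq
  have h2 : ∫ s in ((i.val : ℝ) / n)..(((i.val : ℝ) + 1) / n), f s ^ 2 ≤
      ∫ s in ((i.val : ℝ) / n)..(((i.val : ℝ) + 1) / n), (2 * (f s - g s) ^ 2 + 2 * M ^ 2) := by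
    refine intervalIntegral.integral_mono_on (cell_le i)
      (intervalIntegrable_cell hf.integrable_sq i)
      (((intervalIntegrable_cell h1 i).const_mul 2).add intervalIntegrable_const) fun s _ => ?_
    have h3 : g s ^ 2 ≤ M ^ 2 := sq_le_sq' (by linarith [(abs_le.1 (hM s)).1]) (abs_le.1 (hM s)).2
    nlinarith [sq_nonneg (f s - 2 * g s)]
  have h3 : ∫ s in ((i.val : ℝ) / n)..(((i.val : ℝ) + 1) / n), (f s - g s) ^ 2 ≤ ε / 4 := by
    rw [intervalIntegral.integral_of_le (cell_le i)]
    refine le_trans ?_ hfg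
    exact setIntegral_mono_set h1 (ae_of_all _ fun s => sq_nonneg _)
      (Ioc_cell_subset i).eventuallyLE
  have h4 : ((i.val : ℝ) + 1) / n - (i.val : ℝ) / n = 1 / n := by ring
  rw [intervalIntegral.integral_add ((intervalIntegrable_cell h1 i).const_mul 2)
    intervalIntegrable_const, intervalIntegral.integral_const_mul,
    intervalIntegral.integral_const, h4, smul_eq_mul] at h2
  have h5 : 1 / (n : ℝ) * (2 * M ^ 2) ≤ ε / 2 := by
    have : 4 * M ^ 2 / ε < n := hN.trans_le (by exact_mod_cast hn)
    rw [div_lt_iff₀ hε] at this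
    rw [one_div_mul_eq_div, div_le_iff₀ hn0]
    linarith
  linarith

/-- Averaging over cells does not lose any energy in the limit. -/
theorem tendsto_integral_sq_sub_sum_cellCoeff_sq {F : ℕ → ℝ → ℝ}
    (hF : ∀ n, MemLp (F n) 2 (volume.restrict (Ioc 0 1)))
    (hf : MemLp f 2 (volume.restrict (Ioc 0 1)))
    (hFf : Tendsto (fun n => ∫ s in Ioc 0 1, (F n s - f s) ^ 2) atTop (𝓝 0)) :
    Tendsto (fun n : ℕ => (∫ s in Ioc 0 1, F n s ^ 2) - ∑ i : Fin n, cellCoeff n i (F n) ^ 2)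
      atTop (𝓝 0) := by
  rw [Metric.tendsto_atTop]
  intro ε hε
  -- On a cell, `F n` minus the value of `g` at the left end splits into `F n - f`, `f - g` and the
  -- oscillation of `g`. Each contributes at most `3 * (ε / 12)`.
  obtain ⟨g, hgu, -, hgm, hfg⟩ := exists_continuous_integral_sub_sq_le hf
    (ε := ε / 12) (by positivity)
  obtain ⟨δ, hδ, hgδ⟩ := Metric.uniformContinuous_iff.1 hgu (√(ε / 12)) (by positivity)
  obtain ⟨N1, hN1⟩ := Metric.tendsto_atTop.1 hFf (ε / 12) (by positivity)
  obtain ⟨N2, hN2⟩ := exists_nat_gt (1 / δ)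
  refine ⟨max (max N1 N2) 1, fun n hn => ?_⟩
  have hn1 : N1 ≤ n := (le_max_left _ _).trans ((le_max_left _ _).trans hn)
  have hn2 : N2 ≤ n := (le_max_right _ _).trans ((le_max_left _ _).trans hn)
  have hn3 : n ≠ 0 := by have := (le_max_right _ _).trans hn; omega
  have hn0 : (0 : ℝ) < n := by exact_mod_cast Nat.pos_of_ne_zero hn3
  have hnδ : 1 / (n : ℝ) < δ := by
    rw [div_lt_iff₀ hn0]
    have h1 : 1 / δ < n := hN2.trans_le (by exact_mod_cast hn2)
    rwa [div_lt_iff₀ hδ, mul_comm] at h1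
  have hA := (hF n).integrable_sq
  have hB := ((hF n).sub hf).integrable_sq
  have hC := (hf.sub hgm).integrable_sq
  have hcell : ∀ i : Fin n,
      (∫ s in ((i.val : ℝ) / n)..(((i.val : ℝ) + 1) / n), F n s ^ 2) - cellCoeff n i (F n) ^ 2 ≤
      ∫ s in ((i.val : ℝ) / n)..(((i.val : ℝ) + 1) / n),
        (3 * (F n s - f s) ^ 2 + 3 * (f s - g s) ^ 2 + 3 * (ε / 12)) := by
    intro i
    refine (integral_cell_sq_sub_le (hF n) i (g ((i.val : ℝ) / n))).trans ?_
    refine intervalIntegral.integral_mono_on (cell_le i) ?_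
      ((((intervalIntegrable_cell hB i).const_mul 3).add
        ((intervalIntegrable_cell hC i).const_mul 3)).add intervalIntegrable_const) fun s hs => ?_
    · exact intervalIntegrable_cell (((hF n).sub (memLp_const (g ((i.val : ℝ) / n)))).integrable_sq) i
    · have h1 : dist s ((i.val : ℝ) / n) < δ := by
        rw [Real.dist_eq, abs_of_nonneg (by linarith [hs.1])]
        have : ((i.val : ℝ) + 1) / n = (i.val : ℝ) / n + 1 / n := by ring
        linarith [hs.2]
      have h2 := hgδ h1
      rw [Real.dist_eq] at h2
      have h3 : (g s - g ((i.val : ℝ) / n)) ^ 2 ≤ ε / 12 := by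
        rw [← sq_abs, ← Real.sq_sqrt (show 0 ≤ ε / 12 by positivity)]
        exact pow_le_pow_left₀ (abs_nonneg _) h2.le 2
      nlinarith [sq_nonneg ((F n s - f s) - (f s - g s)),
        sq_nonneg ((F n s - f s) - (g s - g ((i.val : ℝ) / n))),
        sq_nonneg ((f s - g s) - (g s - g ((i.val : ℝ) / n)))]
  have hint : IntegrableOn (fun s => 3 * (F n s - f s) ^ 2 + 3 * (f s - g s) ^ 2 + 3 * (ε / 12))
      (Ioc 0 1) :=
    ((hB.const_mul 3).add (hC.const_mul 3)).add (integrable_const _)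
  have hsum := Finset.sum_le_sum fun i (_ : i ∈ Finset.univ) => hcell i
  rw [Finset.sum_sub_distrib, sum_integral_cell hn3 hA, sum_integral_cell hn3 hint] at hsum
  have hval : ∫ s in Ioc 0 1, (3 * (F n s - f s) ^ 2 + 3 * (f s - g s) ^ 2 + 3 * (ε / 12)) =
      3 * (∫ s in Ioc 0 1, (F n s - f s) ^ 2) + 3 * (∫ s in Ioc 0 1, (f s - g s) ^ 2) +
        3 * (ε / 12) := by
    have e1 := integral_add ((hB.const_mul 3).add (hC.const_mul 3))
      (integrable_const (μ := volume.restrict (Ioc (0 : ℝ) 1)) (3 * (ε / 12)))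
    have e2 := integral_add (hB.const_mul 3) (hC.const_mul 3)
    simp only [Pi.sub_apply, Pi.add_apply] at e1 e2
    rw [e1, e2, integral_const_mul, integral_const_mul]
    simp
  rw [hval] at hsum
  have h1 := hN1 n hn1
  rw [Real.dist_eq, sub_zero] at h1
  have h2 := (abs_lt.1 h1).2
  have h0 := sum_cellCoeff_sq_le hn3 (hF n)
  rw [Real.dist_eq, sub_zero, abs_of_nonneg (by linarith)]
  linarith

end Cells

/-! ### The coefficients of the disturbed random walk -/

section WalkCoeff

variable {H : ℝ}

theorem kernel_mono (hH : 1 / 2 < H) {t T s : ℝ} (htT : t ≤ T) (hs : 0 < s) :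
    kernel H t s ≤ kernel H T s := by
  rw [← ENNReal.ofReal_le_ofReal_iff (kernel_nonneg hH T hs.le), ofReal_kernel hH hs,
    ofReal_kernel hH hs]
  gcongr

theorem lintegral_kernel_sq (hH : 1 / 2 < H) (hH' : H < 1) {t : ℝ} (ht : t ∈ Icc (0 : ℝ) 1) :
    ∫⁻ s in Ioc 0 1, ENNReal.ofReal (kernel H t s) * ENNReal.ofReal (kernel H t s) =
      ENNReal.ofReal (t ^ (2 * H)) := by
  rw [lintegral_kernel_mul_kernel_of_le hH hH' ht.1 le_rfl ht.2, sub_self,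
    Real.zero_rpow (by linarith)]
  congr 1
  ring

theorem aestronglyMeasurable_kernel (hH : 1 / 2 < H) (t : ℝ) :
    AEStronglyMeasurable (kernel H t) (volume.restrict (Ioc 0 1)) := by
  have hm : Measurable fun s => (ENNReal.ofReal (kernelConst H * (H - 1 / 2)) *
      ∫⁻ u in Ioo 0 t, kernelDensity (H - 1 / 2) s u).toReal :=
    ((measurable_setLIntegral_kernelDensity _ t).const_mul _).ennreal_toReal
  refine hm.aestronglyMeasurable.congr ?_
  filter_upwards [ae_restrict_mem measurableSet_Ioc] with s hs
  rw [← ofReal_kernel hH hs.1, ENNReal.toReal_ofReal (kernel_nonneg hH t hs.1.le)]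

theorem memLp_kernel (hH : 1 / 2 < H) (hH' : H < 1) {t : ℝ} (ht : t ∈ Icc (0 : ℝ) 1) :
    MemLp (kernel H t) 2 (volume.restrict (Ioc 0 1)) := by
  rw [memLp_two_iff_integrable_sq (aestronglyMeasurable_kernel hH t)]
  refine ⟨(aestronglyMeasurable_kernel hH t).pow 2, ?_⟩
  rw [hasFiniteIntegral_iff_ofReal (ae_of_all _ fun s => sq_nonneg _)]
  have h : ∫⁻ s in Ioc 0 1, ENNReal.ofReal (kernel H t s ^ 2) =
      ∫⁻ s in Ioc 0 1, ENNReal.ofReal (kernel H t s) * ENNReal.ofReal (kernel H t s) :=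
    setLIntegral_congr_fun measurableSet_Ioc fun s hs => by
      rw [← ENNReal.ofReal_mul (kernel_nonneg hH t hs.1.le), sq]
  rw [h, lintegral_kernel_sq hH hH' ht]
  exact ENNReal.ofReal_lt_top

theorem integral_kernel_mul_kernel (hH : 1 / 2 < H) (hH' : H < 1) {t T : ℝ}
    (ht : t ∈ Icc (0 : ℝ) 1) (hT : T ∈ Icc (0 : ℝ) 1) :
    ∫ s in Ioc 0 1, kernel H t s * kernel H T s =
      (t ^ (2 * H) + T ^ (2 * H) - |t - T| ^ (2 * H)) / 2 := by
  wlog htT : t ≤ T generalizing t T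
  · have := this hT ht (le_of_not_ge htT)
    simp_rw [mul_comm (kernel H t _)]
    rw [this, abs_sub_comm]
    ring
  have hnn : 0 ≤ᵐ[volume.restrict (Ioc (0 : ℝ) 1)] fun s => kernel H t s * kernel H T s :=
    (ae_restrict_mem measurableSet_Ioc).mono fun s hs =>
      mul_nonneg (kernel_nonneg hH t hs.1.le) (kernel_nonneg hH T hs.1.le)
  rw [integral_eq_lintegral_of_nonneg_ae hnn ((aestronglyMeasurable_kernel hH t).mul
    (aestronglyMeasurable_kernel hH T))]
  have h : ∫⁻ s in Ioc 0 1, ENNReal.ofReal (kernel H t s * kernel H T s) =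
      ∫⁻ s in Ioc 0 1, ENNReal.ofReal (kernel H t s) * ENNReal.ofReal (kernel H T s) :=
    setLIntegral_congr_fun measurableSet_Ioc fun s hs => by
      rw [← ENNReal.ofReal_mul (kernel_nonneg hH t hs.1.le)]
  rw [h, lintegral_kernel_mul_kernel_of_le hH hH' ht.1 htT hT.2, ENNReal.toReal_ofReal,
    abs_sub_comm, abs_of_nonneg (sub_nonneg.2 htT)]
  have h1 : (T - t) ^ (2 * H) ≤ T ^ (2 * H) :=
    Real.rpow_le_rpow (sub_nonneg.2 htT) (by linarith [ht.1]) (by linarith)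
  have h2 : 0 ≤ t ^ (2 * H) := Real.rpow_nonneg ht.1 _
  linarith

/-- Polarisation of the covariance: `t ↦ kernel H t` embeds `[0, 1]` in `L²` with the increments of
fractional Brownian motion. -/
theorem integral_kernel_sub_sq (hH : 1 / 2 < H) (hH' : H < 1) {t T : ℝ}
    (ht : t ∈ Icc (0 : ℝ) 1) (hT : T ∈ Icc (0 : ℝ) 1) :
    ∫ s in Ioc 0 1, (kernel H t s - kernel H T s) ^ 2 = |t - T| ^ (2 * H) := by
  have hm := memLp_kernel hH hH' ht
  have hM := memLp_kernel hH hH' hT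
  have h : ∀ s, (kernel H t s - kernel H T s) ^ 2 = kernel H t s * kernel H t s -
      2 * (kernel H t s * kernel H T s) + kernel H T s * kernel H T s := fun s => by ring
  simp_rw [h]
  have i1 : Integrable (fun s => kernel H t s * kernel H t s) (volume.restrict (Ioc 0 1)) :=
    hm.integrable_mul hm
  have i2 : Integrable (fun s => 2 * (kernel H t s * kernel H T s)) (volume.restrict (Ioc 0 1)) :=
    (hm.integrable_mul hM).const_mul 2
  have i12 : Integrable (fun s => kernel H t s * kernel H t s -
      2 * (kernel H t s * kernel H T s)) (volume.restrict (Ioc 0 1)) := i1.sub i2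
  have i3 : Integrable (fun s => kernel H T s * kernel H T s) (volume.restrict (Ioc 0 1)) :=
    hM.integrable_mul hM
  rw [integral_add i12 i3, integral_sub i1 i2, integral_const_mul,
    integral_kernel_mul_kernel hH hH' ht ht, integral_kernel_mul_kernel hH hH' ht hT,
    integral_kernel_mul_kernel hH hH' hT hT]
  simp only [sub_self, abs_zero]
  rw [Real.zero_rpow (by linarith)]
  ring

theorem cellCoeff_sub {n : ℕ} {f g : ℝ → ℝ} (hf : IntegrableOn f (Ioc 0 1))
    (hg : IntegrableOn g (Ioc 0 1)) (i : Fin n) :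
    cellCoeff n i (fun s => f s - g s) = cellCoeff n i f - cellCoeff n i g := by
  rw [cellCoeff, intervalIntegral.integral_sub (intervalIntegrable_cell hf i)
    (intervalIntegrable_cell hg i), mul_sub, cellCoeff, cellCoeff]

theorem cellCoeff_sum {n : ℕ} {J : Type*} [Fintype J] (c : J → ℝ) {f : J → ℝ → ℝ}
    (hf : ∀ j, IntegrableOn (f j) (Ioc 0 1)) (i : Fin n) :
    cellCoeff n i (fun s => ∑ j, c j * f j s) = ∑ j, c j * cellCoeff n i (f j) := by
  rw [cellCoeff, intervalIntegral.integral_finsetSum fun j _ =>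
    (intervalIntegrable_cell (hf j) i).const_mul _, Finset.mul_sum]
  refine Finset.sum_congr rfl fun j _ => ?_
  rw [intervalIntegral.integral_const_mul, cellCoeff]
  ring

/-- The coefficients of the disturbed random walk, stopped at time `n`. -/
noncomputable def stoppedCoeff (H : ℝ) (n l : ℕ) (i : Fin n) : ℝ := walkCoeff H n (min l n) i

theorem stoppedCoeff_eq {n l : ℕ} (hl : l ≤ n) (i : Fin n) :
    stoppedCoeff H n l i = walkCoeff H n l i := by rw [stoppedCoeff, min_eq_left hl]

theorem stoppedCoeff_eq_cellCoeff (n l : ℕ) (i : Fin n) :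
    stoppedCoeff H n l i = cellCoeff n i (kernel H ((min l n : ℕ) / n)) := rfl

theorem stoppedCoeff_zero (n : ℕ) (i : Fin n) : stoppedCoeff H n 0 i = 0 :=
  walkCoeff_eq_zero (by simp)

theorem min_div_mem_Icc (l n : ℕ) : ((min l n : ℕ) : ℝ) / n ∈ Icc (0 : ℝ) 1 := by
  refine ⟨by positivity, div_le_one_of_le₀ ?_ (by positivity)⟩
  exact_mod_cast min_le_right l n

theorem stoppedCoeff_mono (hH : 1 / 2 < H) (hH' : H < 1) (n : ℕ) (i : Fin n) :
    Monotone fun l => stoppedCoeff H n l i := by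
  intro l m hlm
  simp only [stoppedCoeff_eq_cellCoeff]
  rw [cellCoeff, cellCoeff]
  have h1 := (memLp_kernel hH hH' (min_div_mem_Icc l n)).integrable (by norm_num)
  have h2 := (memLp_kernel hH hH' (min_div_mem_Icc m n)).integrable (by norm_num)
  refine mul_le_mul_of_nonneg_left ?_ (Real.sqrt_nonneg _)
  rw [intervalIntegral.integral_of_le (cell_le i), intervalIntegral.integral_of_le (cell_le i)]
  refine setIntegral_mono_on (h1.mono_measure (Measure.restrict_mono (Ioc_cell_subset i) le_rfl))
    (h2.mono_measure (Measure.restrict_mono (Ioc_cell_subset i) le_rfl)) measurableSet_Ioc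
    fun s hs => ?_
  refine kernel_mono hH ?_ (Ioc_cell_subset i hs).1
  gcongr

/-- Cell averaging contracts the `L²` norm, and stopping at `n` only shortens time intervals. Thanks
to the stopping, the bound holds beyond `l = n`, where dyadic blocks may reach. -/
theorem sum_stoppedCoeff_sub_sq_le (hH : 1 / 2 < H) (hH' : H < 1) {n : ℕ} (hn : n ≠ 0) {m l : ℕ}
    (hml : m ≤ l) : ∑ i, (stoppedCoeff H n l i - stoppedCoeff H n m i) ^ 2 ≤
      (((l : ℝ) - m) / n) ^ (2 * H) := by
  have h1 := memLp_kernel hH hH' (min_div_mem_Icc l n)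
  have h2 := memLp_kernel hH hH' (min_div_mem_Icc m n)
  simp only [stoppedCoeff_eq_cellCoeff]
  simp_rw [← cellCoeff_sub (h1.integrable (by norm_num)) (h2.integrable (by norm_num))]
  refine (sum_cellCoeff_sq_le hn (h1.sub h2)).trans ?_
  simp only [Pi.sub_apply]
  rw [integral_kernel_sub_sq hH hH' (min_div_mem_Icc l n) (min_div_mem_Icc m n), ← sub_div,
    abs_div, Nat.abs_cast]
  refine Real.rpow_le_rpow (by positivity) ?_ (by linarith)
  gcongr
  have h3 : ((min m n : ℕ) : ℝ) ≤ (min l n : ℕ) := by exact_mod_cast min_le_min_right n hml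
  rw [abs_of_nonneg (sub_nonneg.2 h3)]
  have h4 : min l n + m ≤ l + min m n := by omega
  have h5 : ((min l n : ℕ) : ℝ) + m ≤ l + (min m n : ℕ) := by exact_mod_cast h4
  linarith

theorem sum_stoppedCoeff_sq_le_one (hH : 1 / 2 < H) (hH' : H < 1) {n : ℕ} (hn : n ≠ 0) (l : ℕ) :
    ∑ i, stoppedCoeff H n l i ^ 2 ≤ 1 := by
  simp only [stoppedCoeff_eq_cellCoeff]
  have ht := min_div_mem_Icc l n
  refine (sum_cellCoeff_sq_le hn (memLp_kernel hH hH' ht)).trans ?_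
  simp_rw [pow_two]
  rw [integral_kernel_mul_kernel hH hH' ht ht, sub_self, abs_zero, Real.zero_rpow (by linarith)]
  have := Real.rpow_le_one ht.1 ht.2 (z := 2 * H) (by linarith)
  linarith

/-- Monotonicity in `l` reduces to `l = n`, that is, to the single function `kernel H 1`, whose
square has uniformly small mass on small cells. -/
theorem exists_forall_stoppedCoeff_sq_le (hH : 1 / 2 < H) (hH' : H < 1) {ε : ℝ} (hε : 0 < ε) :
    ∃ N : ℕ, ∀ n ≥ N, ∀ (l : ℕ) (i : Fin n), stoppedCoeff H n l i ^ 2 ≤ ε := by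
  have h1 := memLp_kernel hH hH' (t := 1) ⟨zero_le_one, le_rfl⟩
  obtain ⟨N, hN⟩ := exists_forall_integral_cell_sq_le h1 hε
  refine ⟨N, fun n hn l i => (le_trans ?_ (cellCoeff_sq_le h1 i)).trans (hN n hn i)⟩
  have hn0 : n ≠ 0 := by have := i.pos; omega
  have h2 : stoppedCoeff H n l i ≤ cellCoeff n i (kernel H 1) := by
    have h3 : cellCoeff n i (kernel H 1) = stoppedCoeff H n n i := by
      rw [stoppedCoeff_eq_cellCoeff, min_self, div_self (by exact_mod_cast hn0)]
    rw [h3]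
    have h4 : stoppedCoeff H n l i = stoppedCoeff H n (min l n) i := by simp [stoppedCoeff]
    rw [h4]
    exact stoppedCoeff_mono hH hH' n i (min_le_right l n)
  exact pow_le_pow_left₀ (coeff_nonneg (stoppedCoeff_mono hH hH' n) (stoppedCoeff_zero n) l i) h2 2

theorem wickCoeff_congr {ι : Type*} [DecidableEq ι] {b b' : ℕ → ι → ℝ} {l : ℕ}
    (h : ∀ j ≤ l, b j = b' j) (A : Finset ι) : wickCoeff b l A = wickCoeff b' l A := by
  induction l generalizing A with
  | zero => rfl
  | succ l ih =>
    have ih' := fun A => ih (fun j hj => h j (by omega)) A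
    rw [wickCoeff, wickCoeff, ih', h (l + 1) le_rfl, h l (by omega)]
    exact congrArg _ (Finset.sum_congr rfl fun i _ => by rw [ih'])

theorem wickCoeff_walkCoeff {n l : ℕ} (hl : l ≤ n) (A : Finset (Fin n)) :
    wickCoeff (walkCoeff H n) l A = wickCoeff (stoppedCoeff H n) l A :=
  wickCoeff_congr (fun j hj => funext fun i => (stoppedCoeff_eq (hj.trans hl) i).symm) A

/-- Cauchy–Schwarz. This supplies the small `η` in the comparison of `wickCoeff` with the product.
-/
theorem sum_stoppedCoeff_mul_le (hH : 1 / 2 < H) (hH' : H < 1) {n : ℕ} (hn : n ≠ 0) (L j : ℕ) :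
    ∑ i, stoppedCoeff H n L i * (stoppedCoeff H n (j + 1) i - stoppedCoeff H n j i) ≤
      √((1 / (n : ℝ)) ^ (2 * H)) := by
  refine Real.le_sqrt_of_sq_le ((Finset.sum_mul_sq_le_sq_mul_sq _ _ _).trans ?_)
  have h1 := sum_stoppedCoeff_sq_le_one hH hH' hn L
  have h2 := sum_stoppedCoeff_sub_sq_le hH hH' hn j.le_succ
  have h3 : (((j + 1 : ℕ) : ℝ) - j) / n = 1 / n := by push_cast; ring
  rw [Nat.succ_eq_add_one, h3] at h2
  calc _ ≤ 1 * (1 / (n : ℝ)) ^ (2 * H) :=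
        mul_le_mul h1 h2 (Finset.sum_nonneg fun i _ => sq_nonneg _) zero_le_one
    _ = _ := one_mul _

/-- The covariance of fractional Brownian motion. -/
noncomputable def fbmCov (H t T : ℝ) : ℝ := (t ^ (2 * H) + T ^ (2 * H) - |t - T| ^ (2 * H)) / 2

theorem continuous_fbmCov (hH : 0 < H) : Continuous fun p : ℝ × ℝ => fbmCov H p.1 p.2 := by
  unfold fbmCov
  have h : Continuous fun x : ℝ => x ^ (2 * H) := Real.continuous_rpow_const (by linarith)
  exact (((h.comp continuous_fst).add (h.comp continuous_snd)).sub
    (h.comp (continuous_fst.sub continuous_snd).abs)).div_const 2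

theorem floor_mul_le (n : ℕ) (t : I) : ⌊(n : ℝ) * t⌋₊ ≤ n := by
  have h : ((⌊(n : ℝ) * t⌋₊ : ℕ) : ℝ) ≤ n :=
    (Nat.floor_le (mul_nonneg n.cast_nonneg t.2.1)).trans
      (mul_le_of_le_one_right n.cast_nonneg t.2.2)
  exact_mod_cast h

theorem tendsto_floor_mul_div (t : I) :
    Tendsto (fun n : ℕ => ((⌊(n : ℝ) * t⌋₊ : ℕ) : ℝ) / n) atTop (𝓝 t) := by
  have h := (tendsto_nat_floor_mul_div_atTop (R := ℝ) t.2.1).comp tendsto_natCast_atTop_atTop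
  refine h.congr fun n => ?_
  simp [mul_comm]

/-- Convergence of the variance of linear combinations of values of the walk. -/
theorem tendsto_sum_stoppedCoeff_sq (hH : 1 / 2 < H) (hH' : H < 1) {J : Type*} [Fintype J]
    (c : J → ℝ) (t : J → I) :
    Tendsto (fun n : ℕ => ∑ i : Fin n, (∑ j, c j * stoppedCoeff H n ⌊(n : ℝ) * t j⌋₊ i) ^ 2) atTop
      (𝓝 (∑ j, ∑ k, c j * c k * fbmCov H (t j) (t k))) := by
  set τ : ℕ → J → ℝ := fun n j => ((⌊(n : ℝ) * t j⌋₊ : ℕ) : ℝ) / n with hτ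
  have hτmem : ∀ n j, τ n j ∈ Icc (0 : ℝ) 1 := fun n j => by
    have := min_div_mem_Icc ⌊(n : ℝ) * t j⌋₊ n
    rwa [min_eq_left (floor_mul_le n (t j))] at this
  have hτt : ∀ j, Tendsto (fun n => τ n j) atTop (𝓝 (t j)) := fun j => tendsto_floor_mul_div (t j)
  have hcomb : ∀ τ' : J → ℝ, (∀ j, τ' j ∈ Icc (0 : ℝ) 1) →
      MemLp (fun s => ∑ j, c j * kernel H (τ' j) s) 2 (volume.restrict (Ioc 0 1)) :=
    fun τ' hτ' => memLp_finsetSum _ fun j _ => (memLp_kernel hH hH' (hτ' j)).const_mul _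
  have hsq : ∀ τ' : J → ℝ, (∀ j, τ' j ∈ Icc (0 : ℝ) 1) →
      ∫ s in Ioc 0 1, (∑ j, c j * kernel H (τ' j) s) ^ 2 =
        ∑ j, ∑ k, c j * c k * fbmCov H (τ' j) (τ' k) := by
    intro τ' hτ'
    have h1 : ∀ s, (∑ j, c j * kernel H (τ' j) s) ^ 2 =
        ∑ j, ∑ k, c j * c k * (kernel H (τ' j) s * kernel H (τ' k) s) := fun s => by
      rw [sq, Finset.sum_mul_sum]
      exact Finset.sum_congr rfl fun j _ => Finset.sum_congr rfl fun k _ => by ring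
    simp_rw [h1]
    have h2 : ∀ j k, Integrable (fun s => c j * c k * (kernel H (τ' j) s * kernel H (τ' k) s))
        (volume.restrict (Ioc 0 1)) := fun j k =>
      ((memLp_kernel hH hH' (hτ' j)).integrable_mul (memLp_kernel hH hH' (hτ' k))).const_mul _
    rw [integral_finsetSum _ fun j _ => integrable_finsetSum _ fun k _ => h2 j k]
    refine Finset.sum_congr rfl fun j _ => ?_
    rw [integral_finsetSum _ fun k _ => h2 j k]
    refine Finset.sum_congr rfl fun k _ => ?_
    rw [integral_const_mul, integral_kernel_mul_kernel hH hH' (hτ' j) (hτ' k), fbmCov]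
  -- The kernel times `⌊n t⌋ / n` vary with `n`; their combinations converge in `L²` by the
  -- isometry, as needed for the cell averages.
  have hdiff : Tendsto (fun n => ∫ s in Ioc 0 1,
      ((∑ j, c j * kernel H (τ n j) s) - ∑ j, c j * kernel H (t j) s) ^ 2) atTop (𝓝 0) := by
    have hbound : ∀ n, ∫ s in Ioc 0 1,
        ((∑ j, c j * kernel H (τ n j) s) - ∑ j, c j * kernel H (t j) s) ^ 2 ≤
        (Fintype.card J : ℝ) * ∑ j, c j ^ 2 * |τ n j - t j| ^ (2 * H) := by
      intro n
      have hint : ∀ j, Integrable (fun s => c j ^ 2 * (kernel H (τ n j) s - kernel H (t j) s) ^ 2)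
          (volume.restrict (Ioc 0 1)) := fun j =>
        ((memLp_kernel hH hH' (hτmem n j)).sub
          (memLp_kernel hH hH' (t j).2)).integrable_sq.const_mul _
      have h3 : ∫ s in Ioc 0 1, (Fintype.card J : ℝ) *
          ∑ j, c j ^ 2 * (kernel H (τ n j) s - kernel H (t j) s) ^ 2 =
          (Fintype.card J : ℝ) * ∑ j, c j ^ 2 * |τ n j - t j| ^ (2 * H) := by
        rw [integral_const_mul, integral_finsetSum _ fun j _ => hint j]
        congr 1
        refine Finset.sum_congr rfl fun j _ => ?_
        rw [integral_const_mul, integral_kernel_sub_sq hH hH' (hτmem n j) (t j).2]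
      rw [← h3]
      refine integral_mono ((hcomb _ (hτmem n)).sub (hcomb _ fun j => (t j).2)).integrable_sq
        ((integrable_finsetSum _ fun j _ => hint j).const_mul _) fun s => ?_
      simp only
      rw [← Finset.sum_sub_distrib]
      refine (sq_sum_le_card_mul_sum_sq).trans (le_of_eq ?_)
      rw [Finset.card_univ]
      congr 1
      exact Finset.sum_congr rfl fun j _ => by ring
    have hlim : Tendsto (fun n => (Fintype.card J : ℝ) * ∑ j, c j ^ 2 * |τ n j - t j| ^ (2 * H))
        atTop (𝓝 ((Fintype.card J : ℝ) * ∑ j : J, c j ^ 2 * 0)) := by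
      refine Tendsto.const_mul _ (tendsto_finsetSum _ fun j _ => Tendsto.const_mul _ ?_)
      have h4 : Tendsto (fun n => |τ n j - t j|) atTop (𝓝 0) := by
        have := ((hτt j).sub_const (t j : ℝ)).abs
        simpa using this
      have h5 := h4.rpow_const (p := 2 * H) (Or.inr (by linarith))
      rwa [Real.zero_rpow (by linarith)] at h5
    simp only [mul_zero, Finset.sum_const_zero] at hlim
    exact squeeze_zero (fun n => integral_nonneg fun s => sq_nonneg _) hbound hlim
  have hmain := tendsto_integral_sq_sub_sum_cellCoeff_sq (fun n => hcomb (τ n) (hτmem n))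
    (hcomb (fun j => (t j : ℝ)) fun j => (t j).2) hdiff
  have hcell : ∀ n (i : Fin n), cellCoeff n i (fun s => ∑ j, c j * kernel H (τ n j) s) =
      ∑ j, c j * stoppedCoeff H n ⌊(n : ℝ) * t j⌋₊ i := by
    intro n i
    rw [cellCoeff_sum c fun j => (memLp_kernel hH hH' (hτmem n j)).integrable (by norm_num)]
    refine Finset.sum_congr rfl fun j _ => ?_
    rw [stoppedCoeff_eq_cellCoeff, min_eq_left (floor_mul_le n (t j))]
  simp_rw [hcell, hsq _ (hτmem _)] at hmain
  have hcov : Tendsto (fun n => ∑ j, ∑ k, c j * c k * fbmCov H (τ n j) (τ n k)) atTop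
      (𝓝 (∑ j, ∑ k, c j * c k * fbmCov H (t j) (t k))) := by
    refine tendsto_finsetSum _ fun j _ => tendsto_finsetSum _ fun k _ => Tendsto.const_mul _ ?_
    have h6 : Tendsto (fun n => (τ n j, τ n k)) atTop (𝓝 ((t j : ℝ), (t k : ℝ))) :=
      (hτt j).prodMk_nhds (hτt k)
    have h7 := ((continuous_fbmCov (H := H) (by linarith)).tendsto ((t j : ℝ), (t k : ℝ))).comp h6
    simpa only [Function.comp_def] using h7
  have := hcov.sub hmain
  simpa using this

end WalkCoeff

/-! ### Hermite polynomials with variance parameter -/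

/-- The Hermite polynomials with variance parameter `v`. -/
noncomputable def wickPoly {R : Type*} [CommRing R] (v x : R) : ℕ → R
  | 0 => 1
  | 1 => x
  | k + 2 => x * wickPoly v x (k + 1) - ((k : R) + 1) * v * wickPoly v x k

section Hermite

theorem wickPoly_ofReal (v x : ℝ) (k : ℕ) :
    wickPoly (v : ℂ) (x : ℂ) k = ((wickPoly v x k : ℝ) : ℂ) := by
  induction k using Nat.twoStepInduction with
  | zero => simp [wickPoly]
  | one => simp [wickPoly]
  | more k ih1 ih2 => simp [wickPoly, ih1, ih2]

variable {𝕜 : Type*} [NontriviallyNormedField 𝕜]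

/-- The Appell property, obtained from the three-term recursion; it drives the computation of the
derivatives of the generating function. -/
theorem hasDerivAt_wickPoly_succ (v x : 𝕜) (k : ℕ) :
    HasDerivAt (fun y => wickPoly v y (k + 1)) (((k : 𝕜) + 1) * wickPoly v x k) x := by
  induction k using Nat.twoStepInduction with
  | zero => simpa [wickPoly] using hasDerivAt_id' x
  | one =>
    have h := ((hasDerivAt_id x).mul (hasDerivAt_id x)).sub_const v
    have e : (fun y => wickPoly v y (1 + 1)) = fun y => id y * id y - v := by
      funext y; simp [wickPoly]
    rw [e]
    convert! h using 1
    simp [wickPoly]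
    ring
  | more k ih1 ih2 =>
    have h := ((hasDerivAt_id x).mul ih2).sub (ih1.const_mul (((k + 1 : ℕ) : 𝕜) + 1) |>.const_mul v)
    have e : (fun y => wickPoly v y (k + 2 + 1)) = fun y => id y * wickPoly v y (k + 1 + 1) -
        v * ((((k + 1 : ℕ) : 𝕜) + 1) * wickPoly v y (k + 1)) := by
      funext y
      rw [wickPoly]
      simp
      ring
    rw [e]
    convert! h using 1
    simp only [id]
    have e2 : wickPoly v x (k + 2) = x * wickPoly v x (k + 1) - ((k : 𝕜) + 1) * v * wickPoly v x k :=
      rfl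
    rw [e2]
    push_cast
    ring

/-- The derivatives of a solution of `f' = (x - v w) f`. -/
theorem iteratedDeriv_eq_wickPoly_mul {f : 𝕜 → 𝕜} {v x : 𝕜}
    (hf : ∀ w, HasDerivAt f ((x - v * w) * f w) w) (k : ℕ) :
    iteratedDeriv k f = fun w => wickPoly v (x - v * w) k * f w := by
  induction k with
  | zero => funext w; simp [wickPoly]
  | succ k ih =>
    rw [iteratedDeriv_succ, ih]
    funext w
    have hlin : HasDerivAt (fun w => x - v * w) (-v) w := by
      simpa using ((hasDerivAt_id w).const_mul v).const_sub x
    cases k with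
    | zero =>
      have : (fun w => wickPoly v (x - v * w) 0 * f w) = f := by funext w; simp [wickPoly]
      rw [this, (hf w).deriv]
      simp [wickPoly]
    | succ k =>
      have h := ((hasDerivAt_wickPoly_succ v (x - v * w) k).comp w hlin).mul (hf w)
      have h' := h.deriv
      simp only [Function.comp_def] at h'
      refine h'.trans ?_
      rw [wickPoly]
      ring

end Hermite

theorem hasDerivAt_gaussianExp (v x w : ℝ) :
    HasDerivAt (fun w : ℝ => Real.exp (w * x - w ^ 2 * v / 2))
      ((x - v * w) * Real.exp (w * x - w ^ 2 * v / 2)) w := by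
  have h1 : HasDerivAt (fun w : ℝ => w * x - w ^ 2 * v / 2) (1 * x - (2 * w ^ 1 * 1) * v / 2) w :=
    ((hasDerivAt_id w).mul_const x).sub ((((hasDerivAt_id w).pow 2).mul_const v).div_const 2)
  convert! h1.exp using 1
  ring

/-- The Wick exponential of `w Φ` solves `f' = (x - v w) f` in `w`, with `x = Φ ω` and `v = E[Φ²]`.
-/
theorem wickPow_eq_wickPoly {Ω : Type*} [MeasurableSpace Ω] (P : Measure Ω) (Φ : Ω → ℝ) (k : ℕ)
    (ω : Ω) : wickPow P Φ k ω = wickPoly (∫ ω', Φ ω' ^ 2 ∂P) (Φ ω) k := by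
  have h : (fun w : ℝ => wickExp P (fun ω' => w * Φ ω') ω) =
      fun w : ℝ => Real.exp (w * Φ ω - w ^ 2 * (∫ ω', Φ ω' ^ 2 ∂P) / 2) := by
    funext w
    simp only [wickExp, mul_pow, integral_const_mul]
  rw [wickPow, h, iteratedDeriv_eq_wickPoly_mul fun w => hasDerivAt_gaussianExp _ _ w]
  simp

/-- The generating function of the Hermite polynomials. -/
theorem hasSum_wickPoly (v x : ℝ) :
    HasSum (fun k : ℕ => wickPoly v x k / (k.factorial : ℝ)) (Real.exp (x - v / 2)) := by
  -- The generating function extends to an entire function, so its Taylor series at `0` converges at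
  -- `1`.
  let f : ℂ → ℂ := fun w => Complex.exp (w * x - w ^ 2 * v / 2)
  have hf : ∀ w, HasDerivAt f (((x : ℂ) - v * w) * f w) w := fun w => by
    have h1 : HasDerivAt (fun w : ℂ => w * (x : ℂ) - w ^ 2 * v / 2)
        (1 * (x : ℂ) - (2 * w ^ 1 * 1) * v / 2) w :=
      ((hasDerivAt_id w).mul_const (x : ℂ)).sub
        ((((hasDerivAt_id w).pow 2).mul_const (v : ℂ)).div_const 2)
    convert! h1.cexp using 1
    simp only [f]
    ring
  have hd : Differentiable ℂ f := fun w => (hf w).differentiableAt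
  have h := Complex.hasSum_taylorSeries_of_entire hd 0 1
  have hval : f 1 = ((Real.exp (x - v / 2) : ℝ) : ℂ) := by simp [f]
  have hterm : ∀ k : ℕ, ((k.factorial : ℂ)⁻¹ • ((1 : ℂ) - 0) ^ k • iteratedDeriv k f 0) =
      ((wickPoly v x k / (k.factorial : ℝ) : ℝ) : ℂ) := fun k => by
    rw [iteratedDeriv_eq_wickPoly_mul hf]
    have : f 0 = 1 := by simp [f]
    simp only [this, mul_zero, sub_zero, wickPoly_ofReal, one_pow, smul_eq_mul, mul_one, one_mul]
    push_cast
    field_simp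
  simp_rw [hterm] at h
  rw [hval] at h
  exact_mod_cast h

theorem continuous_wickPoly (v : ℝ) (k : ℕ) : Continuous fun x : ℝ => wickPoly v x k := by
  induction k using Nat.twoStepInduction with
  | zero => simpa only [wickPoly] using continuous_const
  | one => simpa only [wickPoly] using continuous_id'
  | more k ih1 ih2 =>
    simp only [wickPoly]
    fun_prop

theorem continuous_wickPoly_uncurry (k : ℕ) :
    Continuous fun p : ℝ × ℝ => wickPoly p.1 p.2 k := by
  induction k using Nat.twoStepInduction with
  | zero => simpa only [wickPoly] using continuous_const
  | one => simpa only [wickPoly] using continuous_snd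
  | more k ih1 ih2 =>
    simp only [wickPoly]
    fun_prop

/-- The Hermite polynomials decay superexponentially relative to the factorial. -/
theorem exists_abs_wickPoly_div_le (M : ℝ) {ρ : ℝ} (hρ : 0 < ρ) :
    ∃ K : ℝ, ∀ (k : ℕ) (v x : ℝ), |v| ≤ 1 → |x| ≤ M →
      |wickPoly v x k / (k.factorial : ℝ)| ≤ K * ρ ^ k := by
  -- Relative to `ρ ^ k`, the recursion for `wickPoly / k!` multiplies the bound by `r / (k + 2)`.
  -- Once `k ≥ k0` this is at most one, so a constant valid for the first indices works for all.
  obtain ⟨k0, hk0⟩ := exists_nat_gt (|M| / ρ + 1 / ρ ^ 2)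
  set r := |M| / ρ + 1 / ρ ^ 2 with hr
  have hr0 : 0 ≤ r := by positivity
  have hstep : ∀ (K : ℝ) (k : ℕ) (v x : ℝ), 0 ≤ K → |v| ≤ 1 → |x| ≤ M →
      |wickPoly v x k / (k.factorial : ℝ)| ≤ K * ρ ^ k →
      |wickPoly v x (k + 1) / ((k + 1).factorial : ℝ)| ≤ K * ρ ^ (k + 1) →
      |wickPoly v x (k + 2) / ((k + 2).factorial : ℝ)| ≤ K * ρ ^ (k + 2) * (r / ((k : ℝ) + 2)) := by
    intro K k v x hK hv hx h1 h2
    have e : wickPoly v x (k + 2) / ((k + 2).factorial : ℝ) =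
        (x * (wickPoly v x (k + 1) / ((k + 1).factorial : ℝ)) -
          v * (wickPoly v x k / (k.factorial : ℝ))) / ((k : ℝ) + 2) := by
      have hf : (k.factorial : ℝ) ≠ 0 := by exact_mod_cast k.factorial_ne_zero
      rw [wickPoly, Nat.factorial_succ (k + 1), Nat.factorial_succ k]
      push_cast
      field_simp
      ring
    have hx' : |x| ≤ |M| := hx.trans (le_abs_self M)
    rw [e, abs_div, abs_of_pos (show (0 : ℝ) < (k : ℝ) + 2 by positivity),
      ← mul_div_assoc (K * ρ ^ (k + 2))]
    refine (div_le_div_iff_of_pos_right (show (0 : ℝ) < (k : ℝ) + 2 by positivity)).2 ?_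
    calc |x * (wickPoly v x (k + 1) / ((k + 1).factorial : ℝ)) -
          v * (wickPoly v x k / (k.factorial : ℝ))|
        ≤ |M| * (K * ρ ^ (k + 1)) + 1 * (K * ρ ^ k) := by
          refine (abs_sub _ _).trans ?_
          rw [abs_mul, abs_mul]
          gcongr
      _ = K * ρ ^ (k + 2) * r := by
          rw [hr]
          field_simp
          ring
  have hinit : ∀ N : ℕ, ∃ K : ℝ, 0 ≤ K ∧ ∀ k ≤ N, ∀ v x : ℝ, |v| ≤ 1 → |x| ≤ M →
      |wickPoly v x k / (k.factorial : ℝ)| ≤ K * ρ ^ k := by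
    intro N
    induction N with
    | zero =>
      refine ⟨1, zero_le_one, fun k hk v x _ _ => ?_⟩
      obtain rfl : k = 0 := by omega
      simp [wickPoly]
    | succ N ih =>
      obtain ⟨K, hK, h⟩ := ih
      have hmono : ∀ K' : ℝ, K ≤ K' → ∀ k ≤ N, ∀ v x : ℝ, |v| ≤ 1 → |x| ≤ M →
          |wickPoly v x k / (k.factorial : ℝ)| ≤ K' * ρ ^ k := fun K' hKK' k hk v x hv hx =>
        (h k hk v x hv hx).trans (by gcongr)
      cases N with
      | zero =>
        refine ⟨K + |M| / ρ, by positivity, fun k hk v x hv hx => ?_⟩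
        rcases Nat.lt_or_ge k 1 with hk1 | hk1
        · exact hmono _ (le_add_of_nonneg_right (by positivity)) k (by omega) v x hv hx
        · obtain rfl : k = 1 := by omega
          simp only [wickPoly, Nat.factorial_one, Nat.cast_one, div_one, pow_one]
          have : |M| / ρ * ρ = |M| := div_mul_cancel₀ _ hρ.ne'
          have h2 : 0 ≤ K * ρ := by positivity
          rw [add_mul, this]
          linarith [le_abs_self M]
      | succ N =>
        refine ⟨K + K * r, by positivity, fun k hk v x hv hx => ?_⟩
        rcases Nat.lt_or_ge k (N + 2) with hk1 | hk1
        · exact hmono _ (le_add_of_nonneg_right (by positivity)) k (by omega) v x hv hx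
        · obtain rfl : k = N + 2 := by omega
          refine (hstep K N v x hK hv hx (h N (by omega) v x hv hx)
            (h (N + 1) le_rfl v x hv hx)).trans ?_
          have h3 : r / ((N : ℝ) + 2) ≤ r := div_le_self hr0 (by linarith [N.cast_nonneg (α := ℝ)])
          have h4 : 0 ≤ K * ρ ^ (N + 2) := by positivity
          nlinarith [mul_le_mul_of_nonneg_left h3 h4]
  obtain ⟨K, hK, h⟩ := hinit (k0 + 1)
  refine ⟨K, fun k => ?_⟩
  induction k using Nat.strong_induction_on with
  | _ k ih =>
    intro v x hv hx
    rcases Nat.lt_or_ge k (k0 + 2) with hk | hk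
    · exact h k (by omega) v x hv hx
    · obtain ⟨j, rfl⟩ : ∃ j, k = j + 2 := ⟨k - 2, by omega⟩
      refine (hstep K j v x hK hv hx (ih j (by omega) v x hv hx)
        (ih (j + 1) (by omega) v x hv hx)).trans ?_
      refine mul_le_of_le_one_right (by positivity) ?_
      rw [div_le_one (by positivity)]
      have : (k0 : ℝ) ≤ j := by exact_mod_cast (by omega : k0 ≤ j)
      linarith

/-- A uniform summable bound for Wick power series. -/
theorem exists_abs_mul_wickPoly_le {a : ℕ → ℝ} {C : ℝ} (hC : 0 ≤ C)
    (ha : ∀ k, 1 ≤ k → |a k| ≤ C ^ k) (M : ℝ) :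
    ∃ K : ℝ, ∀ (k : ℕ) (v x : ℝ), |v| ≤ 1 → |x| ≤ M →
      |a k / (k.factorial : ℝ) * wickPoly v x k| ≤ K * (1 / 2) ^ k := by
  -- This `ρ` makes `((C + 1) ρ) ^ k = (1 / 2) ^ k`. The growth condition starts at `k = 1`, so `a
  -- 0` enters through the factor `1 + |a 0|`.
  obtain ⟨K, hK⟩ := exists_abs_wickPoly_div_le M (ρ := 1 / (2 * (C + 1))) (by positivity)
  have ha' : ∀ k, |a k| ≤ (1 + |a 0|) * (C + 1) ^ k := fun k => by
    rcases Nat.eq_zero_or_pos k with rfl | hk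
    · simp
    · calc |a k| ≤ C ^ k := ha k hk
        _ ≤ (C + 1) ^ k := by gcongr; linarith
        _ ≤ _ := le_mul_of_one_le_left (by positivity) (by linarith [abs_nonneg (a 0)])
  refine ⟨(1 + |a 0|) * K, fun k v x hv hx => ?_⟩
  have h := hK k v x hv hx
  have e : a k / (k.factorial : ℝ) * wickPoly v x k =
      a k * (wickPoly v x k / (k.factorial : ℝ)) := by ring
  rw [e, abs_mul]
  refine (mul_le_mul (ha' k) h (abs_nonneg _) (by positivity)).trans (le_of_eq ?_)
  rw [mul_mul_mul_comm, ← mul_pow, mul_assoc, mul_assoc]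
  congr 3
  field_simp

/-- The sum of a Wick power series. -/
noncomputable def wickSeries (a : ℕ → ℝ) (v x : ℝ) : ℝ :=
  ∑' k : ℕ, a k / (k.factorial : ℝ) * wickPoly v x k

theorem hasSum_wickSeries {a : ℕ → ℝ} {C : ℝ} (hC : 0 ≤ C) (ha : ∀ k, 1 ≤ k → |a k| ≤ C ^ k)
    {v : ℝ} (hv : |v| ≤ 1) (x : ℝ) :
    HasSum (fun k : ℕ => a k / (k.factorial : ℝ) * wickPoly v x k) (wickSeries a v x) := by
  obtain ⟨K, hK⟩ := exists_abs_mul_wickPoly_le hC ha |x|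
  refine Summable.hasSum (Summable.of_norm_bounded
    ((summable_geometric_of_lt_one (by norm_num) (by norm_num : (1 / 2 : ℝ) < 1)).mul_left K)
    fun k => hK k v x hv le_rfl)

theorem continuous_wickSeries_comp {a : ℕ → ℝ} {C : ℝ} (hC : 0 ≤ C)
    (ha : ∀ k, 1 ≤ k → |a k| ≤ C ^ k) {T : Type*} [TopologicalSpace T] [CompactSpace T]
    {v x : T → ℝ} (hv : Continuous v) (hx : Continuous x) (hv1 : ∀ t, |v t| ≤ 1) :
    Continuous fun t => wickSeries a (v t) (x t) := by
  obtain ⟨M, hM⟩ := isCompact_univ.exists_bound_of_continuousOn hx.continuousOn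
  obtain ⟨K, hK⟩ := exists_abs_mul_wickPoly_le hC ha M
  refine continuous_tsum (u := fun k => K * (1 / 2) ^ k) (fun k => ?_)
    ((summable_geometric_of_lt_one (by norm_num) (by norm_num : (1 / 2 : ℝ) < 1)).mul_left K)
    fun k t => hK k _ _ (hv1 t) (hM t (mem_univ t))
  exact continuous_const.mul ((continuous_wickPoly_uncurry k).comp (hv.prodMk hx))

/-- The partial sums of a Wick power series converge uniformly. -/
theorem exists_abs_wickSeries_sub_le {a : ℕ → ℝ} {C : ℝ} (hC : 0 ≤ C)
    (ha : ∀ k, 1 ≤ k → |a k| ≤ C ^ k) (M : ℝ) :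
    ∃ K : ℝ, ∀ (m : ℕ) (v x : ℝ), |v| ≤ 1 → |x| ≤ M →
      |wickSeries a v x - ∑ k ∈ Finset.range (m + 1), a k / (k.factorial : ℝ) * wickPoly v x k| ≤
        K * (1 / 2) ^ m := by
  obtain ⟨K, hK⟩ := exists_abs_mul_wickPoly_le hC ha M
  refine ⟨K, fun m v x hv hx => ?_⟩
  have h3 := (hasSum_nat_add_iff' (m + 1)).2 (hasSum_wickSeries hC ha hv x)
  have hg : HasSum (fun k : ℕ => K * (1 / 2 : ℝ) ^ (k + (m + 1))) (K * (1 / 2) ^ m) := by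
    have h4 := (hasSum_geometric_of_lt_one (r := (1 / 2 : ℝ)) (by norm_num)
      (by norm_num)).mul_left (K * (1 / 2 : ℝ) ^ (m + 1))
    have e1 : (fun k : ℕ => K * (1 / 2 : ℝ) ^ (k + (m + 1))) =
        fun k => K * (1 / 2 : ℝ) ^ (m + 1) * (1 / 2) ^ k := by
      funext k; rw [pow_add]; ring
    have e2 : K * (1 / 2 : ℝ) ^ m = K * (1 / 2 : ℝ) ^ (m + 1) * (1 - 1 / 2)⁻¹ := by
      rw [pow_succ]; norm_num; ring
    rw [e1, e2]
    exact h4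
  exact h3.norm_le_of_bounded hg fun k => hK _ v x hv hx

/-! ### The central limit theorem for the disturbed random walk -/

section CentralLimit

theorem abs_prod_sub_prod_le {ι : Type*} (s : Finset ι) {a b : ι → ℝ} (ha : ∀ i, |a i| ≤ 1)
    (hb : ∀ i, |b i| ≤ 1) : |∏ i ∈ s, a i - ∏ i ∈ s, b i| ≤ ∑ i ∈ s, |a i - b i| := by
  classical
  induction s using Finset.induction_on with
  | empty => simp
  | insert i s hi ih =>
    rw [Finset.prod_insert hi, Finset.prod_insert hi, Finset.sum_insert hi]
    have e : a i * ∏ j ∈ s, a j - b i * ∏ j ∈ s, b j =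
        (a i - b i) * ∏ j ∈ s, a j + b i * (∏ j ∈ s, a j - ∏ j ∈ s, b j) := by ring
    rw [e]
    refine (abs_add_le _ _).trans (add_le_add ?_ ?_)
    · rw [abs_mul]
      refine mul_le_of_le_one_right (abs_nonneg _) ?_
      rw [Finset.abs_prod]
      exact Finset.prod_le_one (fun _ _ => abs_nonneg _) fun j _ => ha j
    · rw [abs_mul]
      exact (mul_le_of_le_one_left (abs_nonneg _) (hb i)).trans ih

/-- Both functions agree with `1 - x² / 2` up to a multiple of `x⁴`. -/
theorem abs_cos_sub_exp_le {x : ℝ} (hx : x ^ 2 ≤ 1) :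
    |Real.cos x - Real.exp (-(x ^ 2 / 2))| ≤ x ^ 4 := by
  have hx1 : |x| ≤ 1 := by rwa [← sq_le_one_iff_abs_le_one]
  have h1 := Real.cos_bound hx1
  have e1 : |x| ^ 4 = x ^ 4 := by rw [pow_abs, abs_of_nonneg (by positivity)]
  rw [e1] at h1
  have h2 : |Real.exp (-(x ^ 2 / 2)) - 1 - -(x ^ 2 / 2)| ≤ (-(x ^ 2 / 2)) ^ 2 :=
    Real.abs_exp_sub_one_sub_id_le (by rw [abs_neg, abs_of_nonneg (by positivity)]; linarith)
  rw [abs_le] at *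
  have h4 : (0 : ℝ) ≤ x ^ 4 := by positivity
  have e2 : (-(x ^ 2 / 2)) ^ 2 = x ^ 4 / 4 := by ring
  rw [e2] at h2
  constructor <;> linarith [h1.1, h1.2, h2.1, h2.2]

theorem abs_prod_cos_sub_exp_le {ι : Type*} [Fintype ι] {y : ι → ℝ} {β : ℝ} (hβ : β ≤ 1)
    (hy : ∀ i, y i ^ 2 ≤ β) :
    |∏ i, Real.cos (y i) - Real.exp (-((∑ i, y i ^ 2) / 2))| ≤ β * ∑ i, y i ^ 2 := by
  rw [Finset.sum_div, ← Finset.sum_neg_distrib, Real.exp_sum, Finset.mul_sum]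
  refine (abs_prod_sub_prod_le _ (fun i => Real.abs_cos_le_one _) fun i => ?_).trans
    (Finset.sum_le_sum fun i _ => ?_)
  · rw [Real.abs_exp]
    exact Real.exp_le_one_iff.2 (by have := sq_nonneg (y i); linarith)
  · refine (abs_cos_sub_exp_le ((hy i).trans hβ)).trans ?_
    have e : y i ^ 4 = y i ^ 2 * y i ^ 2 := by ring
    rw [e]
    exact mul_le_mul_of_nonneg_right (hy i) (sq_nonneg _)

variable {Ω : Type*} [MeasurableSpace Ω] {n : ℕ} {P : Measure Ω} [IsProbabilityMeasure P]

theorem IsSymmetricBernoulli.integral_cexp_sum {ξ : Fin n → Ω → ℝ}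
    (hξ : IsSymmetricBernoulli ξ P) (y : Fin n → ℝ) :
    ∫ ω, Complex.exp (((∑ i, y i * ξ i ω : ℝ) : ℂ) * Complex.I) ∂P =
      ((∏ i, Real.cos (y i) : ℝ) : ℂ) := by
  have h := hξ.indep.integral_fun_prod_comp (𝕜 := ℂ)
    (f := fun i x => Complex.exp (((y i * x : ℝ) : ℂ) * Complex.I))
    (fun i => (hξ.measurable i).aemeasurable)
    (fun i => Continuous.aestronglyMeasurable (by fun_prop))
  have e : ∀ ω, Complex.exp (((∑ i, y i * ξ i ω : ℝ) : ℂ) * Complex.I) =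
      ∏ i, Complex.exp (((y i * ξ i ω : ℝ) : ℂ) * Complex.I) := fun ω => by
    rw [Complex.ofReal_sum, Finset.sum_mul, Complex.exp_sum]
  simp_rw [e]
  rw [h, Complex.ofReal_prod]
  refine Finset.prod_congr rfl fun i _ => ?_
  rw [hξ.integral_comp i (fun x : ℝ => Complex.exp (((y i * x : ℝ) : ℂ) * Complex.I)),
    Complex.ofReal_cos, Complex.cos]
  simp [Complex.real_smul]
  ring

end CentralLimit

/-! ### Convergence of finite-dimensional distributions. -/

section Limit

variable {Ω' : Type*} [MeasurableSpace Ω'] {P' : Measure Ω'} [IsProbabilityMeasure P'] {H : ℝ}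
  {B : I → Ω' → ℝ}

theorem IsFractionalBrownianMotion.aemeasurable (hB : IsFractionalBrownianMotion H B P') (t : I) :
    AEMeasurable (B t) P' := (hB.gaussian.hasGaussianLaw_eval t).aemeasurable

theorem IsFractionalBrownianMotion.memLp_two (hB : IsFractionalBrownianMotion H B P') (t : I) :
    MemLp (B t) 2 P' := (hB.gaussian.hasGaussianLaw_eval t).memLp_two

theorem IsFractionalBrownianMotion.integral_sq (hH : 0 < H)
    (hB : IsFractionalBrownianMotion H B P') (t : I) :
    ∫ ω, B t ω ^ 2 ∂P' = (t : ℝ) ^ (2 * H) := by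
  have h := hB.covariance t t
  simp_rw [← sq] at h
  rw [h, sub_self, abs_zero, Real.zero_rpow (by positivity)]
  ring

theorem IsFractionalBrownianMotion.integral_cexp_sum (hB : IsFractionalBrownianMotion H B P')
    {J : Type*} [Fintype J] (c : J → ℝ) (t : J → I) :
    ∫ ω, Complex.exp (((∑ j, c j * B (t j) ω : ℝ) : ℂ) * Complex.I) ∂P' =
      ((Real.exp (-((∑ j, ∑ k, c j * c k * fbmCov H (t j) (t k)) / 2)) : ℝ) : ℂ) := by
  have hG : HasGaussianLaw (fun ω => ∑ j, c j * B (t j) ω) P' :=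
    ((hB.gaussian.comp_right t).smul c).hasGaussianLaw_fun_sum
  have hm : ∫ ω, ∑ j, c j * B (t j) ω ∂P' = 0 := by
    rw [integral_finsetSum _ fun j _ =>
      ((hB.memLp_two (t j)).integrable (by norm_num)).const_mul _]
    refine Finset.sum_eq_zero fun j _ => ?_
    rw [integral_const_mul, hB.mean_zero, mul_zero]
  have hv : Var[fun ω => ∑ j, c j * B (t j) ω; P'] =
      ∑ j, ∑ k, c j * c k * fbmCov H (t j) (t k) := by
    rw [variance_eq_sub hG.memLp_two, hm]
    have e : ∀ ω, (∑ j, c j * B (t j) ω) ^ 2 =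
        ∑ j, ∑ k, c j * c k * (B (t j) ω * B (t k) ω) := fun ω => by
      rw [sq, Finset.sum_mul_sum]
      exact Finset.sum_congr rfl fun j _ => Finset.sum_congr rfl fun k _ => by ring
    have hi : ∀ j k, Integrable (fun ω => c j * c k * (B (t j) ω * B (t k) ω)) P' := fun j k =>
      ((hB.memLp_two (t j)).integrable_mul (hB.memLp_two (t k))).const_mul _
    have e' : ((fun ω => ∑ j, c j * B (t j) ω) ^ 2 : Ω' → ℝ) =
        fun ω => ∑ j, ∑ k, c j * c k * (B (t j) ω * B (t k) ω) := funext e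
    rw [e', integral_finsetSum _ fun j _ => integrable_finsetSum _ fun k _ => hi j k]
    rw [zero_pow two_ne_zero, sub_zero]
    refine Finset.sum_congr rfl fun j _ => ?_
    rw [integral_finsetSum _ fun k _ => hi j k]
    refine Finset.sum_congr rfl fun k _ => ?_
    rw [integral_const_mul, hB.covariance, fbmCov]
  have h := hG.charFun_map_eq (1 : ℝ)
  rw [charFun_apply_real, integral_map hG.aemeasurable (by fun_prop)] at h
  have e3 : ∀ x : ℝ, inner ℝ (1 : ℝ) x = x := fun x => by simp
  simp only [e3] at h
  rw [hm, hv] at h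
  simp only [Complex.ofReal_one, one_mul] at h
  rw [h]
  push_cast
  congr 1
  ring

variable {Ω : Type*} [MeasurableSpace Ω] {P : Measure Ω} [IsProbabilityMeasure P]
  {ξ : (n : ℕ) → Fin n → Ω → ℝ}

/-- The finite-dimensional distributions of the disturbed random walk converge to those of
fractional Brownian motion. -/
theorem tendstoInDistribution_walk (hH : 1 / 2 < H) (hH' : H < 1)
    (hξ : ∀ n, IsSymmetricBernoulli (ξ n) P) (hB : IsFractionalBrownianMotion H B P')
    {J : Type*} [Fintype J] (t : J → I) :
    TendstoInDistribution
      (fun (n : ℕ) ω (j : J) => ∑ i, stoppedCoeff H n ⌊(n : ℝ) * t j⌋₊ i * ξ n i ω) atTop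
      (fun ω j => B (t j) ω) (fun _ => P) P' := by
  have hmeas : ∀ n, Measurable fun ω (j : J) =>
      ∑ i, stoppedCoeff H n ⌊(n : ℝ) * t j⌋₊ i * ξ n i ω := fun n =>
    measurable_pi_lambda _ fun j => Finset.measurable_fun_sum _ fun i _ =>
      ((hξ n).measurable i).const_mul _
  have hmeasB : AEMeasurable (fun ω (j : J) => B (t j) ω) P' :=
    aemeasurable_pi_lambda _ fun j => hB.aemeasurable (t j)
  have hX : ∀ n, AEMeasurable (fun ω => (WithLp.toLp 2 fun j =>
      ∑ i, stoppedCoeff H n ⌊(n : ℝ) * t j⌋₊ i * ξ n i ω : EuclideanSpace ℝ J)) P := fun n =>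
    ((WithLp.measurable_toLp 2 (J → ℝ)).comp (hmeas n)).aemeasurable
  have hY : AEMeasurable (fun ω => (WithLp.toLp 2 fun j => B (t j) ω : EuclideanSpace ℝ J)) P' :=
    (WithLp.measurable_toLp 2 (J → ℝ)).comp_aemeasurable hmeasB
  -- Characteristic functions need an inner product, so convergence is proved in `EuclideanSpace ℝ
  -- J` and transported by the continuous map to `J → ℝ`.
  have hE : TendstoInDistribution (fun (n : ℕ) ω => (WithLp.toLp 2 fun j =>
      ∑ i, stoppedCoeff H n ⌊(n : ℝ) * t j⌋₊ i * ξ n i ω : EuclideanSpace ℝ J)) atTop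
      (fun ω => (WithLp.toLp 2 fun j => B (t j) ω : EuclideanSpace ℝ J)) (fun _ => P) P' := by
    refine ⟨hX, hY, ProbabilityMeasure.tendsto_iff_tendsto_charFun.2 fun c => ?_⟩
    simp only [ProbabilityMeasure.coe_mk, charFun_apply]
    rw [integral_map hY (by fun_prop)]
    have e1 : ∀ n, ∫ x, Complex.exp (((inner ℝ x c : ℝ) : ℂ) * Complex.I) ∂(P.map fun ω =>
        (WithLp.toLp 2 fun j =>
          ∑ i, stoppedCoeff H n ⌊(n : ℝ) * t j⌋₊ i * ξ n i ω : EuclideanSpace ℝ J)) =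
        ((∏ i : Fin n, Real.cos (∑ j, c j * stoppedCoeff H n ⌊(n : ℝ) * t j⌋₊ i) : ℝ) : ℂ) := by
      intro n
      rw [integral_map (hX n) (by fun_prop), ← (hξ n).integral_cexp_sum]
      congr 1
      funext ω
      congr 3
      simp only [PiLp.inner_apply, RCLike.inner_apply, conj_trivial, Finset.mul_sum, Finset.sum_mul]
      rw [Finset.sum_comm]
      exact Finset.sum_congr rfl fun _ _ => Finset.sum_congr rfl fun _ _ => by ring
    have e2 : ∫ ω, Complex.exp (((inner ℝ (WithLp.toLp 2 fun j => B (t j) ω : EuclideanSpace ℝ J)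
        c : ℝ) : ℂ) * Complex.I) ∂P' =
        ((Real.exp (-((∑ j, ∑ k, c j * c k * fbmCov H (t j) (t k)) / 2)) : ℝ) : ℂ) := by
      rw [← hB.integral_cexp_sum (fun j => c j) t]
      simp only [PiLp.inner_apply, RCLike.inner_apply, conj_trivial]
    rw [e2]
    simp_rw [e1]
    refine (Complex.continuous_ofReal.tendsto _).comp ?_
    have hs := tendsto_sum_stoppedCoeff_sq hH hH' (fun j => c j) t
    have hexp : Tendsto (fun n : ℕ => Real.exp (-((∑ i : Fin n,
        (∑ j, c j * stoppedCoeff H n ⌊(n : ℝ) * t j⌋₊ i) ^ 2) / 2))) atTop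
        (𝓝 (Real.exp (-((∑ j, ∑ k, c j * c k * fbmCov H (t j) (t k)) / 2)))) :=
      (Real.continuous_exp.tendsto _).comp (hs.div_const 2).neg
    have hdiff : Tendsto (fun n : ℕ =>
        ∏ i : Fin n, Real.cos (∑ j, c j * stoppedCoeff H n ⌊(n : ℝ) * t j⌋₊ i) -
        Real.exp (-((∑ i : Fin n,
          (∑ j, c j * stoppedCoeff H n ⌊(n : ℝ) * t j⌋₊ i) ^ 2) / 2))) atTop (𝓝 0) := by
      set V := ∑ j, ∑ k, c j * c k * fbmCov H (t j) (t k)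
      rw [Metric.tendsto_atTop]
      intro ε hε
      have hV : ∀ᶠ n : ℕ in atTop, ∑ i : Fin n,
          (∑ j, c j * stoppedCoeff H n ⌊(n : ℝ) * t j⌋₊ i) ^ 2 < |V| + 1 :=
        hs.eventually_lt_const (by linarith [le_abs_self V])
      -- The bound `1` is needed for the Taylor estimate of the cosine; the other entry makes `β
      -- (|V| + 1) ≤ ε / 2`.
      set β : ℝ := min 1 (ε / (2 * (|V| + 1))) with hβ
      have hβ0 : 0 < β := lt_min one_pos (by positivity)
      set D : ℝ := ∑ j, c j ^ 2 with hD
      have hD0 : 0 ≤ D := Finset.sum_nonneg fun j _ => sq_nonneg _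
      obtain ⟨N, hN⟩ := exists_forall_stoppedCoeff_sq_le hH hH'
        (ε := β / ((D + 1) * (Fintype.card J + 1))) (by positivity)
      obtain ⟨N', hN'⟩ := eventually_atTop.1 hV
      refine ⟨max N N', fun n hn => ?_⟩
      have hy : ∀ i : Fin n, (∑ j, c j * stoppedCoeff H n ⌊(n : ℝ) * t j⌋₊ i) ^ 2 ≤ β := by
        intro i
        calc (∑ j, c j * stoppedCoeff H n ⌊(n : ℝ) * t j⌋₊ i) ^ 2
            ≤ (∑ j, c j ^ 2) * ∑ j, stoppedCoeff H n ⌊(n : ℝ) * t j⌋₊ i ^ 2 :=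
              Finset.sum_mul_sq_le_sq_mul_sq _ _ _
          _ ≤ (∑ j, c j ^ 2) * ∑ _j : J, β / ((D + 1) * (Fintype.card J + 1)) := by
              gcongr with j _
              exact hN n ((le_max_left _ _).trans hn) _ _
          _ = D * (Fintype.card J) / ((D + 1) * (Fintype.card J + 1)) * β := by
              rw [Finset.sum_const, Finset.card_univ, nsmul_eq_mul]; ring
          _ ≤ 1 * β := by
              gcongr
              rw [div_le_one (by positivity)]
              gcongr <;> linarith
          _ = β := one_mul β
      rw [Real.dist_eq, sub_zero]
      calc _ ≤ β * ∑ i : Fin n, (∑ j, c j * stoppedCoeff H n ⌊(n : ℝ) * t j⌋₊ i) ^ 2 :=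
            abs_prod_cos_sub_exp_le (min_le_left _ _) hy
        _ ≤ ε / (2 * (|V| + 1)) * (|V| + 1) := by
            gcongr
            · exact min_le_right _ _
            · exact (hN' n ((le_max_right _ _).trans hn)).le
        _ = ε / 2 := by field_simp
        _ < ε := by linarith
    simpa using hdiff.add hexp
  exact hE.continuous_comp (g := fun x : EuclideanSpace ℝ J => WithLp.ofLp x)
    (PiLp.continuous_ofLp 2 fun _ : J => ℝ)

end Limit

/-! ### Convergence to zero in probability -/

section InProbability

variable {Ω : Type*} [MeasurableSpace Ω] {P : Measure Ω} [IsProbabilityMeasure P]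
  {f g : ℕ → Ω → ℝ}

theorem tendstoInMeasure_zero_iff :
    TendstoInMeasure P f atTop (fun _ => 0) ↔
      ∀ ε, 0 < ε → Tendsto (fun n => P.real {ω | ε ≤ |f n ω|}) atTop (𝓝 0) := by
  rw [tendstoInMeasure_iff_measureReal_norm]
  simp only [sub_zero, Real.norm_eq_abs]

theorem measureReal_le_abs_le {h : Ω → ℝ} (hi : Integrable (fun ω => h ω ^ 2) P) {ε : ℝ}
    (hε : 0 < ε) : P.real {ω | ε ≤ |h ω|} ≤ (∫ ω, h ω ^ 2 ∂P) / ε ^ 2 := by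
  have h1 := mul_meas_ge_le_integral_of_nonneg (ae_of_all P fun ω => sq_nonneg (h ω)) hi (ε ^ 2)
  have e : {ω | ε ≤ |h ω|} = {ω | ε ^ 2 ≤ h ω ^ 2} := by
    ext ω
    simp only [mem_ofPred_eq]
    rw [← sq_abs (h ω), pow_le_pow_iff_left₀ hε.le (abs_nonneg _) two_ne_zero]
  rw [e, le_div_iff₀ (by positivity), mul_comm]
  exact h1

theorem tendstoInMeasure_zero_add (hf : TendstoInMeasure P f atTop (fun _ => 0))
    (hg : TendstoInMeasure P g atTop (fun _ => 0)) :
    TendstoInMeasure P (fun n ω => f n ω + g n ω) atTop (fun _ => 0) := by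
  rw [tendstoInMeasure_zero_iff] at *
  intro ε hε
  have h := (hf (ε / 2) (half_pos hε)).add (hg (ε / 2) (half_pos hε))
  rw [add_zero] at h
  refine squeeze_zero (fun n => measureReal_nonneg) (fun n => ?_) h
  refine (measureReal_mono ?_).trans (measureReal_union_le _ _)
  intro ω hω
  by_contra hc
  simp only [mem_union, mem_ofPred_eq, not_or, not_le] at hc hω
  have := abs_add_le (f n ω) (g n ω)
  linarith

theorem tendstoInMeasure_zero_sum {ι : Type*} (s : Finset ι) {f : ι → ℕ → Ω → ℝ}
    (hf : ∀ i ∈ s, TendstoInMeasure P (f i) atTop (fun _ => 0)) :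
    TendstoInMeasure P (fun n ω => ∑ i ∈ s, f i n ω) atTop (fun _ => 0) := by
  classical
  induction s using Finset.induction_on with
  | empty =>
    rw [tendstoInMeasure_zero_iff]
    intro ε hε
    simp [not_le.2 hε]
  | insert i s hi ih =>
    simp only [Finset.sum_insert hi]
    exact tendstoInMeasure_zero_add (hf i (Finset.mem_insert_self i s))
      (ih fun j hj => hf j (Finset.mem_insert_of_mem hj))

theorem tendstoInMeasure_zero_of_tendsto_integral_sq
    (hi : ∀ n, Integrable (fun ω => f n ω ^ 2) P)
    (h : Tendsto (fun n => ∫ ω, f n ω ^ 2 ∂P) atTop (𝓝 0)) :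
    TendstoInMeasure P f atTop (fun _ => 0) := by
  rw [tendstoInMeasure_zero_iff]
  intro ε hε
  have h' := h.div_const (ε ^ 2)
  rw [zero_div] at h'
  exact squeeze_zero (fun n => measureReal_nonneg) (fun n => measureReal_le_abs_le (hi n) hε) h'

/-- An `L²`-bounded factor exceeds a large `M` only with probability `K / M²`; otherwise a product
of size `ε` forces `|g| ≥ ε / M`. -/
theorem tendstoInMeasure_zero_mul {K : ℝ} (hi : ∀ n, Integrable (fun ω => f n ω ^ 2) P)
    (hK : ∀ n, ∫ ω, f n ω ^ 2 ∂P ≤ K) (hg : TendstoInMeasure P g atTop (fun _ => 0)) :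
    TendstoInMeasure P (fun n ω => f n ω * g n ω) atTop (fun _ => 0) := by
  rw [tendstoInMeasure_zero_iff] at *
  intro ε hε
  rw [Metric.tendsto_atTop]
  intro δ hδ
  have hK0 : 0 ≤ K := (integral_nonneg fun ω => sq_nonneg _).trans (hK 0)
  obtain ⟨M, hM0, hM⟩ : ∃ M : ℝ, 0 < M ∧ K / M ^ 2 ≤ δ / 2 := by
    refine ⟨√(2 * (K + 1) / δ), Real.sqrt_pos.2 (by positivity), ?_⟩
    rw [Real.sq_sqrt (by positivity), div_le_iff₀ (by positivity)]
    field_simp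
    linarith
  obtain ⟨N, hN⟩ := Metric.tendsto_atTop.1 (hg (ε / M) (by positivity)) (δ / 2) (half_pos hδ)
  refine ⟨N, fun n hn => ?_⟩
  have h1 := hN n hn
  rw [Real.dist_eq, sub_zero, abs_of_nonneg measureReal_nonneg] at h1 ⊢
  calc P.real {ω | ε ≤ |f n ω * g n ω|}
      ≤ P.real ({ω | M ≤ |f n ω|} ∪ {ω | ε / M ≤ |g n ω|}) := by
        refine measureReal_mono ?_
        intro ω hω
        by_contra hc
        simp only [mem_union, mem_ofPred_eq, not_or, not_le] at hc hω
        rw [abs_mul] at hω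
        have h2 : |f n ω| * |g n ω| ≤ M * |g n ω| :=
          mul_le_mul_of_nonneg_right hc.1.le (abs_nonneg _)
        have h3 : M * |g n ω| < M * (ε / M) := mul_lt_mul_of_pos_left hc.2 hM0
        rw [mul_div_cancel₀ _ hM0.ne'] at h3
        linarith
    _ ≤ P.real {ω | M ≤ |f n ω|} + P.real {ω | ε / M ≤ |g n ω|} := measureReal_union_le _ _
    _ < δ / 2 + δ / 2 := by
        refine add_lt_add_of_le_of_lt (((measureReal_le_abs_le (hi n) hM0).trans ?_).trans hM) h1
        gcongr
        exact hK n
    _ = δ := by ring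

theorem tendstoInMeasure_zero_const_mul (c : ℝ) (hg : TendstoInMeasure P g atTop (fun _ => 0)) :
    TendstoInMeasure P (fun n ω => c * g n ω) atTop (fun _ => 0) :=
  tendstoInMeasure_zero_mul (f := fun _ _ => c) (K := c ^ 2) (fun _ => integrable_const _)
    (fun _ => by simp) hg

theorem tendstoInMeasure_zero_of_tendsto {c : ℕ → ℝ} (hc : Tendsto c atTop (𝓝 0)) :
    TendstoInMeasure P (fun n (_ : Ω) => c n) atTop (fun _ => 0) := by
  refine tendstoInMeasure_zero_of_tendsto_integral_sq (fun _ => integrable_const _) ?_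
  simpa using hc.pow 2

end InProbability

/-! ### Discrete Wick powers and Hermite polynomials -/

section Chaos

variable {Ω : Type*} [MeasurableSpace Ω] {n : ℕ}

/-- The `k`-th discrete Wick power of `∑ i, s i * ξ i`. -/
noncomputable def chaosSum (ξ : Fin n → Ω → ℝ) (s : Fin n → ℝ) (k : ℕ) : Ω → ℝ :=
  walshSum ξ fun A => if A.card = k then (k.factorial : ℝ) * ∏ i ∈ A, s i else 0

/-- The error in the recursion for discrete Wick powers. -/
noncomputable def chaosError (ξ : Fin n → Ω → ℝ) (s : Fin n → ℝ) (k : ℕ) : Ω → ℝ :=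
  walshSum ξ fun A =>
    if A.card = k then (k.factorial : ℝ) * ((∑ i ∈ A, s i ^ 2) * ∏ i ∈ A, s i) else 0

theorem walshSum_card_eq (ξ : Fin n → Ω → ℝ) (k : ℕ) (r : ℝ) (h : Finset (Fin n) → ℝ) (ω : Ω) :
    walshSum ξ (fun A => if A.card = k then r * h A else 0) ω =
      r * ∑ A : Finset (Fin n) with A.card = k, h A * ∏ i ∈ A, ξ i ω := by
  simp only [walshSum, walsh, ite_mul, zero_mul]
  rw [← Finset.sum_filter, Finset.mul_sum]
  exact Finset.sum_congr rfl fun A _ => by ring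

theorem chaosSum_zero (ξ : Fin n → Ω → ℝ) (s : Fin n → ℝ) (ω : Ω) : chaosSum ξ s 0 ω = 1 := by
  simp [chaosSum, walshSum, walsh, Finset.card_eq_zero, ite_mul]

theorem chaosSum_one (ξ : Fin n → Ω → ℝ) (s : Fin n → ℝ) (ω : Ω) :
    chaosSum ξ s 1 ω = ∑ i, s i * ξ i ω := by
  rw [sum_mul_eq_walshSum, chaosSum]
  congr 1
  funext A
  split_ifs with h
  · obtain ⟨i, rfl⟩ := Finset.card_eq_one.1 h
    simp [Finset.singleton_inj]
  · symm
    refine Finset.sum_eq_zero fun i _ => if_neg ?_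
    rintro rfl
    simp at h

variable {P : Measure Ω} [IsProbabilityMeasure P]

/-- Because `ξ i ^ 2 = 1`, the second power sum is deterministic, and the identity for elementary
symmetric polynomials becomes the Hermite recursion with variance `∑ s i ^ 2`, up to `chaosError`.
-/
theorem chaosSum_add_two {ξ : Fin n → Ω → ℝ} (hξ : IsSymmetricBernoulli ξ P) (s : Fin n → ℝ)
    (k : ℕ) (ω : Ω) :
    chaosSum ξ s (k + 2) ω = chaosSum ξ s 1 ω * chaosSum ξ s (k + 1) ω -
      ((k : ℝ) + 1) * (∑ i, s i ^ 2) * chaosSum ξ s k ω + ((k : ℝ) + 1) * chaosError ξ s k ω := by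
  have h := sum_mul_sum_card_eq (fun i => s i * ξ i ω) k
  have e : ∀ i, (s i * ξ i ω) ^ 2 = s i ^ 2 := fun i => by
    rw [mul_pow, sq (ξ i ω), hξ.sq_eq_one, mul_one]
  simp only [e, Finset.prod_mul_distrib] at h
  rw [chaosSum_one]
  simp only [chaosSum, chaosError]
  rw [walshSum_card_eq, walshSum_card_eq, walshSum_card_eq, walshSum_card_eq, Nat.factorial_succ,
    Nat.factorial_succ]
  have e2 : ∀ A : Finset (Fin n), (∑ i ∈ A, s i ^ 2) * ((∏ i ∈ A, s i) * ∏ i ∈ A, ξ i ω) =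
      (∑ i ∈ A, s i ^ 2) * (∏ i ∈ A, s i) * ∏ i ∈ A, ξ i ω := fun A => by ring
  simp only [e2] at h
  push_cast
  linear_combination (-((k : ℝ) + 1) * (k.factorial : ℝ)) * h

theorem integral_chaosSum_sq_le {ξ : Fin n → Ω → ℝ} (hξ : IsSymmetricBernoulli ξ P)
    (s : Fin n → ℝ) (k : ℕ) :
    ∫ ω, chaosSum ξ s k ω ^ 2 ∂P ≤ (k.factorial : ℝ) ^ 2 * Real.exp (∑ i, s i ^ 2) := by
  rw [chaosSum, integral_walshSum_sq hξ]
  have h := sum_pow_card_mul_prod_le zero_le_one fun i => sq_nonneg (s i)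
  rw [one_mul] at h
  refine le_trans (Finset.sum_le_sum fun A _ => ?_)
    ((Finset.mul_sum _ _ _).symm.le.trans (mul_le_mul_of_nonneg_left h (sq_nonneg _)))
  split_ifs with hA
  · rw [mul_pow, one_pow, one_mul, Finset.prod_pow]
  · rw [zero_pow two_ne_zero]
    exact mul_nonneg (sq_nonneg _) (mul_nonneg (by simp) (Finset.prod_nonneg fun i _ =>
      sq_nonneg _))

theorem integral_chaosError_sq_le {ξ : Fin n → Ω → ℝ} (hξ : IsSymmetricBernoulli ξ P)
    {s : Fin n → ℝ} {β : ℝ} (hβ : ∀ i, s i ^ 2 ≤ β) (k : ℕ) :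
    ∫ ω, chaosError ξ s k ω ^ 2 ∂P ≤
      (k * β) ^ 2 * ((k.factorial : ℝ) ^ 2 * Real.exp (∑ i, s i ^ 2)) := by
  rw [chaosError, integral_walshSum_sq hξ]
  have h := sum_pow_card_mul_prod_le zero_le_one fun i => sq_nonneg (s i)
  rw [one_mul] at h
  rw [← mul_assoc]
  refine le_trans (Finset.sum_le_sum fun A _ => ?_)
    ((Finset.mul_sum _ _ _).symm.le.trans (mul_le_mul_of_nonneg_left h (by positivity)))
  split_ifs with hA
  · rw [mul_pow, mul_pow, one_pow, one_mul, Finset.prod_pow]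
    have h1 : ∑ i ∈ A, s i ^ 2 ≤ k * β := by
      refine (Finset.sum_le_sum fun i _ => hβ i).trans (le_of_eq ?_)
      rw [Finset.sum_const, hA, nsmul_eq_mul]
    have h2 : (∑ i ∈ A, s i ^ 2) ^ 2 ≤ (k * β) ^ 2 :=
      pow_le_pow_left₀ (Finset.sum_nonneg fun i _ => sq_nonneg _) h1 2
    have h3 : 0 ≤ (k.factorial : ℝ) ^ 2 * (∏ i ∈ A, s i) ^ 2 := by positivity
    calc _ = (∑ i ∈ A, s i ^ 2) ^ 2 * ((k.factorial : ℝ) ^ 2 * (∏ i ∈ A, s i) ^ 2) := by ring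
      _ ≤ (k * β) ^ 2 * ((k.factorial : ℝ) ^ 2 * (∏ i ∈ A, s i) ^ 2) :=
        mul_le_mul_of_nonneg_right h2 h3
      _ = _ := by ring
  · rw [zero_pow two_ne_zero]
    exact mul_nonneg (by positivity) (mul_nonneg (by simp) (Finset.prod_nonneg fun i _ =>
      sq_nonneg _))

/-- Discrete Wick powers are asymptotically Hermite polynomials of the underlying sum. -/
theorem tendstoInMeasure_chaosSum_sub_wickPoly {ξ : (n : ℕ) → Fin n → Ω → ℝ}
    (hξ : ∀ n, IsSymmetricBernoulli (ξ n) P) {s : (n : ℕ) → Fin n → ℝ}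
    (hs1 : ∀ n, ∑ i, s n i ^ 2 ≤ 1)
    (hs0 : ∀ ε > 0, ∃ N, ∀ n ≥ N, ∀ i, s n i ^ 2 ≤ ε) {v : ℝ}
    (hv : Tendsto (fun n => ∑ i, s n i ^ 2) atTop (𝓝 v)) (k : ℕ) :
    TendstoInMeasure P (fun n ω => chaosSum (ξ n) (s n) k ω -
      wickPoly v (chaosSum (ξ n) (s n) 1 ω) k) atTop (fun _ => 0) := by
  have hint : ∀ k n, Integrable (fun ω => chaosSum (ξ n) (s n) k ω ^ 2) P := fun k n =>
    integrable_walshSum_sq (hξ n) _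
  have hbd : ∀ k n, ∫ ω, chaosSum (ξ n) (s n) k ω ^ 2 ∂P ≤
      (k.factorial : ℝ) ^ 2 * Real.exp 1 := fun k n =>
    (integral_chaosSum_sq_le (hξ n) (s n) k).trans (by gcongr; exact hs1 n)
  have herr : ∀ k, TendstoInMeasure P (fun n ω => chaosError (ξ n) (s n) k ω) atTop
      (fun _ => 0) := by
    intro k
    refine tendstoInMeasure_zero_of_tendsto_integral_sq
      (fun n => integrable_walshSum_sq (hξ n) _) ?_
    set Q : ℝ := (k : ℝ) ^ 2 * ((k.factorial : ℝ) ^ 2 * Real.exp 1) with hQ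
    rw [Metric.tendsto_atTop]
    intro ε hε
    set β : ℝ := √(ε / (2 * (Q + 1))) with hβ
    have hQ0 : 0 ≤ Q := by positivity
    have hβ0 : 0 < β := Real.sqrt_pos.2 (by positivity)
    obtain ⟨N, hN⟩ := hs0 β hβ0
    refine ⟨N, fun n hn => ?_⟩
    rw [Real.dist_eq, sub_zero, abs_of_nonneg (integral_nonneg fun ω => sq_nonneg _)]
    calc _ ≤ (k * β) ^ 2 * ((k.factorial : ℝ) ^ 2 * Real.exp (∑ i, s n i ^ 2)) :=
          integral_chaosError_sq_le (hξ n) (hN n hn) k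
      _ ≤ (k * β) ^ 2 * ((k.factorial : ℝ) ^ 2 * Real.exp 1) := by gcongr; exact hs1 n
      _ = Q * (ε / (2 * (Q + 1))) := by rw [mul_pow, hβ, Real.sq_sqrt (by positivity), hQ]; ring
      _ ≤ (Q + 1) * (ε / (2 * (Q + 1))) := by gcongr; linarith
      _ = ε / 2 := by field_simp
      _ < ε := by linarith
  have hzero : TendstoInMeasure P (fun (_ : ℕ) (_ : Ω) => (0 : ℝ)) atTop (fun _ => 0) :=
    tendstoInMeasure_zero_of_tendsto tendsto_const_nhds
  induction k using Nat.strong_induction_on with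
  | _ k ih =>
    match k with
    | 0 => simpa [chaosSum_zero, wickPoly] using hzero
    | 1 => simpa [wickPoly] using hzero
    | k + 2 =>
      -- Four errors: the two inductive ones of degrees `k + 1` and `k`, the replacement of the
      -- variance by its limit `v`, and the recursion error.
      have h1 := tendstoInMeasure_zero_mul (hint 1) (hbd 1) (ih (k + 1) (by omega))
      have h2 := tendstoInMeasure_zero_const_mul (-(((k : ℝ) + 1) * v)) (ih k (by omega))
      have hv' : Tendsto (fun n => -(((k : ℝ) + 1) * (∑ i, s n i ^ 2 - v))) atTop (𝓝 0) := by
        have := ((hv.sub_const v).const_mul ((k : ℝ) + 1)).neg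
        simpa using this
      have h3 := tendstoInMeasure_zero_mul (hint k) (hbd k)
        (tendstoInMeasure_zero_of_tendsto (P := P) hv')
      have h4 := tendstoInMeasure_zero_const_mul ((k : ℝ) + 1) (herr k)
      have h5 := tendstoInMeasure_zero_add (tendstoInMeasure_zero_add h1 h2)
        (tendstoInMeasure_zero_add h3 h4)
      refine h5.congr_left fun n => ae_of_all _ fun ω => ?_
      simp only [chaosSum_add_two (hξ n), wickPoly]
      ring

end Chaos

/-! ### Approximation of the Wick series of the walk by Hermite polynomials -/

section Approximation

variable {Ω : Type*} [MeasurableSpace Ω] {P : Measure Ω} [IsProbabilityMeasure P] {H : ℝ}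
  {ξ : (n : ℕ) → Fin n → Ω → ℝ}

/-- At a fixed time and degree, three replacements are made: `wickCoeff` by the product, `a n k` by
its limit, and the discrete Wick power by the Hermite polynomial. -/
theorem tendstoInMeasure_truncation_sub (hH : 1 / 2 < H) (hH' : H < 1)
    (hξ : ∀ n, IsSymmetricBernoulli (ξ n) P) {a : ℕ → ℕ → ℝ} {a' : ℕ → ℝ}
    (ha : ∀ k, Tendsto (fun n => a n k) atTop (𝓝 (a' k))) (t : I) (m : ℕ) :
    TendstoInMeasure P (fun n ω =>
      walshSum (ξ n) (fun A => if A.card ≤ m then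
        a n A.card * wickCoeff (stoppedCoeff H n) ⌊(n : ℝ) * t⌋₊ A else 0) ω -
      ∑ k ∈ Finset.range (m + 1), a' k / (k.factorial : ℝ) * wickPoly ((t : ℝ) ^ (2 * H))
        (∑ i, stoppedCoeff H n ⌊(n : ℝ) * t⌋₊ i * ξ n i ω) k) atTop (fun _ => 0) := by
  set s : (n : ℕ) → Fin n → ℝ := fun n i => stoppedCoeff H n ⌊(n : ℝ) * t⌋₊ i with hs
  have hs1 : ∀ n, ∑ i, s n i ^ 2 ≤ 1 := fun n => by
    rcases Nat.eq_zero_or_pos n with rfl | hn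
    · simp
    · exact sum_stoppedCoeff_sq_le_one hH hH' hn.ne' _
  have hs0 : ∀ ε > 0, ∃ N, ∀ n ≥ N, ∀ i, s n i ^ 2 ≤ ε := fun ε hε => by
    obtain ⟨N, hN⟩ := exists_forall_stoppedCoeff_sq_le hH hH' hε
    exact ⟨N, fun n hn i => hN n hn _ i⟩
  have hv : Tendsto (fun n => ∑ i, s n i ^ 2) atTop (𝓝 ((t : ℝ) ^ (2 * H))) := by
    have h := tendsto_sum_stoppedCoeff_sq hH hH' (fun _ : Unit => (1 : ℝ)) fun _ => t
    simp only [Finset.univ_unique, Finset.sum_singleton, one_mul, fbmCov, sub_self, abs_zero] at h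
    rw [Real.zero_rpow (by linarith)] at h
    convert! h using 2
    ring
  have hk : ∀ k ∈ Finset.range (m + 1), TendstoInMeasure P (fun n ω =>
      walshSum (ξ n) (fun A => if A.card = k then
        a n k * wickCoeff (stoppedCoeff H n) ⌊(n : ℝ) * t⌋₊ A else 0) ω -
      a' k / (k.factorial : ℝ) * wickPoly ((t : ℝ) ^ (2 * H)) (chaosSum (ξ n) (s n) 1 ω) k) atTop
      (fun _ => 0) := by
    intro k _
    have hfac : (k.factorial : ℝ) ≠ 0 := by exact_mod_cast k.factorial_ne_zero
    have h1 := tendstoInMeasure_zero_const_mul (a' k / (k.factorial : ℝ))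
      (tendstoInMeasure_chaosSum_sub_wickPoly hξ hs1 hs0 hv k)
    have h2 := tendstoInMeasure_zero_mul (P := P)
      (f := fun n ω => chaosSum (ξ n) (s n) k ω) (K := (k.factorial : ℝ) ^ 2 * Real.exp 1)
      (fun n => integrable_walshSum_sq (hξ n) _)
      (fun n => (integral_chaosSum_sq_le (hξ n) (s n) k).trans (by gcongr; exact hs1 n))
      (tendstoInMeasure_zero_of_tendsto (c := fun n => (a n k - a' k) / (k.factorial : ℝ)) (by
        have := ((ha k).sub_const (a' k)).div_const (k.factorial : ℝ)
        simpa using this))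
    have h3 : TendstoInMeasure P (fun n ω => walshSum (ξ n) (fun A => if A.card = k then
        wickCoeff (stoppedCoeff H n) ⌊(n : ℝ) * t⌋₊ A - ∏ i ∈ A, s n i else 0) ω) atTop
        (fun _ => 0) := by
      refine tendstoInMeasure_zero_of_tendsto_integral_sq
        (fun n => integrable_walshSum_sq (hξ n) _) ?_
      rw [Metric.tendsto_atTop]
      intro ε hε
      -- The comparison with `c = 1` and `η = β = δ` yields `2 δ exp 2 = ε / 2`.
      set δ : ℝ := ε / (4 * Real.exp 2) with hδ
      have hδ0 : 0 < δ := by positivity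
      obtain ⟨N, hN⟩ := hs0 δ hδ0
      have hη : Tendsto (fun n : ℕ => √((1 / (n : ℝ)) ^ (2 * H))) atTop (𝓝 0) := by
        have h5 := (Real.continuous_rpow_const (by linarith : 0 ≤ 2 * H)).tendsto 0
        rw [Real.zero_rpow (by linarith)] at h5
        have h6 := (Real.continuous_sqrt.tendsto 0).comp
          (h5.comp tendsto_one_div_atTop_nhds_zero_nat)
        rw [Real.sqrt_zero] at h6
        exact h6
      obtain ⟨N', hN'⟩ := eventually_atTop.1 (hη.eventually_lt_const hδ0)
      refine ⟨max (max N N') 1, fun n hn => ?_⟩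
      have hn0 : n ≠ 0 := by have := (le_max_right _ _).trans hn; omega
      rw [Real.dist_eq, sub_zero, abs_of_nonneg (integral_nonneg fun ω => sq_nonneg _),
        integral_walshSum_sq (hξ n)]
      have h6 := sum_pow_card_mul_prod_sub_wickCoeff_sq_le (b := stoppedCoeff H n)
        (stoppedCoeff_mono hH hH' n) (stoppedCoeff_zero n) zero_le_one ⌊(n : ℝ) * t⌋₊ hδ0.le
        (hN n (((le_max_left _ _).trans (le_max_left _ _)).trans hn))
        (fun j _ => (sum_stoppedCoeff_mul_le hH hH' hn0 ⌊(n : ℝ) * t⌋₊ j).trans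
          (hN' n (((le_max_right _ _).trans (le_max_left _ _)).trans hn)).le)
      calc _ ≤ ∑ A : Finset (Fin n), (1 : ℝ) ^ A.card * (∏ i ∈ A, s n i -
            wickCoeff (stoppedCoeff H n) ⌊(n : ℝ) * t⌋₊ A) ^ 2 := by
            refine Finset.sum_le_sum fun A _ => ?_
            rw [one_pow, one_mul]
            split_ifs with hA
            · exact le_of_eq (by ring)
            · rw [zero_pow two_ne_zero]; exact sq_nonneg _
        _ ≤ _ := h6
        _ ≤ 1 ^ 2 * (δ + δ) * 1 * Real.exp (2 * 1 * 1) := by gcongr <;> exact hs1 n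
        _ = ε / 2 := by rw [hδ]; norm_num; field_simp; norm_num
        _ < ε := by linarith
    obtain ⟨M, hM⟩ := Metric.isBounded_range_iff.1 (Metric.isBounded_range_of_tendsto _ (ha k))
    have h4 := tendstoInMeasure_zero_mul (P := P) (f := fun n _ => a n k - a' k)
      (K := (M + |a 0 k - a' k|) ^ 2) (fun _ => integrable_const _) (fun n => by
        simp only [integral_const, probReal_univ, one_smul]
        rw [← sq_abs (a n k - a' k)]
        refine pow_le_pow_left₀ (abs_nonneg _) ?_ 2
        have h5 := hM n 0
        rw [Real.dist_eq] at h5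
        have h6 := abs_add_le (a n k - a 0 k) (a 0 k - a' k)
        rw [sub_add_sub_cancel] at h6
        linarith) h3
    refine (tendstoInMeasure_zero_add (tendstoInMeasure_zero_add h1 h2)
      (tendstoInMeasure_zero_add h4 (tendstoInMeasure_zero_const_mul (a' k) h3))).congr_left
      fun n => ae_of_all _ fun ω => ?_
    simp only [chaosSum]
    have e1 := walshSum_card_eq (ξ n) k (k.factorial : ℝ) (fun A => ∏ i ∈ A, s n i) ω
    have e2 := walshSum_card_eq (ξ n) k (a n k)
      (fun A => wickCoeff (stoppedCoeff H n) ⌊(n : ℝ) * t⌋₊ A) ω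
    have e3 := walshSum_card_eq (ξ n) k 1
      (fun A => wickCoeff (stoppedCoeff H n) ⌊(n : ℝ) * t⌋₊ A - ∏ i ∈ A, s n i) ω
    simp only [one_mul, sub_mul, Finset.sum_sub_distrib] at e3
    rw [e1, e2, e3]
    field_simp
    ring
  have hsum := tendstoInMeasure_zero_sum _ hk
  refine hsum.congr_left fun n => ae_of_all _ fun ω => ?_
  simp only [Finset.sum_sub_distrib, chaosSum_one]
  congr 1
  simp only [walshSum]
  rw [Finset.sum_comm]
  refine Finset.sum_congr rfl fun A _ => ?_
  rw [← Finset.sum_mul]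
  congr 1
  rw [Finset.sum_ite_eq]
  simp

/-- The tail of the Wick series of the walk is small in `L²`. -/
theorem integral_tail_sq_le (hH : 1 / 2 < H) (hH' : H < 1) {n : ℕ} (hn : n ≠ 0)
    {ξ : Fin n → Ω → ℝ} (hξ : IsSymmetricBernoulli ξ P) {a : ℕ → ℝ} {C : ℝ}
    (ha : ∀ k, 1 ≤ k → |a k| ≤ C ^ k) (l m : ℕ) :
    ∫ ω, walshSum ξ (fun A => if A.card ≤ m then 0 else
      a A.card * wickCoeff (stoppedCoeff H n) l A) ω ^ 2 ∂P ≤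
      (1 / 2) ^ m * Real.exp (2 * C ^ 2) := by
  rw [integral_walshSum_sq hξ]
  -- The weight `2 C²` instead of `C²` leaves a spare factor `2 ^ |A| ≥ 2 ^ m` on the tail, whence
  -- the gain `(1 / 2) ^ m`.
  have h := sum_pow_card_mul_wickCoeff_sq_le (stoppedCoeff_mono hH hH' n) (stoppedCoeff_zero n)
    (by positivity : 0 ≤ 2 * C ^ 2) l
  have h1 : Real.exp (2 * C ^ 2 * ∑ i, stoppedCoeff H n l i ^ 2) ≤ Real.exp (2 * C ^ 2) := by
    exact Real.exp_le_exp.2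
      (mul_le_of_le_one_right (by positivity) (sum_stoppedCoeff_sq_le_one hH hH' hn l))
  refine le_trans (Finset.sum_le_sum fun A _ => ?_)
    ((Finset.mul_sum _ _ _).symm.le.trans
      (mul_le_mul_of_nonneg_left (h.trans h1) (by positivity)))
  split_ifs with hA
  · rw [zero_pow two_ne_zero]; positivity
  · rw [mul_pow, ← mul_assoc]
    refine mul_le_mul_of_nonneg_right ?_ (sq_nonneg _)
    have h2 : a A.card ^ 2 ≤ (C ^ A.card) ^ 2 := by
      rw [← sq_abs (a _)]
      exact pow_le_pow_left₀ (abs_nonneg _) (ha _ (by omega)) 2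
    refine h2.trans ?_
    rw [mul_pow, ← mul_assoc, ← pow_mul, mul_comm A.card 2, pow_mul]
    refine le_mul_of_one_le_left (by positivity) ?_
    have h3 : ((1 / 2 : ℝ)) ^ m * 2 ^ A.card = 2 ^ (A.card - m) := by
      rw [one_div, inv_pow, mul_comm, ← pow_sub₀ _ (by norm_num) (by omega)]
    rw [h3]
    exact one_le_pow₀ (by norm_num)

end Approximation

/-! ### A maximal inequality by dyadic chaining -/

section Maximal

theorem add_sq_le_of_pos {ε : ℝ} (hε : 0 < ε) (x y : ℝ) :
    (x + y) ^ 2 ≤ (1 + ε) * x ^ 2 + (1 + 1 / ε) * y ^ 2 := by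
  have h : (1 + ε) * x ^ 2 + (1 + 1 / ε) * y ^ 2 - (x + y) ^ 2 = (ε * x - y) ^ 2 / ε := by
    field_simp
    ring
  have : 0 ≤ (ε * x - y) ^ 2 / ε := by positivity
  linarith

variable {Ω : Type*} [MeasurableSpace Ω] {P : Measure Ω}

/-- Induction on dyadic length. An index in the second half is reached through the midpoint, so `G +
(1 + ε) G' + (1 + 1/ε) (midpoint increment)²` dominates both halves. As `γ > 1`, `q = 2 ^ γ > 2`;
with `ε = (q - 2) / 2` the two halves cost `2 + ε`, the midpoint term at most `ε`, and the total `2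
+ 2 ε = q` is the growth allowed per doubling. -/
theorem exists_maximal_bound {γ : ℝ} (hγ : 1 < γ) :
    ∃ Q : ℝ, 0 ≤ Q ∧ ∀ (S : ℕ → Ω → ℝ) (K : ℝ), 0 ≤ K →
      (∀ m l, Integrable (fun ω => (S l ω - S m ω) ^ 2) P) →
      (∀ m l, m ≤ l → ∫ ω, (S l ω - S m ω) ^ 2 ∂P ≤ K * ((l : ℝ) - m) ^ γ) →
      ∀ J m : ℕ, ∃ G : Ω → ℝ, (∀ ω, 0 ≤ G ω) ∧ Integrable G P ∧
        (∀ i ≤ 2 ^ J, ∀ ω, (S (m + i) ω - S m ω) ^ 2 ≤ G ω) ∧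
        ∫ ω, G ω ∂P ≤ Q * K * ((2 : ℝ) ^ J) ^ γ := by
  set q : ℝ := (2 : ℝ) ^ γ with hq
  have hq2 : 2 < q := by
    have := Real.rpow_lt_rpow_of_exponent_lt (by norm_num : (1 : ℝ) < 2) hγ
    rwa [Real.rpow_one] at this
  set ε : ℝ := (q - 2) / 2 with hε
  have hε0 : 0 < ε := by rw [hε]; linarith
  set Q : ℝ := 1 + (1 + 1 / ε) / ε with hQ
  have hQ0 : 0 ≤ Q := by positivity
  refine ⟨Q, hQ0, fun S K hK hint hincr J => ?_⟩
  have hpow : ∀ J : ℕ, ((2 : ℝ) ^ J) ^ γ = q ^ J := fun J => by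
    rw [hq, ← Real.rpow_natCast, ← Real.rpow_mul (by norm_num), mul_comm, Real.rpow_mul (by norm_num),
      Real.rpow_natCast]
  simp only [hpow]
  induction J with
  | zero =>
    intro m
    refine ⟨fun ω => (S (m + 1) ω - S m ω) ^ 2, fun ω => sq_nonneg _, hint _ _, ?_, ?_⟩
    · intro i hi ω
      have : i = 0 ∨ i = 1 := by simp at hi; omega
      rcases this with rfl | rfl
      · simp only [add_zero, sub_self]
        rw [zero_pow two_ne_zero]
        exact sq_nonneg _
      · exact le_rfl
    · have h := hincr m (m + 1) (by omega)
      push_cast at h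
      rw [add_sub_cancel_left, Real.one_rpow, mul_one] at h
      rw [pow_zero, mul_one]
      refine h.trans (le_mul_of_one_le_left hK ?_)
      have : 0 ≤ (1 + 1 / ε) / ε := by positivity
      rw [hQ]; linarith
  | succ J ih =>
    intro m
    obtain ⟨G, hG0, hGi, hG, hGb⟩ := ih m
    obtain ⟨G', hG0', hGi', hG', hGb'⟩ := ih (m + 2 ^ J)
    have hi1 : Integrable (fun ω => (1 + ε) * G' ω) P := hGi'.const_mul _
    have hi2 : Integrable (fun ω => (1 + 1 / ε) * (S (m + 2 ^ J) ω - S m ω) ^ 2) P :=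
      (hint m (m + 2 ^ J)).const_mul _
    have hi3 : Integrable (fun ω => G ω + (1 + ε) * G' ω) P := hGi.add hi1
    have hpos1 : ∀ ω, 0 ≤ (1 + ε) * G' ω := fun ω => mul_nonneg (by positivity) (hG0' ω)
    have hpos2 : ∀ ω, 0 ≤ (1 + 1 / ε) * (S (m + 2 ^ J) ω - S m ω) ^ 2 := fun ω => by positivity
    refine ⟨fun ω => G ω + (1 + ε) * G' ω + (1 + 1 / ε) * (S (m + 2 ^ J) ω - S m ω) ^ 2,
      fun ω => add_nonneg (add_nonneg (hG0 ω) (hpos1 ω)) (hpos2 ω), hi3.add hi2, ?_, ?_⟩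
    · intro i hi ω
      rcases le_total i (2 ^ J) with h | h
      · have := hG i h ω
        linarith [hpos1 ω, hpos2 ω]
      · obtain ⟨i', rfl⟩ := Nat.exists_eq_add_of_le h
        have h1 := hG' i' (by rw [pow_succ] at hi; omega) ω
        have h2 := add_sq_le_of_pos hε0 (S (m + 2 ^ J + i') ω - S (m + 2 ^ J) ω)
          (S (m + 2 ^ J) ω - S m ω)
        rw [sub_add_sub_cancel] at h2
        have h3 := mul_le_mul_of_nonneg_left h1 (by positivity : 0 ≤ 1 + ε)
        rw [← add_assoc]
        linarith [hG0 ω]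
    · rw [integral_add hi3 hi2, integral_add hGi hi1, integral_const_mul, integral_const_mul]
      have h := hincr m (m + 2 ^ J) (Nat.le_add_right _ _)
      push_cast at h
      rw [add_sub_cancel_left, hpow] at h
      have h3 := mul_le_mul_of_nonneg_left hGb' (by positivity : 0 ≤ 1 + ε)
      have h4 := mul_le_mul_of_nonneg_left h (by positivity : 0 ≤ 1 + 1 / ε)
      have h5 : 1 + 1 / ε ≤ ε * Q := by
        have : ε * Q = ε + (1 + 1 / ε) := by rw [hQ]; field_simp
        linarith
      have h6 : q = 2 + 2 * ε := by rw [hε]; ring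
      have h7 : 0 ≤ K * q ^ J := by positivity
      have h8 := mul_le_mul_of_nonneg_right h5 h7
      calc _ ≤ Q * K * q ^ J + (1 + ε) * (Q * K * q ^ J) + ε * Q * (K * q ^ J) := by linarith
        _ = Q * K * (q ^ J * (2 + 2 * ε)) := by ring
        _ = Q * K * q ^ (J + 1) := by rw [← h6, pow_succ]

end Maximal

/-! ### Oscillation of the Wick series of the walk -/

section Oscillation

variable {Ω : Type*} [MeasurableSpace Ω] {P : Measure Ω} [IsProbabilityMeasure P] {H : ℝ}

/-- The Wick series of the disturbed random walk. -/
noncomputable def walkSeries (H : ℝ) {n : ℕ} (ξ : Fin n → Ω → ℝ) (a : ℕ → ℝ) (l : ℕ) : Ω → ℝ :=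
  walshSum ξ fun A => a A.card * wickCoeff (stoppedCoeff H n) l A

/-- The coefficient at `∅` does not depend on `l`, so the increment does not see `a 0` and only the
growth bound for `k ≥ 1` is needed. -/
theorem integral_walkSeries_sub_sq_le (hH : 1 / 2 < H) (hH' : H < 1) {n : ℕ} (hn : n ≠ 0)
    {ξ : Fin n → Ω → ℝ} (hξ : IsSymmetricBernoulli ξ P) {a : ℕ → ℝ} {C : ℝ}
    (ha : ∀ k, 1 ≤ k → |a k| ≤ C ^ k) {m l : ℕ} (hml : m ≤ l) :
    ∫ ω, (walkSeries H ξ a l ω - walkSeries H ξ a m ω) ^ 2 ∂P ≤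
      2 * C ^ 2 * Real.exp (2 * C ^ 2) * (((l : ℝ) - m) / n) ^ (2 * H) := by
  have hlm : (0 : ℝ) ≤ (l : ℝ) - m := sub_nonneg.2 (by exact_mod_cast hml)
  simp only [walkSeries, walshSum_sub]
  rw [integral_walshSum_sq hξ]
  have h := sum_pow_card_mul_wickCoeff_sub_sq_le (stoppedCoeff_mono hH hH' n) (stoppedCoeff_zero n)
    (sq_nonneg C) hml
  calc _ ≤ ∑ A : Finset (Fin n), (C ^ 2) ^ A.card *
        (wickCoeff (stoppedCoeff H n) l A - wickCoeff (stoppedCoeff H n) m A) ^ 2 := by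
        refine Finset.sum_le_sum fun A _ => ?_
        rw [← mul_sub, mul_pow]
        rcases Nat.eq_zero_or_pos A.card with h0 | h0
        · rw [Finset.card_eq_zero] at h0
          subst h0
          simp [wickCoeff_empty]
        · refine mul_le_mul_of_nonneg_right ?_ (sq_nonneg _)
          rw [← sq_abs, ← pow_mul, mul_comm 2, pow_mul]
          exact pow_le_pow_left₀ (abs_nonneg _) (ha _ h0) 2
    _ ≤ _ := h
    _ ≤ 2 * C ^ 2 * Real.exp (2 * C ^ 2) *
        ∑ i, (stoppedCoeff H n l i - stoppedCoeff H n m i) ^ 2 := by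
        refine mul_le_mul_of_nonneg_right ?_ (Finset.sum_nonneg fun i _ => sq_nonneg _)
        refine mul_le_mul_of_nonneg_left (Real.exp_le_exp.2 ?_) (by positivity)
        exact mul_le_of_le_one_right (by positivity) (sum_stoppedCoeff_sq_le_one hH hH' hn l)
    _ ≤ _ := mul_le_mul_of_nonneg_left (sum_stoppedCoeff_sub_sq_le hH hH' hn hml) (by positivity)

theorem integrable_walkSeries_sub_sq {n : ℕ} {ξ : Fin n → Ω → ℝ} (hξ : IsSymmetricBernoulli ξ P)
    (a : ℕ → ℝ) (m l : ℕ) :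
    Integrable (fun ω => (walkSeries H ξ a l ω - walkSeries H ξ a m ω) ^ 2) P := by
  simp only [walkSeries, walshSum_sub]
  exact integrable_walshSum_sq hξ _

/-- The oscillation of the Wick series of the walk over a block of length at most `n / m`. -/
theorem exists_measureReal_block_le (hH : 1 / 2 < H) (hH' : H < 1) (C : ℝ) :
    ∃ Q : ℝ, 0 ≤ Q ∧ ∀ (m n : ℕ), 1 ≤ m → m ≤ n → ∀ (ξ : Fin n → Ω → ℝ),
      IsSymmetricBernoulli ξ P → ∀ a : ℕ → ℝ, (∀ k, 1 ≤ k → |a k| ≤ C ^ k) →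
      ∀ (l : ℕ) (ε : ℝ), 0 < ε →
        P.real {ω | ∃ i : ℕ, (i : ℝ) ≤ (n : ℝ) / m + 1 ∧
          ε ≤ |walkSeries H ξ a (l + i) ω - walkSeries H ξ a l ω|} ≤
        Q * (1 / (m : ℝ)) ^ (2 * H) / ε ^ 2 := by
  obtain ⟨Q, hQ0, hQ⟩ := exists_maximal_bound (P := P) (γ := 2 * H) (by linarith)
  set K : ℝ := 2 * C ^ 2 * Real.exp (2 * C ^ 2) with hK
  refine ⟨Q * K * 4 ^ (2 * H), by positivity, fun m n hm hmn ξ hξ a ha l ε hε => ?_⟩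
  have hn : n ≠ 0 := by omega
  have hn' : (0 : ℝ) < n := by exact_mod_cast Nat.pos_of_ne_zero hn
  have hm' : (0 : ℝ) < m := by exact_mod_cast hm
  have hmn' : (m : ℝ) ≤ n := by exact_mod_cast hmn
  -- A block of length `2 ^ (J + 1)` covers all admissible `i`, and since `m ≤ n` it is no longer
  -- than `4 n / m`.
  obtain ⟨J, hJ1, hJ2⟩ := exists_nat_pow_near (x := (n : ℝ) / m + 1) (y := 2)
    (by have : 0 ≤ (n : ℝ) / m := by positivity
        linarith) (by norm_num)
  obtain ⟨G, hG0, hGi, hG, hGb⟩ := hQ (walkSeries H ξ a) (K / (n : ℝ) ^ (2 * H)) (by positivity)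
    (integrable_walkSeries_sub_sq hξ a) (fun m' l' hml => by
      refine (integral_walkSeries_sub_sq_le hH hH' hn hξ ha hml).trans (le_of_eq ?_)
      rw [Real.div_rpow (sub_nonneg.2 (by exact_mod_cast hml)) hn'.le]
      ring) (J + 1) l
  have hsub : {ω | ∃ i : ℕ, (i : ℝ) ≤ (n : ℝ) / m + 1 ∧
      ε ≤ |walkSeries H ξ a (l + i) ω - walkSeries H ξ a l ω|} ⊆ {ω | ε ^ 2 ≤ G ω} := by
    rintro ω ⟨i, hi, hω⟩
    have hi' : i ≤ 2 ^ (J + 1) := by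
      have : (i : ℝ) < 2 ^ (J + 1) := hi.trans_lt hJ2
      exact_mod_cast this.le
    refine le_trans ?_ (hG i hi' ω)
    rw [← sq_abs (walkSeries H ξ a (l + i) ω - _)]
    exact pow_le_pow_left₀ hε.le hω 2
  refine (measureReal_mono hsub).trans ?_
  have h1 := mul_meas_ge_le_integral_of_nonneg (ae_of_all P hG0) hGi (ε ^ 2)
  rw [le_div_iff₀ (by positivity), mul_comm]
  refine h1.trans (hGb.trans ?_)
  have h2 : (2 : ℝ) ^ (J + 1) ≤ 4 * (n * (1 / m)) := by
    have h3 : (1 : ℝ) ≤ n / m := by rwa [one_le_div hm']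
    have h4 : (n : ℝ) * (1 / m) = n / m := by ring
    rw [h4, pow_succ]
    linarith
  calc Q * (K / (n : ℝ) ^ (2 * H)) * ((2 : ℝ) ^ (J + 1)) ^ (2 * H)
      ≤ Q * (K / (n : ℝ) ^ (2 * H)) * (4 * (n * (1 / m))) ^ (2 * H) := by
        gcongr
    _ = Q * K * 4 ^ (2 * H) * (1 / (m : ℝ)) ^ (2 * H) := by
        rw [Real.mul_rpow (by norm_num) (by positivity), Real.mul_rpow hn'.le (by positivity)]
        have : (n : ℝ) ^ (2 * H) ≠ 0 := by positivity
        field_simp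

end Oscillation

/-! ### Convergence in distribution by approximation -/

section Approximation

variable {E Ω Ω' : Type*} [PseudoEMetricSpace E] [MeasurableSpace E] [BorelSpace E]
  [MeasurableSpace Ω] [MeasurableSpace Ω'] {P : Measure Ω} [IsProbabilityMeasure P]
  {P' : Measure Ω'} [IsProbabilityMeasure P']

/-- Portmanteau with closed sets: if `X n` lies in `F`, either `X' m n` lies in the closed
`ε`-thickening of `F` or the two are more than `ε` apart. The thickening is chosen first, using the
law of `Z`, then `m`, then `n`. -/
theorem tendstoInDistribution_of_approximation {X : ℕ → Ω → E} {Z : Ω' → E}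
    {X' : ℕ → ℕ → Ω → E} {Z' : ℕ → Ω' → E} (hX : ∀ n, AEMeasurable (X n) P)
    (hX' : ∀ m, TendstoInDistribution (X' m) atTop (Z' m) (fun _ => P) P')
    (hZ : TendstoInDistribution Z' atTop Z (fun _ => P') P')
    (happrox : ∀ ε > 0, ∀ δ > 0, ∀ᶠ m in atTop, ∀ᶠ n in atTop,
      P {ω | ENNReal.ofReal ε < edist (X n ω) (X' m n ω)} ≤ ENNReal.ofReal δ) :
    TendstoInDistribution X atTop Z (fun _ => P) P' := by
  refine ⟨hX, hZ.aemeasurable_limit, tendsto_of_forall_isClosed_limsup_le' fun F hF => ?_⟩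
  simp only [ProbabilityMeasure.coe_mk]
  refine le_of_forall_gt fun r hr => ?_
  obtain ⟨r', hr1, hr2⟩ := exists_between hr
  have hcth := tendsto_measure_cthickening_of_isClosed (μ := P'.map Z)
    ⟨1, one_pos, by
      have := Measure.isProbabilityMeasure_map (μ := P') hZ.aemeasurable_limit
      exact measure_ne_top _ _⟩ hF
  obtain ⟨ε, hε, hε'⟩ : ∃ ε > 0, P'.map Z (Metric.cthickening ε F) < r' := by
    have h1 : ∀ᶠ ε in 𝓝[>] (0 : ℝ), P'.map Z (Metric.cthickening ε F) < r' :=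
      nhdsWithin_le_nhds (hcth.eventually_lt_const hr1)
    obtain ⟨ε, h2, h3⟩ := (h1.and self_mem_nhdsWithin).exists
    exact ⟨ε, h3, h2⟩
  have hFε : IsClosed (Metric.cthickening ε F) := Metric.isClosed_cthickening
  have hZlim := ProbabilityMeasure.limsup_measure_closed_le_of_tendsto hZ.tendsto hFε
  simp only [ProbabilityMeasure.coe_mk] at hZlim
  have hev := eventually_lt_of_limsup_lt (hZlim.trans_lt hε')
  obtain ⟨δ, hδ, hδ'⟩ : ∃ δ : ℝ, 0 < δ ∧ r' + ENNReal.ofReal δ < r := by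
    obtain ⟨δ, hδ, h⟩ := ENNReal.lt_iff_exists_add_pos_lt.1 hr2
    exact ⟨δ, by exact_mod_cast hδ, by rwa [ENNReal.ofReal_coe_nnreal]⟩
  obtain ⟨m, hm1, hm2⟩ := (hev.and (happrox ε hε δ hδ)).exists
  have hXlim := ProbabilityMeasure.limsup_measure_closed_le_of_tendsto (hX' m).tendsto hFε
  simp only [ProbabilityMeasure.coe_mk] at hXlim
  have hev' := eventually_lt_of_limsup_lt (hXlim.trans_lt hm1)
  refine lt_of_le_of_lt (limsup_le_of_le (by isBoundedDefault) ?_) hδ'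
  filter_upwards [hev', hm2] with n hn1 hn2
  rw [Measure.map_apply_of_aemeasurable ((hX' m).forall_aemeasurable n) hFε.measurableSet] at hn1
  rw [Measure.map_apply_of_aemeasurable (hX n) hF.measurableSet]
  refine (measure_mono ?_).trans ((measure_union_le _ _).trans (add_le_add hn1.le hn2))
  intro ω hω
  by_contra hc
  simp only [mem_union, mem_preimage, mem_ofPred_eq, not_or, not_lt] at hc
  refine hc.1 ?_
  rw [Metric.mem_cthickening_iff]
  refine (Metric.infEDist_le_edist_of_mem (mem_preimage.1 hω)).trans ?_
  rw [edist_comm]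
  exact hc.2

end Approximation

/-! ### Step functions in the Skorokhod space -/

namespace SkorokhodSpace

theorem edist_le_iSup (f g : SkorokhodSpace) : edist f g ≤ ⨆ t : I, edist (f t) (g t) := by
  refine (iInf_le _ (OrderIso.refl I)).trans (max_le ?_ le_rfl)
  simp

theorem edist_le_ofReal {f g : SkorokhodSpace} {r : ℝ} (h : ∀ t, |f t - g t| ≤ r) :
    edist f g ≤ ENNReal.ofReal r := by
  refine (edist_le_iSup f g).trans (iSup_le fun t => ?_)
  rw [edist_dist, Real.dist_eq]
  exact ENNReal.ofReal_le_ofReal (h t)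

/-- A continuous function as an element of the Skorokhod space. -/
def ofContinuous (f : I → ℝ) (hf : Continuous f) : SkorokhodSpace where
  toFun := f
  right_continuous _ := hf.continuousWithinAt
  left_limit t := ⟨f t, (hf.tendsto t).mono_left nhdsWithin_le_nhds⟩

end SkorokhodSpace

/-- The points `j / m`. -/
noncomputable def gridPoint (m : ℕ) (j : Fin (m + 1)) : I :=
  ⟨(j.val : ℝ) / m, by positivity, div_le_one_of_le₀
    (by exact_mod_cast Nat.lt_succ_iff.1 j.isLt) (by positivity)⟩

/-- The index of the grid point to the left of `t`. -/
noncomputable def gridIndex (m : ℕ) (t : I) : Fin (m + 1) :=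
  ⟨⌊(m : ℝ) * t⌋₊, Nat.lt_succ_iff.2 (floor_mul_le m t)⟩

theorem gridPoint_gridIndex_le {m : ℕ} (hm : 1 ≤ m) (t : I) :
    (gridPoint m (gridIndex m t) : ℝ) ≤ t := by
  have hm' : (0 : ℝ) < m := by exact_mod_cast hm
  change ((⌊(m : ℝ) * t⌋₊ : ℕ) : ℝ) / m ≤ t
  rw [div_le_iff₀ hm', mul_comm (t : ℝ)]
  exact Nat.floor_le (mul_nonneg hm'.le t.2.1)

theorem le_gridPoint_gridIndex_add {m : ℕ} (hm : 1 ≤ m) (t : I) :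
    (t : ℝ) ≤ gridPoint m (gridIndex m t) + 1 / m := by
  have hm' : (0 : ℝ) < m := by exact_mod_cast hm
  change (t : ℝ) ≤ ((⌊(m : ℝ) * t⌋₊ : ℕ) : ℝ) / m + 1 / m
  rw [← add_div, le_div_iff₀ hm', mul_comm (t : ℝ)]
  exact (Nat.lt_floor_add_one _).le

/-- The step function with given values at the points `j / m`. -/
noncomputable def stepMap (m : ℕ) (y : Fin (m + 1) → ℝ) : SkorokhodSpace :=
  stepPath m fun l => y (Fin.ofNat (m + 1) l)

theorem stepMap_apply (m : ℕ) (y : Fin (m + 1) → ℝ) (t : I) :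
    stepMap m y t = y (gridIndex m t) := by
  change y (Fin.ofNat (m + 1) ⌊(m : ℝ) * t⌋₊) = _
  congr 1
  exact Fin.ext (Nat.mod_eq_of_lt (Nat.lt_succ_iff.2 (floor_mul_le m t)))

/-- The Skorokhod distance is at most the uniform one, by the identity time change. Continuity also
yields Borel measurability of the random step paths. -/
theorem continuous_stepMap (m : ℕ) : Continuous (stepMap m) := by
  refine LipschitzWith.continuous (K := 1) fun y z => ?_
  rw [ENNReal.coe_one, one_mul]
  refine (SkorokhodSpace.edist_le_iSup _ _).trans (iSup_le fun t => ?_)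
  rw [stepMap_apply, stepMap_apply]
  exact edist_le_pi_edist y z _

theorem stepPath_eq_stepMap (n : ℕ) (u : ℕ → ℝ) : stepPath n u = stepMap n fun j => u j := by
  refine SkorokhodSpace.ext (funext fun t => ?_)
  rw [stepMap_apply]
  rfl

/-! ### Weak convergence of the Wick series -/

/-- The partial sums of a Wick power series. -/
noncomputable def wickPartialSum (a : ℕ → ℝ) (m : ℕ) (v x : ℝ) : ℝ :=
  ∑ k ∈ Finset.range (m + 1), a k / (k.factorial : ℝ) * wickPoly v x k

theorem continuous_wickPartialSum (a : ℕ → ℝ) (m : ℕ) (v : ℝ) :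
    Continuous (wickPartialSum a m v) :=
  continuous_finsetSum _ fun k _ => (continuous_wickPoly v k).const_mul _

section Convergence

variable {Ω : Type*} [MeasurableSpace Ω] {P : Measure Ω} [IsProbabilityMeasure P] {H : ℝ}
  {ξ : (n : ℕ) → Fin n → Ω → ℝ}

/-- The union bound over `m + 1` grid points is affordable because `2H > 1`. -/
theorem tendsto_block_error (hH : 1 / 2 < H) (Q R : ℝ) :
    Tendsto (fun m : ℕ => ((m : ℝ) + 1) * (Q * (1 / (m : ℝ)) ^ (2 * H) + R * (1 / 2) ^ m)) atTop
      (𝓝 0) := by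
  have h1 : Tendsto (fun m : ℕ => (m : ℝ) ^ (-(2 * H - 1))) atTop (𝓝 0) :=
    (tendsto_rpow_neg_atTop (by linarith)).comp tendsto_natCast_atTop_atTop
  have h2 : Tendsto (fun m : ℕ => (m : ℝ) ^ (-(2 * H))) atTop (𝓝 0) :=
    (tendsto_rpow_neg_atTop (by linarith)).comp tendsto_natCast_atTop_atTop
  have h3 : Tendsto (fun m : ℕ => (m : ℝ) * (1 / 2) ^ m) atTop (𝓝 0) :=
    tendsto_self_mul_const_pow_of_lt_one (by norm_num) (by norm_num)
  have h4 : Tendsto (fun m : ℕ => (1 / 2 : ℝ) ^ m) atTop (𝓝 0) :=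
    tendsto_pow_atTop_nhds_zero_of_lt_one (by norm_num) (by norm_num)
  have h5 := ((h1.add h2).const_mul Q).add ((h3.add h4).const_mul R)
  simp only [add_zero, mul_zero] at h5
  refine h5.congr' ?_
  filter_upwards [eventually_ge_atTop 1] with m hm
  have hm' : (0 : ℝ) < m := by exact_mod_cast hm
  have e1 : (1 / (m : ℝ)) ^ (2 * H) = (m : ℝ) ^ (-(2 * H)) := by
    rw [one_div, Real.inv_rpow hm'.le, Real.rpow_neg hm'.le]
  have e2 : (m : ℝ) ^ (-(2 * H - 1)) = m * (m : ℝ) ^ (-(2 * H)) := by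
    rw [neg_sub, sub_eq_add_neg, Real.rpow_add hm', Real.rpow_one]
  rw [e1, e2]
  ring

/-- Approximation of the Wick series of the walk by step functions of its values on a coarse
grid. -/
theorem eventually_measure_approximation_le (hH : 1 / 2 < H) (hH' : H < 1)
    (hξ : ∀ n, IsSymmetricBernoulli (ξ n) P) {a : ℕ → ℕ → ℝ} {a' : ℕ → ℝ} {C : ℝ}
    (ha : ∀ k, Tendsto (fun n => a n k) atTop (𝓝 (a' k)))
    (hC : ∀ n k, 1 ≤ n → 1 ≤ k → |a n k| ≤ C ^ k) {ε δ : ℝ} (hε : 0 < ε) (hδ : 0 < δ) :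
    ∀ᶠ m : ℕ in atTop, ∀ᶠ n : ℕ in atTop,
      P {ω | ENNReal.ofReal ε < edist (stepPath n fun l => walkSeries H (ξ n) (a n) l ω)
        (stepMap m fun j => wickPartialSum a' m ((gridPoint m j : ℝ) ^ (2 * H))
          (∑ i, stoppedCoeff H n ⌊(n : ℝ) * gridPoint m j⌋₊ i * ξ n i ω))} ≤
      ENNReal.ofReal δ := by
  obtain ⟨Q, hQ0, hQ⟩ := exists_measureReal_block_le (P := P) hH hH' C
  have hε3 : 0 < ε / 3 := by positivity
  have hblock := ((tendsto_block_error hH Q (Real.exp (2 * C ^ 2))).div_const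
    ((ε / 3) ^ 2)).eventually_lt_const (u := δ / 2) (by rw [zero_div]; exact half_pos hδ)
  filter_upwards [hblock, eventually_ge_atTop 1] with m hm hm1
  set L : ℕ → Fin (m + 1) → ℕ := fun n j => ⌊(n : ℝ) * gridPoint m j⌋₊ with hL
  set D : ℕ → Fin (m + 1) → Ω → ℝ := fun n j ω =>
    walshSum (ξ n) (fun A => if A.card ≤ m then
      a n A.card * wickCoeff (stoppedCoeff H n) (L n j) A else 0) ω -
    wickPartialSum a' m ((gridPoint m j : ℝ) ^ (2 * H))
      (∑ i, stoppedCoeff H n (L n j) i * ξ n i ω) with hD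
  set T : ℕ → Fin (m + 1) → Ω → ℝ := fun n j =>
    walshSum (ξ n) (fun A => if A.card ≤ m then 0 else
      a n A.card * wickCoeff (stoppedCoeff H n) (L n j) A) with hT
  have hDlim : Tendsto (fun n => ∑ j, P.real {ω | ε / 3 ≤ |D n j ω|}) atTop (𝓝 0) := by
    have h := tendsto_finsetSum (Finset.univ : Finset (Fin (m + 1))) fun j _ =>
      tendstoInMeasure_zero_iff.1 (tendstoInMeasure_truncation_sub hH hH' hξ ha (gridPoint m j) m)
        (ε / 3) hε3
    rw [Finset.sum_const_zero] at h
    exact h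
  filter_upwards [hDlim.eventually_lt_const (half_pos hδ), eventually_ge_atTop m] with n hn hmn
  have hn0 : n ≠ 0 := by omega
  have hm' : (0 : ℝ) < m := by exact_mod_cast hm1
  set O : Fin (m + 1) → Set Ω := fun j => {ω | ∃ i : ℕ, (i : ℝ) ≤ (n : ℝ) / m + 1 ∧
    ε / 3 ≤ |walkSeries H (ξ n) (a n) (L n j + i) ω - walkSeries H (ξ n) (a n) (L n j) ω|} with hO
  have hO_le : ∀ j, P.real (O j) ≤ Q * (1 / (m : ℝ)) ^ (2 * H) / (ε / 3) ^ 2 := fun j =>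
    hQ m n hm1 hmn (ξ n) (hξ n) (a n) (fun k hk => hC n k (by omega) hk) (L n j) _ hε3
  have hT_le : ∀ j, P.real {ω | ε / 3 ≤ |T n j ω|} ≤
      Real.exp (2 * C ^ 2) * (1 / 2) ^ m / (ε / 3) ^ 2 := fun j => by
    refine (measureReal_le_abs_le (integrable_walshSum_sq (hξ n) _) hε3).trans ?_
    gcongr
    rw [mul_comm]
    exact integral_tail_sq_le hH hH' hn0 (hξ n) (fun k hk => hC n k (by omega) hk) _ _
  -- Three sources of error, each allotted `ε / 3`: oscillation after the grid point (`O`), the tail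
  -- of degree above `m` (`T`), and the truncated series against its Hermite form (`D`).
  have hsub : {ω | ENNReal.ofReal ε < edist (stepPath n fun l => walkSeries H (ξ n) (a n) l ω)
      (stepMap m fun j => wickPartialSum a' m ((gridPoint m j : ℝ) ^ (2 * H))
        (∑ i, stoppedCoeff H n ⌊(n : ℝ) * gridPoint m j⌋₊ i * ξ n i ω))} ⊆
      ⋃ j, (O j ∪ {ω | ε / 3 ≤ |T n j ω|} ∪ {ω | ε / 3 ≤ |D n j ω|}) := by
    intro ω hω
    by_contra hc
    refine absurd hω (not_lt.2 (SkorokhodSpace.edist_le_ofReal fun t => ?_))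
    rw [stepMap_apply]
    set j := gridIndex m t with hj
    simp only [mem_iUnion, mem_union, not_exists, not_or] at hc
    obtain ⟨⟨h1, h2⟩, h3⟩ := hc j
    simp only [mem_ofPred_eq, not_le] at h2 h3
    simp only [hO, mem_ofPred_eq, not_exists, not_and, not_le] at h1
    have hle : L n j ≤ ⌊(n : ℝ) * t⌋₊ := Nat.floor_le_floor
      (mul_le_mul_of_nonneg_left (gridPoint_gridIndex_le hm1 t) n.cast_nonneg)
    obtain ⟨i, hi⟩ := Nat.exists_eq_add_of_le hle
    -- The point `t` is within `1 / m` of its grid point, and the two floors cost at most one extra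
    -- step.
    have hi' : (i : ℝ) ≤ (n : ℝ) / m + 1 := by
      have h4 : ((⌊(n : ℝ) * t⌋₊ : ℕ) : ℝ) ≤ n * t :=
        Nat.floor_le (mul_nonneg n.cast_nonneg t.2.1)
      have h5 : (n : ℝ) * gridPoint m j < (L n j : ℝ) + 1 := Nat.lt_floor_add_one _
      have h6 := mul_le_mul_of_nonneg_left (le_gridPoint_gridIndex_add hm1 t)
        (n.cast_nonneg (α := ℝ))
      have h7 : (n : ℝ) * (gridPoint m (gridIndex m t) + 1 / m) =
        n * gridPoint m j + n / m := by rw [← hj]; ring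
      rw [hi] at h4
      push_cast at h4
      linarith
    have h8 := h1 i hi'
    have h9 : walkSeries H (ξ n) (a n) (L n j) ω - wickPartialSum a' m
        ((gridPoint m j : ℝ) ^ (2 * H)) (∑ i, stoppedCoeff H n (L n j) i * ξ n i ω) =
        T n j ω + D n j ω := by
      have : walkSeries H (ξ n) (a n) (L n j) ω = T n j ω + walshSum (ξ n) (fun A =>
          if A.card ≤ m then a n A.card * wickCoeff (stoppedCoeff H n) (L n j) A else 0) ω := by
        simp only [walkSeries, hT, walshSum, ← Finset.sum_add_distrib]
        refine Finset.sum_congr rfl fun A _ => ?_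
        split_ifs <;> ring
      rw [this, hD]
      ring
    have h10 := abs_add_le (T n j ω) (D n j ω)
    rw [← h9] at h10
    have h11 := abs_add_le (walkSeries H (ξ n) (a n) (L n j + i) ω -
      walkSeries H (ξ n) (a n) (L n j) ω) (walkSeries H (ξ n) (a n) (L n j) ω - wickPartialSum a' m
        ((gridPoint m j : ℝ) ^ (2 * H)) (∑ i, stoppedCoeff H n (L n j) i * ξ n i ω))
    rw [sub_add_sub_cancel, ← hi] at h11
    rw [← hi] at h8
    exact h11.trans (by linarith)
  rw [← ofReal_measureReal (measure_ne_top _ _)]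
  refine ENNReal.ofReal_le_ofReal ((measureReal_mono hsub).trans ?_)
  calc P.real (⋃ j, (O j ∪ {ω | ε / 3 ≤ |T n j ω|} ∪ {ω | ε / 3 ≤ |D n j ω|}))
      ≤ ∑ j, P.real (O j ∪ {ω | ε / 3 ≤ |T n j ω|} ∪ {ω | ε / 3 ≤ |D n j ω|}) :=
        measureReal_iUnion_fintype_le _
    _ ≤ ∑ j, ((Q * (1 / (m : ℝ)) ^ (2 * H) / (ε / 3) ^ 2 +
        Real.exp (2 * C ^ 2) * (1 / 2) ^ m / (ε / 3) ^ 2) + P.real {ω | ε / 3 ≤ |D n j ω|}) :=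
        Finset.sum_le_sum fun j _ => (measureReal_union_le _ _).trans (add_le_add
          ((measureReal_union_le _ _).trans (add_le_add (hO_le j) (hT_le j))) le_rfl)
    _ = ((m : ℝ) + 1) * (Q * (1 / (m : ℝ)) ^ (2 * H) + Real.exp (2 * C ^ 2) * (1 / 2) ^ m) /
        (ε / 3) ^ 2 + ∑ j, P.real {ω | ε / 3 ≤ |D n j ω|} := by
        rw [Finset.sum_add_distrib, Finset.sum_const, Finset.card_univ, Fintype.card_fin,
          nsmul_eq_mul]
        push_cast
        ring
    _ ≤ δ / 2 + δ / 2 := add_le_add hm.le hn.le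
    _ = δ := by ring

variable {Ω' : Type*} [MeasurableSpace Ω'] {P' : Measure Ω'} [IsProbabilityMeasure P']
  {B : I → Ω' → ℝ}

theorem abs_rpow_le_one (hH : 0 < H) (t : I) : |(t : ℝ) ^ (2 * H)| ≤ 1 := by
  rw [abs_of_nonneg (Real.rpow_nonneg t.2.1 _)]
  exact Real.rpow_le_one t.2.1 t.2.2 (by positivity)

/-- Step functions of partial sums converge uniformly to a Wick series along a continuous path. -/
theorem tendsto_stepMap_wickPartialSum (hH : 0 < H) {a : ℕ → ℝ} {C : ℝ} (hC : 0 ≤ C)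
    (ha : ∀ k, 1 ≤ k → |a k| ≤ C ^ k) {x : I → ℝ} (hx : Continuous x) {z : SkorokhodSpace}
    (hz : ∀ t, z t = wickSeries a ((t : ℝ) ^ (2 * H)) (x t)) :
    Tendsto (fun m => stepMap m fun j => wickPartialSum a m ((gridPoint m j : ℝ) ^ (2 * H))
      (x (gridPoint m j))) atTop (𝓝 z) := by
  have hcont : Continuous fun t : I => wickSeries a ((t : ℝ) ^ (2 * H)) (x t) :=
    continuous_wickSeries_comp hC ha
      ((Real.continuous_rpow_const (by positivity)).comp continuous_subtype_val) hx
      (abs_rpow_le_one hH)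
  obtain ⟨M, hM⟩ := isCompact_univ.exists_bound_of_continuousOn hx.continuousOn
  obtain ⟨K, hK⟩ := exists_abs_wickSeries_sub_le hC ha M
  rw [EMetric.tendsto_atTop]
  intro ε hε
  obtain ⟨r, hr0, hr⟩ := ENNReal.lt_iff_exists_nnreal_btwn.1 hε
  have hr0' : 0 < (r : ℝ) := by exact_mod_cast hr0
  obtain ⟨δ, hδ, hδ'⟩ := Metric.uniformContinuous_iff.1
    (CompactSpace.uniformContinuous_of_continuous hcont) (r / 2) (half_pos hr0')
  have h1 : ∀ᶠ m : ℕ in atTop, 1 / (m : ℝ) < δ :=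
    tendsto_one_div_atTop_nhds_zero_nat.eventually_lt_const hδ
  have h2 : ∀ᶠ m : ℕ in atTop, K * (1 / 2 : ℝ) ^ m < r / 2 := by
    have h := (tendsto_pow_atTop_nhds_zero_of_lt_one (r := (1 / 2 : ℝ)) (by norm_num)
      (by norm_num)).const_mul K
    rw [mul_zero] at h
    exact h.eventually_lt_const (half_pos hr0')
  obtain ⟨N, hN⟩ := eventually_atTop.1 ((h1.and h2).and (eventually_ge_atTop 1))
  refine ⟨N, fun m hm => ?_⟩
  obtain ⟨⟨h3, h4⟩, h5⟩ := hN m hm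
  refine lt_of_le_of_lt (SkorokhodSpace.edist_le_ofReal (r := r) fun t => ?_)
    (by rwa [ENNReal.ofReal_coe_nnreal])
  rw [stepMap_apply, hz]
  set s := gridPoint m (gridIndex m t)
  have h6 : dist s t < δ := by
    rw [Subtype.dist_eq, Real.dist_eq]
    refine lt_of_le_of_lt ?_ h3
    have h7 := gridPoint_gridIndex_le h5 t
    have h8 := le_gridPoint_gridIndex_add h5 t
    rw [abs_le]
    constructor <;> linarith
  have h7 := hδ' h6
  rw [Real.dist_eq] at h7
  have h8 := hK m ((s : ℝ) ^ (2 * H)) (x s) (abs_rpow_le_one hH s) (hM s (mem_univ s))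
  rw [abs_sub_comm] at h8
  have h9 := abs_add_le (wickPartialSum a m ((s : ℝ) ^ (2 * H)) (x s) -
    wickSeries a ((s : ℝ) ^ (2 * H)) (x s)) (wickSeries a ((s : ℝ) ^ (2 * H)) (x s) -
    wickSeries a ((t : ℝ) ^ (2 * H)) (x t))
  rw [sub_add_sub_cancel] at h9
  have h10 : |wickPartialSum a m ((s : ℝ) ^ (2 * H)) (x s) -
    wickSeries a ((s : ℝ) ^ (2 * H)) (x s)| ≤ K * (1 / 2) ^ m := h8
  linarith

/-- Weak convergence of the Wick series of the disturbed random walk to that of fractional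
Brownian motion. -/
theorem exists_tendstoInDistribution_walkSeries (hH : 1 / 2 < H) (hH' : H < 1)
    (hξ : ∀ n, IsSymmetricBernoulli (ξ n) P) (hB : IsFractionalBrownianMotion H B P')
    {a : ℕ → ℕ → ℝ} {a' : ℕ → ℝ} {C : ℝ} (hC : 0 ≤ C)
    (ha : ∀ k, Tendsto (fun n => a n k) atTop (𝓝 (a' k)))
    (haC : ∀ n k, 1 ≤ n → 1 ≤ k → |a n k| ≤ C ^ k) :
    ∃ Z : Ω' → SkorokhodSpace,
      (∀ᵐ ω ∂P', ∀ t, HasSum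
        (fun k => a' k / (k.factorial : ℝ) * wickPow P' (B t) k ω) (Z ω t)) ∧
      TendstoInDistribution (fun n ω => stepPath n fun l => walkSeries H (ξ n) (a n) l ω)
        atTop Z (fun _ => P) P' := by
  have hH0 : 0 < H := by linarith
  have haC' : ∀ k, 1 ≤ k → |a' k| ≤ C ^ k := fun k hk =>
    le_of_tendsto (ha k).abs ((eventually_ge_atTop 1).mono fun n hn => haC n k hn hk)
  -- On the null set of discontinuous paths the limit is set to the zero path.
  have hex : ∀ ω, ∃ z : SkorokhodSpace, Continuous (fun t => B t ω) →
      ∀ t : I, z t = wickSeries a' ((t : ℝ) ^ (2 * H)) (B t ω) := fun ω => by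
    by_cases h : Continuous fun t => B t ω
    · exact ⟨.ofContinuous _ (continuous_wickSeries_comp hC haC'
        ((Real.continuous_rpow_const (by positivity)).comp continuous_subtype_val) h
        (abs_rpow_le_one hH0)), fun _ t => rfl⟩
    · exact ⟨.ofContinuous _ continuous_zero, fun h' => absurd h' h⟩
  choose Z hZ using hex
  refine ⟨Z, ?_, ?_⟩
  · filter_upwards [hB.continuous] with ω hω t
    rw [hZ ω hω t]
    simp only [wickPow_eq_wickPoly, hB.integral_sq hH0]
    exact hasSum_wickSeries hC haC' (abs_rpow_le_one hH0 t) _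
  · have hg : ∀ m, Continuous fun y : Fin (m + 1) → ℝ => stepMap m fun j =>
        wickPartialSum a' m ((gridPoint m j : ℝ) ^ (2 * H)) (y j) := fun m =>
      (continuous_stepMap m).comp (continuous_pi fun j =>
        (continuous_wickPartialSum a' m _).comp (continuous_apply j))
    have hlim : ∀ᵐ ω ∂P', Tendsto (fun m => stepMap m fun j =>
        wickPartialSum a' m ((gridPoint m j : ℝ) ^ (2 * H)) (B (gridPoint m j) ω)) atTop
        (𝓝 (Z ω)) := by
      filter_upwards [hB.continuous] with ω hω
      exact tendsto_stepMap_wickPartialSum hH0 hC haC' hω (hZ ω hω)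
    have hmeas : ∀ m, AEMeasurable (fun ω => stepMap m fun j =>
        wickPartialSum a' m ((gridPoint m j : ℝ) ^ (2 * H)) (B (gridPoint m j) ω)) P' := fun m =>
      (hg m).measurable.comp_aemeasurable
        (aemeasurable_pi_lambda _ fun j => hB.aemeasurable (gridPoint m j))
    -- `Z` is chosen pointwise; its measurability comes from being an almost sure limit of
    -- measurable step paths.
    refine tendstoInDistribution_of_approximation (fun n => ?_)
      (fun m => (tendstoInDistribution_walk hH hH' hξ hB (gridPoint m)).continuous_comp (hg m))
      (tendstoInDistribution_of_ae_tendsto hmeas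
        (aemeasurable_of_tendsto_metrizable_ae atTop hmeas hlim) hlim)
      fun ε hε δ hδ => eventually_measure_approximation_le hH hH' hξ ha haC hε hδ
    simp only [stepPath_eq_stepMap]
    exact ((continuous_stepMap n).measurable.comp (measurable_pi_lambda _ fun j =>
      measurable_walshSum (hξ n) _)).aemeasurable

end Convergence

end WickFBM

/-! ### The main theorem. -/

theorem theorem3p2
    {Ω Ω' : Type*} [MeasurableSpace Ω] [MeasurableSpace Ω']
    (P : MeasureTheory.Measure Ω) [MeasureTheory.IsProbabilityMeasure P]
    (P' : MeasureTheory.Measure Ω') [MeasureTheory.IsProbabilityMeasure P']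
    (H : ℝ) (hH : H ∈ Set.Ioo (1 / 2 : ℝ) 1)
    (ξ : (n : ℕ) → Fin n → Ω → ℝ) (hξ : ∀ n, WickFBM.IsSymmetricBernoulli (ξ n) P)
    (B : unitInterval → Ω' → ℝ) (hB : WickFBM.IsFractionalBrownianMotion H B P') :
    (∀ (a : ℕ → ℕ → ℝ) (a' : ℕ → ℝ) (C : ℝ), 0 ≤ C →
      (∀ k, Filter.Tendsto (fun n => a n k) Filter.atTop (nhds (a' k))) →
      (∀ n k, 1 ≤ n → 1 ≤ k → |a n k| ≤ C ^ k) →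
      ∃ Z : Ω' → WickFBM.SkorokhodSpace,
        (∀ᵐ ω ∂P', ∀ t, HasSum
          (fun k => a' k / (k.factorial : ℝ) * WickFBM.wickPow P' (B t) k ω) (Z ω t)) ∧
        MeasureTheory.TendstoInDistribution
          (fun (n : ℕ) (ω : Ω) => WickFBM.stepPath n (fun l =>
            ∑ k ∈ Finset.range (n + 1),
              a n k / (k.factorial : ℝ) * WickFBM.wickU P H (ξ n) k l ω))
          Filter.atTop Z (fun _ => P) P') ∧
    (∃ Z : Ω' → WickFBM.SkorokhodSpace,
      (∀ᵐ ω ∂P', ∀ t : unitInterval, Z ω t = Real.exp (B t ω - (t : ℝ) ^ (2 * H) / 2)) ∧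
      MeasureTheory.TendstoInDistribution
        (fun (n : ℕ) (ω : Ω) => WickFBM.stepPath n (fun l => WickFBM.wickEuler P H (ξ n) l ω))
        Filter.atTop Z (fun _ => P) P') := by
  have hpath : ∀ (n : ℕ) (u w : ℕ → ℝ), (∀ l ≤ n, u l = w l) →
      WickFBM.stepPath n u = WickFBM.stepPath n w := fun n u w h =>
    WickFBM.SkorokhodSpace.ext (funext fun t => h _ (WickFBM.floor_mul_le n t))
  have hdef : (default : Finset (Fin 0)) = ∅ := Subsingleton.elim _ _
  constructor
  · intro a a' C hC ha haC
    obtain ⟨Z, hZ, hlim⟩ :=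
      WickFBM.exists_tendstoInDistribution_walkSeries hH.1 hH.2 hξ hB hC ha haC
    refine ⟨Z, hZ, ?_⟩
    refine hlim.congr (fun n => ae_of_all _ fun ω => hpath _ _ _ fun l hl => ?_) (ae_eq_refl Z)
    -- The Walsh expansion of the walk requires `n ≠ 0`; for `n = 0` only `l = 0` and `A = ∅` occur,
    -- and both sides are `a 0 0`.
    rcases Nat.eq_zero_or_pos n with rfl | hn
    · obtain rfl : l = 0 := by omega
      simp [WickFBM.walkSeries, WickFBM.walshSum, WickFBM.wickU, WickFBM.walsh,
        WickFBM.wickCoeff_empty, Finset.univ_unique, hdef]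
    · rw [WickFBM.sum_wickU_eq_walshSum (hξ n) hn.ne' (a n) l ω]
      simp only [WickFBM.wickCoeff_walkCoeff hl]
      rfl
  · obtain ⟨Z, hZ, hlim⟩ :=
      -- With all coefficients `1` the Walsh series is the Wick–Euler scheme, and uniqueness of sums
      -- identifies the limit with the Wick exponential.
      WickFBM.exists_tendstoInDistribution_walkSeries (a := fun _ _ => 1) (a' := fun _ => 1)
        hH.1 hH.2 hξ hB zero_le_one (fun _ => tendsto_const_nhds) (fun _ _ _ _ => by simp)
    refine ⟨Z, ?_, ?_⟩
    · filter_upwards [hZ] with ω hω t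
      refine (hω t).unique ?_
      have h := WickFBM.hasSum_wickPoly ((t : ℝ) ^ (2 * H)) (B t ω)
      have hH0 : 0 < H := by linarith [hH.1]
      simp only [WickFBM.wickPow_eq_wickPoly, hB.integral_sq hH0, one_div_mul_eq_div]
      exact h
    · refine hlim.congr (fun n => ae_of_all _ fun ω => hpath _ _ _ fun l hl => ?_) (ae_eq_refl Z)
      rcases Nat.eq_zero_or_pos n with rfl | hn
      · obtain rfl : l = 0 := by omega
        simp [WickFBM.walkSeries, WickFBM.walshSum, WickFBM.wickEuler, WickFBM.walsh,
          WickFBM.wickCoeff_empty, Finset.univ_unique, hdef]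
      · rw [WickFBM.wickEuler_eq_walshSum (hξ n) hn.ne' l]
        simp only [WickFBM.walkSeries, one_mul, WickFBM.walshSum, WickFBM.wickCoeff_walkCoeff hl]
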